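/- Let $k\ge 2$. A $k$-SAT formula $F$ with $M$ clauses over $N$ boolean variables is a sequence of $M$ clauses, each the disjunction of $k$ literals on distinct variables; it is \emph{random} if the clauses are chosen independently and uniformly among the $2^k\binom Nk$ possible ones. For an assignment $x\in\{0,1\}^N$ let $E(x)$ be the number of violated clauses, and for $\beta\in\mathbb R$ let $Z_N(\beta,F)=\sum_{x\in\{0,1\}^N}e^{-\beta E(x)}$. Let $\alpha_*(k)$ be the smallest positive root of $\kappa(\alpha)=1$, where $$\kappa(\alpha)=k(k-1)\,\alpha\left(1-\tfrac14e^{-k\alpha/2}\right)\left(1-\tfrac12e^{-k\alpha/2}\right)^{k-2}.$$ Define $\Phi(\beta,F)$ as follows. For a clause $a$ let $\partial a$ be the set of its variables, and for $i\in\partial a$ let $\partial_+i(a)$ (respectively $\partial_-i(a)$) be the set of clauses $b\ne a$ that contain the variable $i$ with the same (respectively the opposite) sign as $a$. Belief propagation at inverse temperature $\beta$ starts from $h^{(0)}_{i\to a}=0$ and iterates $$u^{(t)}_{a\to i}=-\tfrac12\log\Big\{1-\frac{1-e^{-\beta}}{2^{k-1}}\prod_{j\in\partial a\setminus i}\big(1-\tanh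 h^{(t)}_{j\to a}\big)\Big\},\qquad h^{(t+1)}_{i\to a}=\sum_{b\in\partial_+i(a)}u^{(t)}_{b\to i}-\sum_{b\in\partial_-i(a)}u^{(t)}_{b\to i}.$$ The number of iterations is the diameter of the bipartite graph that joins each clause to its variables (the greatest distance between two nodes of the same connected component). With the final messages $h_{i\to a}$, with $E_a(x_{\partial a})\in\{0,1\}$ the indicator that $a$ is violated, and with $\sigma_{ai}(x_i)=1$ if $x_i$ satisfies $a$ and $-1$ otherwise, put $$\langle E\rangle_{\mathrm{BP},\beta}=\sum_a\frac{\sum_{x_{\partial a}}E_a(x_{\partial a})\exp\{-\beta E_a(x_{\partial a})+\sum_{i\in\partial a}h_{i\to a}\sigma_{ai}(x_i)\}}{\sum_{x_{\partial a}}\exp\{-\beta E_a(x_{\partial a})+\sum_{i\in\partial a}h_{i\to a}\sigma_{ai}(x_i)\}}.$$ Interpolating in $\beta$, put $$\Phi(\beta,F)=N\log 2-\sum_{i=0}^{N^2-1}\frac{\beta}{N^2}\,\langle E\rangle_{\mathrm{BP},\,i\beta/N^2}.$$ Then: (1) There are a deterministic algorithm and a polynomial $P$, both depending only on $k$, such that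 for all $N$, $M$, every formula $F$ with $M$ clauses over $N$ variables and every $\beta\in\mathbb R$, the algorithm on input $(\beta,F)$ outputs $\Phi(\beta,F)$ after at most $P(N+M)$ steps. The model of computation is a random access machine with memory for natural and for real numbers, in which each of the following is one step: addition, truncated subtraction and comparison of natural numbers; conversion of a natural number to a real one; the field operations, $\exp$, $\log$ and comparison of real numbers. (2) For every $\varepsilon>0$ and every $\alpha$ with $0\le\alpha<\alpha_*(k)$ there is $\delta'>0$ such that, for every sequence $\beta_N\in[0,N^{\delta'}]$ and for $F$ a random $k$-SAT formula with $\lfloor\alpha N\rfloor$ clauses over $N$ variables, with probability tending to $1$ as $N\to\infty$, $$\Phi(\beta_N,F)\,(1-\varepsilon)\ \le\ \log Z_N(\beta_N,F)\ \le\ \Phi(\beta_N,F)\,(1+\varepsilon).$$ -/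

import Mathlib

open Finset Filter Topology

/-! ## Random k-SAT formulas and the partition function -/

namespace KSat

/-- A `k`-clause over the variables `x_0, …, x_{N-1}`, written `z_1 ∨ … ∨ z_k`: the (pairwise
distinct) variables of its literals, and for each literal whether it is non-negated (`true`) or
negated (`false`). Every unordered clause is written in exactly `k!` ways, so a uniformly random
element of this type is a uniformly random one of the `2 ^ k * N.choose k` unordered clauses;
nothing defined below depends on the order of the literals. -/
abbrev Clause (k N : ℕ) : Type := (Fin k ↪ Fin N) × (Fin k → Bool)

/-- A formula with `M` clauses over `N` variables. -/
abbrev Formula (k N M : ℕ) : Type := Fin M → Clause k N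

variable {k N M : ℕ}

/-- The variable of the `j`-th literal of clause `a`. -/
def Formula.var (F : Formula k N M) (a : Fin M) (j : Fin k) : Fin N := (F a).1 j

/-- The sign of the `j`-th literal of clause `a`: `true` if it is not negated. -/
def Formula.sign (F : Formula k N M) (a : Fin M) (j : Fin k) : Bool := (F a).2 j

/-- `E(x)`: the number of clauses of `F` that the assignment `x` violates. -/
def energy (F : Formula k N M) (x : Fin N → Bool) : ℕ :=
  #{a : Fin M | ∀ j : Fin k, x (F.var a j) ≠ F.sign a j}

/-- The partition function `Z_N(β, F)`. -/
noncomputable def partitionFunction (β : ℝ) (F : Formula k N M) : ℝ :=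
  ∑ x : Fin N → Bool, Real.exp (-β * energy F x)

/-- The probability of a property of a random `k`-SAT formula, whose `M` clauses are chosen
independently and uniformly; that is, `F` is uniform on `Formula k N M`. -/
noncomputable def prob (k N M : ℕ) (P : Formula k N M → Prop) : ℝ :=
  (Nat.card {F : Formula k N M // P F} : ℝ) / (Nat.card (Formula k N M) : ℝ)

/-- The function `κ` of `α`. -/
noncomputable def kappa (k : ℕ) (α : ℝ) : ℝ :=
  k * (k - 1) * α * (1 - 1 / 4 * Real.exp (-(k * α / 2))) *
    (1 - 1 / 2 * Real.exp (-(k * α / 2))) ^ (k - 2)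

/-- `α_*(k)`: the smallest positive root of `κ(α) = 1` (see `isLeast_alphaStar`). -/
noncomputable def alphaStar (k : ℕ) : ℝ := sInf {α : ℝ | 0 < α ∧ kappa k α = 1}

theorem isLeast_alphaStar {k : ℕ} (hk : 2 ≤ k) :
    IsLeast {α : ℝ | 0 < α ∧ kappa k α = 1} (alphaStar k) := by
  have hk' : (2 : ℝ) ≤ k := by exact_mod_cast hk
  have hcont : Continuous (kappa k) := by unfold kappa; fun_prop
  have h0 : kappa k 0 = 0 := by simp [kappa]
  have hS : {α : ℝ | 0 < α ∧ kappa k α = 1} = Set.Ici 0 ∩ kappa k ⁻¹' {1} := by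
    ext α
    simp only [Set.mem_ofPred_eq, Set.mem_inter_iff, Set.mem_Ici, Set.mem_preimage,
      Set.mem_singleton_iff]
    refine ⟨fun h => ⟨h.1.le, h.2⟩, fun h => ⟨lt_of_le_of_ne h.1 ?_, h.2⟩⟩
    rintro rfl
    rw [h0] at h
    exact zero_ne_one h.2
  have h1 : 1 ≤ kappa k 1 := by
    have he : Real.exp (-(k * 1 / 2 : ℝ)) ≤ 2 / (k + 2) := by
      rw [Real.exp_neg, inv_le_comm₀ (Real.exp_pos _) (by positivity), inv_div]
      have := Real.add_one_le_exp (k * 1 / 2 : ℝ)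
      linarith
    have hp := Real.exp_pos (-(k * 1 / 2 : ℝ))
    have he1 : Real.exp (-(k * 1 / 2 : ℝ)) ≤ 1 := Real.exp_le_one_iff.mpr (by linarith)
    set e := Real.exp (-(k * 1 / 2 : ℝ)) with hedef
    have hb : 1 + ((k - 2 : ℕ) : ℝ) * (-(1 / 2 * e)) ≤ (1 + -(1 / 2 * e)) ^ (k - 2) :=
      one_add_mul_le_pow (by linarith) _
    rw [Nat.cast_sub hk] at hb
    have hmul : e * (k + 2) ≤ 2 := by rwa [le_div_iff₀ (by positivity)] at he
    have hq : 4 / (k + 2 : ℝ) ≤ (1 - 1 / 2 * e) ^ (k - 2) := by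
      rw [← sub_eq_add_neg] at hb
      refine le_trans ?_ hb
      rw [div_le_iff₀ (by positivity)]
      push_cast
      nlinarith
    have : kappa k 1 = k * (k - 1) * (1 - 1 / 4 * e) * (1 - 1 / 2 * e) ^ (k - 2) := by
      simp [kappa, hedef]
    rw [this]
    calc (1 : ℝ) ≤ k * (k - 1) * (3 / 4) * (4 / (k + 2)) := by
          rw [mul_div_assoc', le_div_iff₀ (by positivity)]
          nlinarith
      _ ≤ _ := by
          have : (0 : ℝ) ≤ k * (k - 1) := by nlinarith
          have h3 : (3 / 4 : ℝ) ≤ 1 - 1 / 4 * e := by linarith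
          gcongr
  have hne : {α : ℝ | 0 < α ∧ kappa k α = 1}.Nonempty := by
    obtain ⟨x, hx, hx1⟩ := intermediate_value_Icc (zero_le_one' ℝ) hcont.continuousOn
      (show (1 : ℝ) ∈ Set.Icc (kappa k 0) (kappa k 1) from ⟨by rw [h0]; exact zero_le_one, h1⟩)
    rw [hS]
    exact ⟨x, hx.1, hx1⟩
  have hbdd : BddBelow {α : ℝ | 0 < α ∧ kappa k α = 1} := ⟨0, fun _ h => h.1.le⟩
  have hclosed : IsClosed {α : ℝ | 0 < α ∧ kappa k α = 1} := by
    rw [hS]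
    exact isClosed_Ici.inter (isClosed_singleton.preimage hcont)
  exact hclosed.isLeast_csInf hne hbdd

/-! ## Belief propagation and interpolation in `β` -/

/-- The factor graph: variable nodes, clause nodes, and an edge between a variable and every
clause that contains it. -/
def factorGraph (F : Formula k N M) : SimpleGraph (Fin N ⊕ Fin M) :=
  SimpleGraph.fromRel fun u v => ∃ a j, u = Sum.inl (F.var a j) ∧ v = Sum.inr a

/-- The diameter of the factor graph: the greatest distance between two nodes of the same
connected component (`SimpleGraph.dist` is `0` on pairs of nodes that are not connected). -/
noncomputable def diameter (F : Formula k N M) : ℕ :=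
  univ.sup fun p : (Fin N ⊕ Fin M) × (Fin N ⊕ Fin M) => (factorGraph F).dist p.1 p.2

/-- One real number for every edge `(a, j)` of the factor graph, that is, for every clause `a` and
position `j` of a literal in it. -/
abbrev Messages (k M : ℕ) : Type := Fin M → Fin k → ℝ

/-- The function `f` of the variables `y i`, `i ∈ s`. -/
noncomputable def messageFun {ι : Type} (β : ℝ) (s : Finset ι) (y : ι → ℝ) : ℝ :=
  -(1 / 2) * Real.log (1 - (1 - Real.exp (-β)) / 2 ^ #s * ∏ i ∈ s, (1 - Real.tanh (y i)))

/-- The message `u_{a → i}`, `i` the variable of the `j`-th literal of `a`, computed from the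
messages `h_{· → a}` of the other variables of `a`. -/
noncomputable def clauseMessage (β : ℝ) (h : Messages k M) : Messages k M :=
  fun a j => messageFun β (univ.erase j) (h a)

/-- `∂₊ i(a)` (as a set of edges): the occurrences in other clauses of the literal at place `j` of
clause `a`, `i` being its variable. -/
def agreeing (F : Formula k N M) (a : Fin M) (j : Fin k) : Finset (Fin M × Fin k) :=
  {e | e.1 ≠ a ∧ F.var e.1 e.2 = F.var a j ∧ F.sign e.1 e.2 = F.sign a j}

/-- `∂₋ i(a)`: the occurrences in other clauses of the negation of that literal. -/
def disagreeing (F : Formula k N M) (a : Fin M) (j : Fin k) : Finset (Fin M × Fin k) :=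
  {e | e.1 ≠ a ∧ F.var e.1 e.2 = F.var a j ∧ F.sign e.1 e.2 ≠ F.sign a j}

/-- One iteration of belief propagation, on the messages `h_{i → a}`. -/
noncomputable def bpStep (β : ℝ) (F : Formula k N M) (h : Messages k M) : Messages k M :=
  fun a j => ∑ e ∈ agreeing F a j, clauseMessage β h e.1 e.2 -
    ∑ e ∈ disagreeing F a j, clauseMessage β h e.1 e.2

/-- The messages `h_{i → a}` after `diameter F` iterations started from `0`. -/
noncomputable def bpMessages (β : ℝ) (F : Formula k N M) : Messages k M :=
  (bpStep β F)^[diameter F] 0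

/-- `σ_{ai}`: `1` if giving the variable of the `j`-th literal of `a` the value `v` satisfies the
clause, and `-1` otherwise. -/
def spin (F : Formula k N M) (a : Fin M) (j : Fin k) (v : Bool) : ℝ :=
  if v = F.sign a j then 1 else -1

/-- `E_a`, as a function of the values of the variables of clause `a`: `1` if the clause is
violated and `0` otherwise. -/
def clauseEnergy (F : Formula k N M) (a : Fin M) (x : Fin k → Bool) : ℝ :=
  if ∀ j, x j ≠ F.sign a j then 1 else 0

/-- The weight that belief propagation gives to the values `x` of the variables of clause `a`. -/
noncomputable def bpWeight (β : ℝ) (F : Formula k N M) (a : Fin M) (x : Fin k → Bool) : ℝ :=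
  Real.exp (-β * clauseEnergy F a x + ∑ j, bpMessages β F a j * spin F a j (x j))

/-- The belief propagation estimate of the expectation of `E_a`. -/
noncomputable def bpClauseEnergy (β : ℝ) (F : Formula k N M) (a : Fin M) : ℝ :=
  (∑ x : Fin k → Bool, clauseEnergy F a x * bpWeight β F a x) /
    ∑ x : Fin k → Bool, bpWeight β F a x

/-- The belief propagation estimate of the expectation of `E`. -/
noncomputable def bpEnergy (β : ℝ) (F : Formula k N M) : ℝ :=
  ∑ a : Fin M, bpClauseEnergy β F a

/-- `Φ(β, F)`: the interpolation estimate of `log Z_N(β, F)`, with the `N ^ 2` inverse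
temperatures `i β / N ^ 2`. -/
noncomputable def bpLogPartition (β : ℝ) (F : Formula k N M) : ℝ :=
  N * Real.log 2 -
    ∑ i ∈ range (N ^ 2), β / (N : ℝ) ^ 2 * bpEnergy (i * β / (N : ℝ) ^ 2) F

end KSat

/-! ## Deterministic algorithms over the reals, with a step count

A random access machine with finitely many memory banks of natural numbers and finitely many
memory banks of real numbers, programmed in a structured language. Every operation has unit cost.
On natural numbers there are only addition, truncated subtraction and comparison, so numbers grow
by at most one bit per step; on real numbers there are the field operations, `exp`, `log` and
comparison. There are no real constants, and no rounding. -/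

namespace RealRAM

/-- The contents of the memory: bank number, address, value. -/
structure State where
  nat : ℕ → ℕ → ℕ
  real : ℕ → ℕ → ℝ

/-- Expressions of natural-number type; `get b i` reads address `i` of bank `b`. -/
inductive NExpr where
  | lit (n : ℕ)
  | get (b : ℕ) (i : NExpr)
  | add (e₁ e₂ : NExpr)
  | sub (e₁ e₂ : NExpr)

/-- Expressions of real type. -/
inductive RExpr where
  | ofNat (e : NExpr)
  | get (b : ℕ) (i : NExpr)
  | add (e₁ e₂ : RExpr)
  | sub (e₁ e₂ : RExpr)
  | mul (e₁ e₂ : RExpr)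
  | div (e₁ e₂ : RExpr)
  | exp (e : RExpr)
  | log (e : RExpr)

/-- Tests. -/
inductive Test where
  | natLt (e₁ e₂ : NExpr)
  | realLt (e₁ e₂ : RExpr)

/-- Programs. -/
inductive Program where
  | skip
  | setNat (b : ℕ) (i : NExpr) (e : NExpr)
  | setReal (b : ℕ) (i : NExpr) (e : RExpr)
  | seq (p q : Program)
  | ite (c : Test) (p q : Program)
  | while (c : Test) (p : Program)

def NExpr.eval (s : State) : NExpr → ℕ
  | lit n => n
  | get b i => s.nat b (i.eval s)
  | add e₁ e₂ => e₁.eval s + e₂.eval s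
  | sub e₁ e₂ => e₁.eval s - e₂.eval s

/-- The number of operations in an expression. -/
def NExpr.cost : NExpr → ℕ
  | lit _ => 1
  | get _ i => i.cost + 1
  | add e₁ e₂ => e₁.cost + e₂.cost + 1
  | sub e₁ e₂ => e₁.cost + e₂.cost + 1

noncomputable def RExpr.eval (s : State) : RExpr → ℝ
  | ofNat e => (e.eval s : ℝ)
  | get b i => s.real b (i.eval s)
  | add e₁ e₂ => e₁.eval s + e₂.eval s
  | sub e₁ e₂ => e₁.eval s - e₂.eval s
  | mul e₁ e₂ => e₁.eval s * e₂.eval s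
  | div e₁ e₂ => e₁.eval s / e₂.eval s
  | exp e => Real.exp (e.eval s)
  | log e => Real.log (e.eval s)

def RExpr.cost : RExpr → ℕ
  | ofNat e => e.cost + 1
  | get _ i => i.cost + 1
  | add e₁ e₂ => e₁.cost + e₂.cost + 1
  | sub e₁ e₂ => e₁.cost + e₂.cost + 1
  | mul e₁ e₂ => e₁.cost + e₂.cost + 1
  | div e₁ e₂ => e₁.cost + e₂.cost + 1
  | exp e => e.cost + 1
  | log e => e.cost + 1

def Test.Holds (s : State) : Test → Prop
  | natLt e₁ e₂ => e₁.eval s < e₂.eval s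
  | realLt e₁ e₂ => e₁.eval s < e₂.eval s

def Test.cost : Test → ℕ
  | natLt e₁ e₂ => e₁.cost + e₂.cost + 1
  | realLt e₁ e₂ => e₁.cost + e₂.cost + 1

/-- Write `v` to address `i` of bank `b` of natural numbers. -/
def State.writeNat (s : State) (b i v : ℕ) : State :=
  { s with nat := Function.update s.nat b (Function.update (s.nat b) i v) }

/-- Write `v` to address `i` of bank `b` of real numbers. -/
noncomputable def State.writeReal (s : State) (b i : ℕ) (v : ℝ) : State :=
  { s with real := Function.update s.real b (Function.update (s.real b) i v) }

/-- `Exec p s t s'`: started in state `s`, the program `p` halts in state `s'` after `t` steps. -/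
inductive Exec : Program → State → ℕ → State → Prop where
  | skip (s : State) : Exec .skip s 1 s
  | setNat (s : State) (b : ℕ) (i e : NExpr) :
      Exec (.setNat b i e) s (i.cost + e.cost + 1) (s.writeNat b (i.eval s) (e.eval s))
  | setReal (s : State) (b : ℕ) (i : NExpr) (e : RExpr) :
      Exec (.setReal b i e) s (i.cost + e.cost + 1) (s.writeReal b (i.eval s) (e.eval s))
  | seq {p q : Program} {s s' s'' : State} {t t' : ℕ} :
      Exec p s t s' → Exec q s' t' s'' → Exec (.seq p q) s (t + t') s''
  | iteTrue {c : Test} {p q : Program} {s s' : State} {t : ℕ} :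
      c.Holds s → Exec p s t s' → Exec (.ite c p q) s (c.cost + t + 1) s'
  | iteFalse {c : Test} {p q : Program} {s s' : State} {t : ℕ} :
      ¬ c.Holds s → Exec q s t s' → Exec (.ite c p q) s (c.cost + t + 1) s'
  | whileTrue {c : Test} {p : Program} {s s' s'' : State} {t t' : ℕ} :
      c.Holds s → Exec p s t s' → Exec (.while c p) s' t' s'' →
        Exec (.while c p) s (c.cost + t + t' + 1) s''
  | whileFalse {c : Test} {p : Program} {s : State} :
      ¬ c.Holds s → Exec (.while c p) s (c.cost + 1) s

/-- Started in state `s`, the program halts after at most `T` steps with the number `y` at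
address `0` of real bank `0`. -/
def Program.OutputsWithin (p : Program) (s : State) (T : ℕ) (y : ℝ) : Prop :=
  ∃ t s', Exec p s t s' ∧ t ≤ T ∧ s'.real 0 0 = y

end RealRAM

/-- The memory that holds the input `(β, F)`. Natural bank `0`: `N` and `M` at addresses `0` and
`1`; natural bank `1`: the variable of the `j`-th literal of clause `a` at address `k * a + j`;
natural bank `2`: there, `1` if that literal is not negated and `0` if it is; real bank `0`: `β` at
address `0`. Everything else is `0`. -/
noncomputable def KSat.inputState {k N M : ℕ} (β : ℝ) (F : KSat.Formula k N M) :
    RealRAM.State where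
  nat b i :=
    if b = 0 then (if i = 0 then N else if i = 1 then M else 0)
    else if h : i < M * k then
      if b = 1 then (F.var (Fin.divNat ⟨i, h⟩) (Fin.modNat ⟨i, h⟩) : ℕ)
      else if b = 2 then (F.sign (Fin.divNat ⟨i, h⟩) (Fin.modNat ⟨i, h⟩)).toNat
      else 0
    else 0
  real b i := if b = 0 ∧ i = 0 then β else 0

/-!
# Belief propagation and the partition function of random k-SAT

**Approximation.** The derivative of `log Z` in the inverse temperature is minus the expected energy
in the Gibbs measure, and `log Z` is convex in `β`; so summing the exact energies at `N ^ 2` inverse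
temperatures gives `log Z` up to `β M / N ^ 2`. What has to be compared is the Gibbs expectation of
the energy of a clause with its estimate by belief propagation (`abs_bpLogPartition_sub_le`).

Around a clause without short *lassos* (walks through distinct clauses that then return to a
variable of an earlier one), the factor graph is a tree up to some radius. There, given the values
of the variables outside, the variables can be summed out from the leaves, and belief propagation
started from suitable messages at the boundary computes the conditional expectation of the energy
exactly (`sum_violation_mul_pin`). So the error of the estimate is at most the effect of the
boundary messages on the root (`abs_gibbs_sub_bp_le`). If the diameter is smaller than the radius,
no walk reaches the boundary, and the number of iterations does no harm
(`influence_diameter_eq_zero`).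

This effect decays uniformly in `β`. The message of a clause is Lipschitz in the fields on the other
literals, with a constant `∏ σ`, where `σ = 1 / 2` for a literal whose negation does not occur
elsewhere, as such a literal is always in a nonnegative field, and `σ = 1` otherwise
(`abs_messageFun_sub_le`). Hence the effect is at most `β` times the *influence*, a sum over walks
of products of dampings that does not involve `β`. In a random formula, the literals along a walk
miss their negations almost independently, each with probability about `q = exp (-kα/2)`; per
passage, the `k - 2` literals aside contribute `1 - q / 2` each, and the literal at the exit
contributes `1 - q / 4`, since the walk itself continues to its negation with probability `1 / 2`.
With `k (k - 1) α` continuations per passage, the expected influence at distance `n` is about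
`κ(α) ^ n` (`expect_influence_le`), and `κ(α) < 1` below `α_*`. The expected number of clauses near short
lassos is at most exponential in the radius, independently of `N` (`expect_lassoCount_le`).

To turn absolute errors into relative ones, `log Z` must be of order `N`. As `α_* ≤ 1`
(`alphaStar_le_one`), there are fewer clauses than variables; keeping two literals of each clause
leaves a 2-SAT formula in which the expected number of lassos among the chains of implications is
bounded, and removing a clause from each lasso makes it satisfiable. So the expected minimal energy
is bounded (`exists_energy_le`, `exists_bound_expect_lassos`), and as each satisfied clause has to
fix one variable only, `log Z ≥ (N - M) log 2 - β E` for an assignment of energy `E`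
(`log_partitionFunction_ge`). Markov's inequality (`one_sub_le_prob`) concludes, with a radius that
is a small multiple of `log N` and `β` at most a still smaller power of `N`.

**Algorithm.** `RealRAM.Cmd` is a language of programs with bounded loops, whose effect is a
function on states and whose compiled form runs in polynomial time (`Cmd.exec_compile`). In this
language, the distances in the factor graph are found by relaxing all edges as often as there are
nodes (`run_diameterCmd`), and belief propagation and the sum over the inverse temperatures are
nested loops over the edges (`run_logPartitionCmd`).
-/

open scoped BigOperators

/-! ### Lipschitz bounds for the message functions -/

namespace KSat

variable {k N M : ℕ}

/-- The probability `(1 - tanh y) / 2` that a spin in the field `y` does not satisfy the literal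
towards which the field points. -/
noncomputable def unsat (y : ℝ) : ℝ := (1 + Real.exp (2 * y))⁻¹

lemma one_sub_tanh (y : ℝ) : 1 - Real.tanh y = 2 * unsat y := by
  have h : Real.exp (2 * y) = Real.exp y * Real.exp y := by rw [← Real.exp_add]; ring_nf
  have h1 : Real.exp (-y) = (Real.exp y)⁻¹ := Real.exp_neg y
  have := Real.exp_pos y
  rw [Real.tanh_eq, unsat, h, h1]
  field_simp
  ring

lemma unsat_pos (y : ℝ) : 0 < unsat y := by unfold unsat; positivity

lemma unsat_lt_one (y : ℝ) : unsat y < 1 := by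
  unfold unsat
  exact inv_lt_one_of_one_lt₀ (by linarith [Real.exp_pos (2 * y)])

lemma unsat_le_half {y : ℝ} (hy : 0 ≤ y) : unsat y ≤ 1 / 2 := by
  unfold unsat
  have : 1 ≤ Real.exp (2 * y) := Real.one_le_exp (by linarith)
  rw [one_div]
  exact inv_anti₀ (by norm_num) (by linarith)

lemma unsat_eq (y : ℝ) : unsat y = Real.exp (-y) / (Real.exp y + Real.exp (-y)) := by
  have h : Real.exp (2 * y) = Real.exp y * Real.exp y := by rw [← Real.exp_add]; ring_nf
  have h1 : Real.exp (-y) = (Real.exp y)⁻¹ := Real.exp_neg y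
  have := Real.exp_pos y
  rw [unsat, h, h1]
  field_simp
  ring

lemma hasDerivAt_unsat (y : ℝ) : HasDerivAt unsat (-2 * unsat y * (1 - unsat y)) y := by
  have h1 : HasDerivAt (fun z : ℝ => 1 + Real.exp (2 * z)) (Real.exp (2 * y) * (2 * 1)) y :=
    (((hasDerivAt_id' y).const_mul 2).exp).const_add 1
  have hp : (1 + Real.exp (2 * y)) ≠ 0 := by positivity
  have h2 := h1.fun_inv hp
  refine h2.congr_deriv ?_
  rw [unsat]
  field_simp
  ring

lemma prod_unsat_pos {ι : Type*} (s : Finset ι) (y : ι → ℝ) : 0 < ∏ i ∈ s, unsat (y i) :=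
  prod_pos fun _ _ => unsat_pos _

lemma prod_unsat_le_one {ι : Type*} (s : Finset ι) (y : ι → ℝ) : ∏ i ∈ s, unsat (y i) ≤ 1 :=
  prod_le_one (fun _ _ => (unsat_pos _).le) fun _ _ => (unsat_lt_one _).le

lemma prod_unsat_le {ι : Type*} {s : Finset ι} (y : ι → ℝ) {i : ι} (hi : i ∈ s) :
    ∏ i ∈ s, unsat (y i) ≤ unsat (y i) := by
  classical
  rw [← mul_prod_erase s _ hi]
  exact mul_le_of_le_one_right (unsat_pos _).le (prod_unsat_le_one _ _)

lemma hasDerivAt_prod_unsat {ι : Type*} (s : Finset ι) (y d : ι → ℝ) (t : ℝ) :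
    HasDerivAt (fun t : ℝ => ∏ i ∈ s, unsat (y i + t * d i))
      (-2 * (∏ i ∈ s, unsat (y i + t * d i)) * ∑ i ∈ s, (1 - unsat (y i + t * d i)) * d i) t := by
  classical
  have h : ∀ i ∈ s, HasDerivAt (fun t : ℝ => unsat (y i + t * d i))
      (-2 * unsat (y i + t * d i) * (1 - unsat (y i + t * d i)) * d i) t := by
    intro i _
    have h1 : HasDerivAt (fun t : ℝ => y i + t * d i) (1 * d i) t :=
      ((hasDerivAt_id' t).mul_const (d i)).const_add (y i)
    have := (hasDerivAt_unsat (y i + t * d i)).comp t h1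
    simpa [Function.comp_def] using this
  convert! HasDerivAt.fun_finsetProd h using 1
  rw [mul_sum]
  refine sum_congr rfl fun i hi => ?_
  rw [← mul_prod_erase s _ hi, smul_eq_mul]
  ring

/-- The probability that a clause is violated when its literals are in the fields `y i`. -/
noncomputable def violProb {ι : Type*} (β : ℝ) (s : Finset ι) (y : ι → ℝ) : ℝ :=
  Real.exp (-β) * (∏ i ∈ s, unsat (y i)) / (1 - (1 - Real.exp (-β)) * ∏ i ∈ s, unsat (y i))

lemma messageFun_eq {ι : Type} (β : ℝ) (s : Finset ι) (y : ι → ℝ) :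
    messageFun β s y =
      -(1 / 2) * Real.log (1 - (1 - Real.exp (-β)) * ∏ i ∈ s, unsat (y i)) := by
  unfold messageFun
  congr 3
  simp_rw [one_sub_tanh, prod_mul_distrib, prod_const]
  field_simp

lemma one_sub_mul_pos {ι : Type*} (β : ℝ) (s : Finset ι) (y : ι → ℝ) :
    0 < 1 - (1 - Real.exp (-β)) * ∏ i ∈ s, unsat (y i) := by
  have h0 := prod_unsat_pos s y
  have h1 := prod_unsat_le_one s y
  have h2 := Real.exp_pos (-β)
  nlinarith

lemma exp_neg_le_one_sub_mul {ι : Type*} {β : ℝ} (hβ : 0 ≤ β) (s : Finset ι) (y : ι → ℝ) :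
    Real.exp (-β) ≤ 1 - (1 - Real.exp (-β)) * ∏ i ∈ s, unsat (y i) := by
  have h1 := prod_unsat_le_one s y
  have h2 : Real.exp (-β) ≤ 1 := Real.exp_le_one_iff.2 (by linarith)
  nlinarith

lemma one_sub_unsat_le {ι : Type*} {β : ℝ} {s : Finset ι} (y : ι → ℝ) {i : ι} (hβ : 0 ≤ β)
    (hi : i ∈ s) :
    1 - unsat (y i) ≤ 1 - (1 - Real.exp (-β)) * ∏ i ∈ s, unsat (y i) := by
  have h1 := prod_unsat_le y hi
  have h2 : Real.exp (-β) ≤ 1 := Real.exp_le_one_iff.2 (by linarith)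
  have h3 := prod_unsat_pos s y
  have h4 := Real.exp_pos (-β)
  nlinarith

lemma messageFun_nonneg {ι : Type} {β : ℝ} (hβ : 0 ≤ β) (s : Finset ι) (y : ι → ℝ) :
    0 ≤ messageFun β s y := by
  rw [messageFun_eq]
  have h2 : Real.exp (-β) ≤ 1 := Real.exp_le_one_iff.2 (by linarith)
  have h3 := prod_unsat_pos s y
  have := Real.log_nonpos (one_sub_mul_pos β s y).le (by nlinarith)
  linarith

lemma messageFun_le {ι : Type} {β : ℝ} (hβ : 0 ≤ β) (s : Finset ι) (y : ι → ℝ) :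
    messageFun β s y ≤ β / 2 := by
  rw [messageFun_eq]
  have := Real.log_le_log (Real.exp_pos _) (exp_neg_le_one_sub_mul hβ s y)
  rw [Real.log_exp] at this
  linarith

lemma exp_neg_two_mul_messageFun {ι : Type} (β : ℝ) (s : Finset ι) (y : ι → ℝ) :
    Real.exp (-2 * messageFun β s y) = 1 - (1 - Real.exp (-β)) * ∏ i ∈ s, unsat (y i) := by
  rw [messageFun_eq, ← mul_assoc]
  norm_num
  exact Real.exp_log (one_sub_mul_pos β s y)

lemma violProb_nonneg {ι : Type*} (β : ℝ) (s : Finset ι) (y : ι → ℝ) : 0 ≤ violProb β s y :=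
  div_nonneg (mul_nonneg (Real.exp_pos _).le (prod_unsat_pos s y).le) (one_sub_mul_pos β s y).le

lemma violProb_le_one {ι : Type*} (β : ℝ) (s : Finset ι) (y : ι → ℝ) : violProb β s y ≤ 1 := by
  rw [violProb, div_le_one (one_sub_mul_pos β s y)]
  have := prod_unsat_le_one s y
  nlinarith

/-- On the segment from `y` to `z`, the products of the `unsat` values are bounded by the products
of common bounds at the end points, if these bounds are `1` or `1 / 2`, the latter for nonnegative
fields. -/
lemma prod_unsat_segment_le {ι : Type*} {s : Finset ι} {y z σ : ι → ℝ}
    (hσ : ∀ i ∈ s, σ i = 1 ∨ (σ i = 1 / 2 ∧ 0 ≤ y i ∧ 0 ≤ z i)) {t : ℝ}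
    (ht : t ∈ Set.Icc (0 : ℝ) 1) :
    ∏ i ∈ s, unsat (y i + t * (z i - y i)) ≤ ∏ i ∈ s, σ i := by
  refine prod_le_prod (fun i _ => (unsat_pos _).le) fun i hi => ?_
  rcases hσ i hi with h | ⟨h, h1, h2⟩
  · rw [h]; exact (unsat_lt_one _).le
  · rw [h]
    refine unsat_le_half ?_
    have : y i + t * (z i - y i) = (1 - t) * y i + t * z i := by ring
    rw [this]
    exact add_nonneg (mul_nonneg (by linarith [ht.2]) h1) (mul_nonneg ht.1 h2)

/-- The message of a clause is Lipschitz in the fields on its literals, at every inverse temperature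
with the same constant: the factor `1 - unsat (y i)` of the derivative compensates the denominator
`1 - (1 - e^{-β}) ∏ unsat`, and what remains is bounded by `∏ unsat ≤ ∏ σ`. -/
lemma abs_messageFun_sub_le {ι : Type} {β : ℝ} (hβ : 0 ≤ β) {s : Finset ι} {y z σ : ι → ℝ}
    (hσ : ∀ i ∈ s, σ i = 1 ∨ (σ i = 1 / 2 ∧ 0 ≤ y i ∧ 0 ≤ z i)) :
    |messageFun β s z - messageFun β s y| ≤ (∏ i ∈ s, σ i) * ∑ i ∈ s, |z i - y i| := by
  set Q : ℝ → ℝ := fun t => ∏ i ∈ s, unsat (y i + t * (z i - y i)) with hQ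
  have hq0 : 0 ≤ 1 - Real.exp (-β) := by
    linarith [Real.exp_le_one_iff.2 (show -β ≤ 0 by linarith)]
  have hder : ∀ t ∈ Set.Icc (0 : ℝ) 1, HasDerivWithinAt
      (fun t => messageFun β s fun i => y i + t * (z i - y i))
      (-((1 - Real.exp (-β)) * Q t * (∑ i ∈ s, (1 - unsat (y i + t * (z i - y i))) * (z i - y i)) /
        (1 - (1 - Real.exp (-β)) * Q t))) (Set.Icc 0 1) t := by
    intro t _
    simp_rw [messageFun_eq]
    have h1 := ((hasDerivAt_prod_unsat s y (fun i => z i - y i) t).const_mul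
      (1 - Real.exp (-β))).const_sub 1
    have h2 := (h1.log (one_sub_mul_pos β s _).ne').const_mul (-(1 / 2) : ℝ)
    refine HasDerivAt.hasDerivWithinAt ?_
    convert! h2 using 1
    simp only [hQ]
    ring
  have hbound : ∀ t ∈ Set.Ico (0 : ℝ) 1,
      ‖-((1 - Real.exp (-β)) * Q t * (∑ i ∈ s, (1 - unsat (y i + t * (z i - y i))) * (z i - y i)) /
        (1 - (1 - Real.exp (-β)) * Q t))‖ ≤ (∏ i ∈ s, σ i) * ∑ i ∈ s, |z i - y i| := by
    intro t ht
    have hpos : 0 < 1 - (1 - Real.exp (-β)) * Q t := one_sub_mul_pos β s _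
    have hQ0 : 0 < Q t := prod_unsat_pos s _
    rw [norm_neg, Real.norm_eq_abs, abs_div, abs_mul, abs_of_pos hpos,
      abs_of_nonneg (mul_nonneg hq0 hQ0.le), div_le_iff₀ hpos]
    have h1 : |∑ i ∈ s, (1 - unsat (y i + t * (z i - y i))) * (z i - y i)| ≤
        (1 - (1 - Real.exp (-β)) * Q t) * ∑ i ∈ s, |z i - y i| := by
      refine (abs_sum_le_sum_abs _ _).trans ?_
      rw [mul_sum]
      refine sum_le_sum fun i hi => ?_
      rw [abs_mul, abs_of_nonneg (by linarith [unsat_lt_one (y i + t * (z i - y i))])]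
      exact mul_le_mul_of_nonneg_right
        (one_sub_unsat_le (fun i => y i + t * (z i - y i)) hβ hi) (abs_nonneg _)
    have h2 : Q t ≤ ∏ i ∈ s, σ i := prod_unsat_segment_le hσ ⟨ht.1, ht.2.le⟩
    have h3 : (1 - Real.exp (-β)) * Q t ≤ ∏ i ∈ s, σ i := by
      have := Real.exp_pos (-β)
      nlinarith
    calc _ ≤ (∏ i ∈ s, σ i) * ((1 - (1 - Real.exp (-β)) * Q t) * ∑ i ∈ s, |z i - y i|) :=
          mul_le_mul h3 h1 (abs_nonneg _) (hQ0.le.trans h2)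
      _ = _ := by ring
  have := norm_image_sub_le_of_norm_deriv_le_segment_01' hder hbound
  simpa using this

/-- The analogue of `abs_messageFun_sub_le` for the violation probability; its derivative has the
square of the denominator, and the second factor is compensated by `e^{-β}`. -/
lemma abs_violProb_sub_le {ι : Type*} {β : ℝ} (hβ : 0 ≤ β) {s : Finset ι} {y z σ : ι → ℝ}
    (hσ : ∀ i ∈ s, σ i = 1 ∨ (σ i = 1 / 2 ∧ 0 ≤ y i ∧ 0 ≤ z i)) :
    |violProb β s z - violProb β s y| ≤ 2 * (∏ i ∈ s, σ i) * ∑ i ∈ s, |z i - y i| := by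
  set Q : ℝ → ℝ := fun t => ∏ i ∈ s, unsat (y i + t * (z i - y i)) with hQ
  have he := Real.exp_pos (-β)
  have hder : ∀ t ∈ Set.Icc (0 : ℝ) 1, HasDerivWithinAt
      (fun t => violProb β s fun i => y i + t * (z i - y i))
      (-(2 * Real.exp (-β) * Q t *
        (∑ i ∈ s, (1 - unsat (y i + t * (z i - y i))) * (z i - y i)) /
        (1 - (1 - Real.exp (-β)) * Q t) ^ 2)) (Set.Icc 0 1) t := by
    intro t _
    unfold violProb
    have h1 := hasDerivAt_prod_unsat s y (fun i => z i - y i) t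
    have h3 := (h1.const_mul (1 - Real.exp (-β))).const_sub 1
    have h2 := (h1.const_mul (Real.exp (-β))).fun_div h3 (one_sub_mul_pos β s _).ne'
    refine HasDerivAt.hasDerivWithinAt ?_
    convert! h2 using 1
    simp only [hQ]
    ring
  have hbound : ∀ t ∈ Set.Ico (0 : ℝ) 1,
      ‖-(2 * Real.exp (-β) * Q t *
        (∑ i ∈ s, (1 - unsat (y i + t * (z i - y i))) * (z i - y i)) /
        (1 - (1 - Real.exp (-β)) * Q t) ^ 2)‖ ≤ 2 * (∏ i ∈ s, σ i) * ∑ i ∈ s, |z i - y i| := by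
    intro t ht
    have hpos : 0 < 1 - (1 - Real.exp (-β)) * Q t := one_sub_mul_pos β s _
    have hQ0 : 0 < Q t := prod_unsat_pos s _
    have hS : 0 ≤ ∑ i ∈ s, |z i - y i| := sum_nonneg fun i _ => abs_nonneg _
    rw [norm_neg, Real.norm_eq_abs, abs_div, abs_mul, abs_of_pos (pow_pos hpos 2),
      abs_of_nonneg (by positivity), div_le_iff₀ (pow_pos hpos 2)]
    have h1 : |∑ i ∈ s, (1 - unsat (y i + t * (z i - y i))) * (z i - y i)| ≤
        (1 - (1 - Real.exp (-β)) * Q t) * ∑ i ∈ s, |z i - y i| := by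
      refine (abs_sum_le_sum_abs _ _).trans ?_
      rw [mul_sum]
      refine sum_le_sum fun i hi => ?_
      rw [abs_mul, abs_of_nonneg (by linarith [unsat_lt_one (y i + t * (z i - y i))])]
      exact mul_le_mul_of_nonneg_right
        (one_sub_unsat_le (fun i => y i + t * (z i - y i)) hβ hi) (abs_nonneg _)
    have h2 : Q t ≤ ∏ i ∈ s, σ i := prod_unsat_segment_le hσ ⟨ht.1, ht.2.le⟩
    have h3 : Real.exp (-β) * Q t ≤ (1 - (1 - Real.exp (-β)) * Q t) * ∏ i ∈ s, σ i :=
      mul_le_mul (exp_neg_le_one_sub_mul hβ s _) h2 hQ0.le hpos.le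
    calc _ = 2 * ((Real.exp (-β) * Q t) *
            |∑ i ∈ s, (1 - unsat (y i + t * (z i - y i))) * (z i - y i)|) := by ring
      _ ≤ 2 * (((1 - (1 - Real.exp (-β)) * Q t) * ∏ i ∈ s, σ i) *
            ((1 - (1 - Real.exp (-β)) * Q t) * ∑ i ∈ s, |z i - y i|)) := by
          refine mul_le_mul_of_nonneg_left ?_ (by norm_num)
          exact mul_le_mul h3 h1 (abs_nonneg _) (mul_nonneg hpos.le (hQ0.le.trans h2))
      _ = _ := by ring
  have := norm_image_sub_le_of_norm_deriv_le_segment_01' hder hbound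
  simpa using this

lemma clauseEnergy_eq_prod (F : Formula k N M) (a : Fin M) (x : Fin k → Bool) :
    clauseEnergy F a x = ∏ j, if x j ≠ F.sign a j then (1 : ℝ) else 0 := by
  unfold clauseEnergy
  by_cases h : ∀ j, x j ≠ F.sign a j
  · rw [if_pos h, prod_eq_one fun j _ => if_pos (h j)]
  · rw [if_neg h]
    push Not at h
    obtain ⟨j, hj⟩ := h
    exact (prod_eq_zero (mem_univ j) (by simp [hj])).symm

lemma exp_neg_mul_clauseEnergy (β : ℝ) (F : Formula k N M) (a : Fin M) (x : Fin k → Bool) :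
    Real.exp (-β * clauseEnergy F a x) = 1 - (1 - Real.exp (-β)) * clauseEnergy F a x := by
  unfold clauseEnergy
  split_ifs <;> simp

lemma sum_bool_exp_spin (F : Formula k N M) (a : Fin M) (j : Fin k) (y : ℝ) :
    ∑ v : Bool, Real.exp (y * spin F a j v) = Real.exp y + Real.exp (-y) := by
  unfold spin
  cases F.sign a j <;> simp [add_comm]

lemma sum_bool_unsat_exp_spin (F : Formula k N M) (a : Fin M) (j : Fin k) (y : ℝ) :
    ∑ v : Bool, (if v ≠ F.sign a j then (1 : ℝ) else 0) * Real.exp (y * spin F a j v) =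
      (Real.exp y + Real.exp (-y)) * unsat y := by
  have : Real.exp y + Real.exp (-y) ≠ 0 := by positivity
  rw [unsat_eq, mul_div_cancel₀ _ this]
  unfold spin
  cases F.sign a j <;> simp

/-- The estimate of the energy of a clause is the violation probability in independent fields. -/
lemma bpClauseEnergy_eq (β : ℝ) (F : Formula k N M) (a : Fin M) :
    bpClauseEnergy β F a = violProb β univ (bpMessages β F a) := by
  set h := bpMessages β F a with hh
  set C := ∏ j, (Real.exp (h j) + Real.exp (-h j)) with hC
  have hC0 : C ≠ 0 := (prod_pos fun j _ => by positivity).ne'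
  have hw : ∀ x, bpWeight β F a x = (1 - (1 - Real.exp (-β)) * clauseEnergy F a x) *
      ∏ j, Real.exp (h j * spin F a j (x j)) := by
    intro x
    rw [bpWeight, Real.exp_add, exp_neg_mul_clauseEnergy, Real.exp_sum]
  have h1 : ∑ x : Fin k → Bool, ∏ j, Real.exp (h j * spin F a j (x j)) = C := by
    rw [hC, ← Fintype.piFinset_univ,
      ← prod_univ_sum (fun _ => univ) fun j v => Real.exp (h j * spin F a j v)]
    exact prod_congr rfl fun j _ => sum_bool_exp_spin F a j (h j)
  have h2 : ∑ x : Fin k → Bool, clauseEnergy F a x * ∏ j, Real.exp (h j * spin F a j (x j)) =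
      C * ∏ j, unsat (h j) := by
    simp_rw [clauseEnergy_eq_prod, ← prod_mul_distrib]
    rw [hC, ← prod_mul_distrib, ← Fintype.piFinset_univ,
      ← prod_univ_sum (fun _ => univ) fun j v => (if v ≠ F.sign a j then (1 : ℝ) else 0) *
        Real.exp (h j * spin F a j v)]
    exact prod_congr rfl fun j _ => sum_bool_unsat_exp_spin F a j (h j)
  have hsq : ∀ x, clauseEnergy F a x * clauseEnergy F a x = clauseEnergy F a x := by
    intro x; unfold clauseEnergy; split_ifs <;> simp
  have h3 : ∑ x : Fin k → Bool, clauseEnergy F a x * bpWeight β F a x =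
      Real.exp (-β) * (C * ∏ j, unsat (h j)) := by
    rw [← h2, mul_sum]
    refine sum_congr rfl fun x _ => ?_
    rw [hw]
    linear_combination (-(1 - Real.exp (-β)) * ∏ j, Real.exp (h j * spin F a j (x j))) * hsq x
  have h4 : ∑ x : Fin k → Bool, bpWeight β F a x =
      C * (1 - (1 - Real.exp (-β)) * ∏ j, unsat (h j)) := by
    simp_rw [hw, sub_mul, one_mul, sum_sub_distrib, mul_assoc, ← mul_sum]
    rw [h1, h2]
    ring
  rw [bpClauseEnergy, h3, h4, violProb]
  have := (one_sub_mul_pos β univ h).ne'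
  field_simp

end KSat

/-! ### Decay of the influence of the initial messages -/

namespace KSat

variable {k N M : ℕ}

/-- The occurrences in other clauses of the variable of the `j`-th literal of clause `a`. -/
def neighbors (F : Formula k N M) (a : Fin M) (j : Fin k) : Finset (Fin M × Fin k) :=
  {e | e.1 ≠ a ∧ F.var e.1 e.2 = F.var a j}

lemma mem_neighbors {F : Formula k N M} {a : Fin M} {j : Fin k} {e : Fin M × Fin k} :
    e ∈ neighbors F a j ↔ e.1 ≠ a ∧ F.var e.1 e.2 = F.var a j := by simp [neighbors]

lemma mem_agreeing {F : Formula k N M} {a : Fin M} {j : Fin k} {e : Fin M × Fin k} :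
    e ∈ agreeing F a j ↔
      e.1 ≠ a ∧ F.var e.1 e.2 = F.var a j ∧ F.sign e.1 e.2 = F.sign a j := by simp [agreeing]

lemma mem_disagreeing {F : Formula k N M} {a : Fin M} {j : Fin k} {e : Fin M × Fin k} :
    e ∈ disagreeing F a j ↔
      e.1 ≠ a ∧ F.var e.1 e.2 = F.var a j ∧ F.sign e.1 e.2 ≠ F.sign a j := by simp [disagreeing]

lemma agreeing_disjoint_disagreeing (F : Formula k N M) (a : Fin M) (j : Fin k) :
    Disjoint (agreeing F a j) (disagreeing F a j) :=
  disjoint_left.2 fun _ h h' => (mem_disagreeing.1 h').2.2 (mem_agreeing.1 h).2.2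

lemma agreeing_union_disagreeing (F : Formula k N M) (a : Fin M) (j : Fin k) :
    agreeing F a j ∪ disagreeing F a j = neighbors F a j := by
  ext e
  rw [mem_union, mem_agreeing, mem_disagreeing, mem_neighbors]
  tauto

/-- The field on the `j`-th literal of clause `a` that results from the messages `u` of the other
clauses. -/
noncomputable def fieldOf (F : Formula k N M) (u : Messages k M) : Messages k M :=
  fun a j => ∑ e ∈ agreeing F a j, u e.1 e.2 - ∑ e ∈ disagreeing F a j, u e.1 e.2

/-- Belief propagation as an iteration on the messages from clauses to variables. -/
noncomputable def msgIter (β : ℝ) (F : Formula k N M) (n : ℕ) (u : Messages k M) : Messages k M :=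
  (fun u => clauseMessage β (fieldOf F u))^[n] u

lemma msgIter_succ (β : ℝ) (F : Formula k N M) (n : ℕ) (u : Messages k M) :
    msgIter β F (n + 1) u = clauseMessage β (fieldOf F (msgIter β F n u)) :=
  Function.iterate_succ_apply' _ _ _

/-- The number of iterations on the messages from clauses to variables is one less than that of
`bpStep`, and the initial messages are those of the clauses. -/
lemma bpStep_iterate_succ (β : ℝ) (F : Formula k N M) (n : ℕ) (h : Messages k M) :
    (bpStep β F)^[n + 1] h = fieldOf F (msgIter β F n (clauseMessage β h)) := by
  induction n with
  | zero => rfl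
  | succ n ih =>
    rw [Function.iterate_succ_apply', ih, msgIter_succ]
    rfl

/-- A bound for the probability that the `j`-th literal of clause `a` is not satisfied: `1 / 2` if
no other clause contains its negation, since all messages to its variable then favour it. -/
noncomputable def damping (F : Formula k N M) (a : Fin M) (j : Fin k) : ℝ :=
  if disagreeing F a j = ∅ then 1 / 2 else 1

lemma damping_nonneg (F : Formula k N M) (a : Fin M) (j : Fin k) : 0 ≤ damping F a j := by
  unfold damping; split_ifs <;> norm_num

lemma damping_le_one (F : Formula k N M) (a : Fin M) (j : Fin k) : damping F a j ≤ 1 := by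
  unfold damping; split_ifs <;> norm_num

/-- The damping of a message that passes through clause `e.1` towards its `e.2`-th variable. -/
noncomputable def clauseWeight (F : Formula k N M) (e : Fin M × Fin k) : ℝ :=
  ∏ l ∈ univ.erase e.2, damping F e.1 l

lemma clauseWeight_nonneg (F : Formula k N M) (e : Fin M × Fin k) : 0 ≤ clauseWeight F e :=
  prod_nonneg fun _ _ => damping_nonneg F _ _

/-- The sum, over all non-backtracking walks with `n` steps that come from the edge `e`, of the
product of the weights of the clauses that are passed. It bounds the effect on the message of `e`
of the messages `n` steps away, at every inverse temperature. -/
noncomputable def influence (F : Formula k N M) : ℕ → Fin M × Fin k → ℝ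
  | 0, _ => 1
  | n + 1, e => clauseWeight F e *
      ∑ l ∈ univ.erase e.2, ∑ e' ∈ neighbors F e.1 l, influence F n e'

lemma influence_nonneg (F : Formula k N M) (n : ℕ) (e : Fin M × Fin k) : 0 ≤ influence F n e := by
  induction n generalizing e with
  | zero => exact zero_le_one
  | succ n ih =>
    exact mul_nonneg (clauseWeight_nonneg F e) (sum_nonneg fun _ _ => sum_nonneg fun _ _ => ih _)

lemma msgIter_mem {β : ℝ} (hβ : 0 ≤ β) (F : Formula k N M) (n : ℕ) {u : Messages k M}
    (hu : ∀ a j, u a j ∈ Set.Icc 0 (β / 2)) (a : Fin M) (j : Fin k) :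
    msgIter β F n u a j ∈ Set.Icc 0 (β / 2) := by
  cases n with
  | zero => exact hu a j
  | succ n =>
    rw [msgIter_succ]
    exact ⟨messageFun_nonneg hβ _ _, messageFun_le hβ _ _⟩

lemma fieldOf_nonneg {F : Formula k N M} {u : Messages k M} (hu : ∀ a j, 0 ≤ u a j) {a : Fin M}
    {j : Fin k} (h : disagreeing F a j = ∅) : 0 ≤ fieldOf F u a j := by
  rw [fieldOf, h, sum_empty, sub_zero]
  exact sum_nonneg fun e _ => hu _ _

/-- A literal with damping `1 / 2` is in a nonnegative field, since no message opposes it. -/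
lemma damping_spec {F : Formula k N M} {u v : Messages k M} (hu : ∀ a j, 0 ≤ u a j)
    (hv : ∀ a j, 0 ≤ v a j) (a : Fin M) (j : Fin k) :
    damping F a j = 1 ∨
      (damping F a j = 1 / 2 ∧ 0 ≤ fieldOf F u a j ∧ 0 ≤ fieldOf F v a j) := by
  by_cases h : disagreeing F a j = ∅
  · exact Or.inr ⟨if_pos h, fieldOf_nonneg hu h, fieldOf_nonneg hv h⟩
  · exact Or.inl (if_neg h)

lemma abs_fieldOf_sub_le (F : Formula k N M) (u v : Messages k M) (a : Fin M) (j : Fin k) :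
    |fieldOf F v a j - fieldOf F u a j| ≤
      ∑ e ∈ neighbors F a j, |v e.1 e.2 - u e.1 e.2| := by
  have : fieldOf F v a j - fieldOf F u a j =
      ∑ e ∈ agreeing F a j, (v e.1 e.2 - u e.1 e.2) -
        ∑ e ∈ disagreeing F a j, (v e.1 e.2 - u e.1 e.2) := by
    simp only [fieldOf, sum_sub_distrib]
    ring
  rw [this, ← agreeing_union_disagreeing, sum_union (agreeing_disjoint_disagreeing F a j)]
  exact (abs_sub _ _).trans
    (add_le_add (abs_sum_le_sum_abs _ _) (abs_sum_le_sum_abs _ _))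

/-- Messages lie in `[0, β / 2]`, so initial messages differ by at most `β / 2`; each passage
multiplies a difference by at most the weight of the clause. -/
lemma abs_msgIter_sub_le {β : ℝ} (hβ : 0 ≤ β) (F : Formula k N M) {u v : Messages k M}
    (hu : ∀ a j, u a j ∈ Set.Icc 0 (β / 2)) (hv : ∀ a j, v a j ∈ Set.Icc 0 (β / 2)) (n : ℕ)
    (e : Fin M × Fin k) :
    |msgIter β F n v e.1 e.2 - msgIter β F n u e.1 e.2| ≤ β / 2 * influence F n e := by
  induction n generalizing e with
  | zero =>
    have h1 := hu e.1 e.2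
    have h2 := hv e.1 e.2
    rw [influence, mul_one, abs_le]
    constructor <;> simp only [msgIter, Function.iterate_zero, id] <;>
      linarith [h1.1, h1.2, h2.1, h2.2]
  | succ n ih =>
    rw [msgIter_succ, msgIter_succ]
    refine (abs_messageFun_sub_le hβ fun l _ => damping_spec
      (fun a j => (msgIter_mem hβ F n hu a j).1) (fun a j => (msgIter_mem hβ F n hv a j).1)
      e.1 l).trans ?_
    rw [influence, mul_left_comm]
    refine mul_le_mul_of_nonneg_left ?_ (clauseWeight_nonneg F e)
    rw [mul_sum]
    refine sum_le_sum fun l _ => (abs_fieldOf_sub_le F _ _ _ _).trans ?_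
    rw [mul_sum]
    exact sum_le_sum fun e' _ => ih e'

/-- The estimated energy of clause `a` depends on the messages `n + 1` steps away at most by `β`
times the total influence. -/
lemma abs_violProb_msgIter_sub_le (hk : 2 ≤ k) {β : ℝ} (hβ : 0 ≤ β) (F : Formula k N M)
    {u v : Messages k M} (hu : ∀ a j, u a j ∈ Set.Icc 0 (β / 2))
    (hv : ∀ a j, v a j ∈ Set.Icc 0 (β / 2)) (n : ℕ) (a : Fin M) :
    |violProb β univ (fieldOf F (msgIter β F n v) a) -
        violProb β univ (fieldOf F (msgIter β F n u) a)| ≤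
      β * ∑ i, influence F (n + 1) (a, i) := by
  refine (abs_violProb_sub_le hβ fun l _ => damping_spec
    (fun a j => (msgIter_mem hβ F n hu a j).1) (fun a j => (msgIter_mem hβ F n hv a j).1)
    a l).trans ?_
  set S : Fin k → ℝ := fun l => ∑ e ∈ neighbors F a l, influence F n e with hS
  have hS0 : ∀ l, 0 ≤ S l := fun l => sum_nonneg fun e _ => influence_nonneg F n e
  have h1 : ∑ l, |fieldOf F (msgIter β F n v) a l - fieldOf F (msgIter β F n u) a l| ≤
      β / 2 * ∑ l, S l := by
    rw [mul_sum]
    refine sum_le_sum fun l _ => (abs_fieldOf_sub_le F _ _ _ _).trans ?_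
    rw [hS, mul_sum]
    exact sum_le_sum fun e _ => abs_msgIter_sub_le hβ F hu hv n e
  have hW : ∀ i, ∏ l, damping F a l ≤ clauseWeight F (a, i) := by
    intro i
    rw [clauseWeight, ← mul_prod_erase univ _ (mem_univ i)]
    exact mul_le_of_le_one_left (clauseWeight_nonneg F (a, i)) (damping_le_one F a i)
  have hW0 : 0 ≤ ∏ l, damping F a l := prod_nonneg fun _ _ => damping_nonneg F _ _
  have h2 : (∏ l, damping F a l) * ∑ l, S l ≤ ∑ i, influence F (n + 1) (a, i) := by
    calc (∏ l, damping F a l) * ∑ l, S l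
        ≤ (∏ l, damping F a l) * ∑ i, ∑ l ∈ univ.erase i, S l := by
          refine mul_le_mul_of_nonneg_left ?_ hW0
          rw [sum_comm' (t' := univ) (s' := fun l => univ.erase l)
            (by intro x y; simp [eq_comm])]
          refine sum_le_sum fun l _ => ?_
          rw [sum_const, card_erase_of_mem (mem_univ l), card_univ, Fintype.card_fin]
          have : 1 ≤ k - 1 := by omega
          rw [nsmul_eq_mul]
          exact le_mul_of_one_le_left (hS0 l) (by exact_mod_cast this)
      _ ≤ ∑ i, influence F (n + 1) (a, i) := by
          rw [mul_sum]
          exact sum_le_sum fun i _ =>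
            mul_le_mul_of_nonneg_right (hW i) (sum_nonneg fun l _ => hS0 l)
  calc 2 * (∏ l, damping F a l) *
        ∑ l, |fieldOf F (msgIter β F n v) a l - fieldOf F (msgIter β F n u) a l|
      ≤ 2 * (∏ l, damping F a l) * (β / 2 * ∑ l, S l) :=
        mul_le_mul_of_nonneg_left h1 (by positivity)
    _ = β * ((∏ l, damping F a l) * ∑ l, S l) := by ring
    _ ≤ _ := mul_le_mul_of_nonneg_left h2 hβ

end KSat

/-! ### Walks in the factor graph and locally tree-like neighbourhoods -/

namespace KSat

variable {k N M : ℕ}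

/-- A passage through a clause `c`, entered at position `i` and left at position `o`, is the triple
`(c, i, o)`. -/
abbrev Passage (k M : ℕ) : Type := Fin M × Fin k × Fin k

/-- `IsWalk F l e`: the passages in the list `l`, the most recent one first, form a
non-backtracking walk in the factor graph that arrives at the edge `e`. -/
def IsWalk (F : Formula k N M) : List (Passage k M) → Fin M × Fin k → Prop
  | [], _ => True
  | t :: l, e => t.2.1 ≠ t.2.2 ∧ e ∈ neighbors F t.1 t.2.2 ∧ IsWalk F l (t.1, t.2.1)

/-- The clause at which a walk starts. -/
def origin : List (Passage k M) → Fin M × Fin k → Fin M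
  | [], e => e.1
  | t :: l, _ => origin l (t.1, t.2.1)

/-- The clauses visited by a walk, the most recent one first. -/
def visited (l : List (Passage k M)) (e : Fin M × Fin k) : List (Fin M) := e.1 :: l.map Prod.fst

lemma origin_mem {l : List (Passage k M)} (hl : l ≠ []) (e : Fin M × Fin k) :
    origin l e ∈ l.map Prod.fst := by
  induction l generalizing e with
  | nil => exact absurd rfl hl
  | cons t l ih =>
    rcases eq_or_ne l [] with rfl | h
    · simp [origin]
    · exact List.mem_cons_of_mem _ (ih h _)

/-- No walk with at most `L` passages from clause `a`, through distinct clauses, can be continued to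
a variable of a clause that it has visited before. -/
def NoLasso (F : Formula k N M) (a : Fin M) (L : ℕ) : Prop :=
  ∀ (l : List (Passage k M)) (e : Fin M × Fin k) (o : Fin k), l.length ≤ L → IsWalk F l e →
    origin l e = a → (visited l e).Nodup → o ≠ e.2 →
      ∀ t ∈ l, ∀ p, F.var e.1 o ≠ F.var t.1 p

/-- If there is no lasso, then no walk of moderate length visits a clause twice: a first return to a
clause would be a step to one of its variables. -/
lemma NoLasso.nodup {F : Formula k N M} {a : Fin M} {L : ℕ} (h : NoLasso F a L)
    {l : List (Passage k M)} {e : Fin M × Fin k} (hl : l.length ≤ L + 1) (hw : IsWalk F l e)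
    (ha : origin l e = a) : (visited l e).Nodup := by
  induction l generalizing e with
  | nil => simp [visited]
  | cons t l ih =>
    have hl' : l.length ≤ L := by simpa using hl
    have hnd := ih (hl'.trans (Nat.le_succ L)) hw.2.2 ha
    have hn := mem_neighbors.1 hw.2.1
    refine List.nodup_cons.2 ⟨?_, hnd⟩
    intro hmem
    rcases List.mem_cons.1 hmem with h1 | h1
    · exact hn.1 h1
    · obtain ⟨t', ht', h2⟩ := List.mem_map.1 h1
      refine h l (t.1, t.2.1) t.2.2 hl' hw.2.2 ha hnd hw.1.symm t' ht' e.2 ?_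
      rw [h2]
      exact hn.2.symm

/-- Two walks that enter a clause at different positions can be combined to one that follows the
first and then the second backwards. -/
lemma IsWalk.exists_return {F : Formula k N M} {c : Fin M} {i i' : Fin k}
    {l l' : List (Passage k M)} (hw : IsWalk F l (c, i)) (hw' : IsWalk F l' (c, i'))
    (hi : i ≠ i') :
    ∃ l₂ e₂, IsWalk F l₂ e₂ ∧ l₂.length = l.length + l'.length ∧
      origin l₂ e₂ = origin l (c, i) ∧ e₂.1 = origin l' (c, i') := by
  induction l' generalizing l c i i' with
  | nil => exact ⟨l, (c, i), hw, rfl, rfl, rfl⟩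
  | cons t' l' ih =>
    obtain ⟨h1, h2, h3⟩ := hw'
    have hn := mem_neighbors.1 h2
    have hnew : IsWalk F ((c, i, i') :: l) (t'.1, t'.2.2) :=
      ⟨hi, mem_neighbors.2 ⟨hn.1.symm, hn.2.symm⟩, hw⟩
    obtain ⟨l₂, e₂, hw₂, hlen, ho, he⟩ := ih hnew h3 h1.symm
    refine ⟨l₂, e₂, hw₂, ?_, ho, he⟩
    rw [hlen, List.length_cons, List.length_cons]
    omega

/-- If there is no lasso, then no walk returns to its origin. -/
lemma NoLasso.no_return {F : Formula k N M} {a : Fin M} {L : ℕ} (h : NoLasso F a L)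
    {l : List (Passage k M)} {e : Fin M × Fin k} (hl : l.length ≤ L + 1) (hw : IsWalk F l e)
    (ha : origin l e = a) (he : e.1 = a) : l = [] := by
  by_contra hne
  have hnd := h.nodup hl hw ha
  rw [visited, List.nodup_cons] at hnd
  refine hnd.1 ?_
  rw [he, ← ha]
  exact origin_mem hne e

/-- In a tree-like neighbourhood, all walks from `a` to a clause have the same length and enter it
at the same position. -/
lemma NoLasso.unique {F : Formula k N M} {a : Fin M} {L : ℕ} (h : NoLasso F a L)
    {l l' : List (Passage k M)} {e e' : Fin M × Fin k} (hl : l.length + l'.length ≤ L + 1)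
    (hw : IsWalk F l e) (hw' : IsWalk F l' e') (ha : origin l e = a) (ha' : origin l' e' = a)
    (he : e.1 = e'.1) : l.length = l'.length ∧ (l ≠ [] → e = e') := by
  induction l generalizing e e' l' with
  | nil =>
    have : l' = [] := h.no_return (by simpa using hl) hw' ha' (by rw [← he, ← ha]; rfl)
    simp [this]
  | cons t l ih =>
    obtain ⟨c, i⟩ := e
    obtain ⟨c', i'⟩ := e'
    obtain rfl : c = c' := he
    by_cases hi : i = i'
    · subst hi
      cases l' with
      | nil =>
        have := h.no_return (by simpa using hl) hw ha (by rw [← ha']; rfl)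
        exact absurd this (by simp)
      | cons t' l' =>
        have hn := mem_neighbors.1 hw.2.1
        have hn' := mem_neighbors.1 hw'.2.1
        by_cases ht : t.1 = t'.1
        · have := ih (l' := l') (e := (t.1, t.2.1)) (e' := (t'.1, t'.2.1))
            (by simp only [List.length_cons] at hl; omega) hw.2.2 hw'.2.2 ha ha' ht
          exact ⟨by simp [this.1], fun _ => rfl⟩
        · exfalso
          have hnew : IsWalk F (t :: l) (t'.1, t'.2.2) :=
            ⟨hw.1, mem_neighbors.2 ⟨Ne.symm ht, hn'.2.symm.trans hn.2⟩, hw.2.2⟩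
          obtain ⟨l₂, e₂, hw₂, hlen, ho, he₂⟩ := hnew.exists_return hw'.2.2 hw'.1.symm
          have := h.no_return (by rw [hlen]; simp only [List.length_cons] at hl ⊢; omega) hw₂
            (ho.trans ha) (he₂.trans ha')
          rw [this] at hlen
          simp only [List.length_nil, List.length_cons] at hlen
          omega
    · exfalso
      obtain ⟨l₂, e₂, hw₂, hlen, ho, he₂⟩ := hw.exists_return hw' hi
      have := h.no_return (by rw [hlen]; exact hl) hw₂ (ho.trans ha) (he₂.trans ha')
      rw [this] at hlen
      simp only [List.length_nil, List.length_cons] at hlen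
      omega

/-- The edge `e` is entered by some walk with `n` passages from clause `a`. -/
def Reach (F : Formula k N M) (a : Fin M) (n : ℕ) (e : Fin M × Fin k) : Prop :=
  ∃ l, l.length = n ∧ IsWalk F l e ∧ origin l e = a

lemma reach_zero {F : Formula k N M} {a : Fin M} {e : Fin M × Fin k} :
    Reach F a 0 e ↔ e.1 = a := by
  constructor
  · rintro ⟨l, hl, -, ho⟩
    rw [List.length_eq_zero_iff] at hl
    subst hl
    exact ho
  · exact fun h => ⟨[], rfl, trivial, h⟩

lemma Reach.step {F : Formula k N M} {a : Fin M} {n : ℕ} {e e' : Fin M × Fin k} {o : Fin k}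
    (h : Reach F a n e) (ho : o ≠ e.2) (he : e' ∈ neighbors F e.1 o) : Reach F a (n + 1) e' := by
  obtain ⟨l, hl, hw, ha⟩ := h
  exact ⟨(e.1, e.2, o) :: l, by simp [hl], ⟨ho.symm, he, hw⟩, ha⟩

lemma Reach.exists_pred {F : Formula k N M} {a : Fin M} {n : ℕ} {e : Fin M × Fin k}
    (h : Reach F a (n + 1) e) :
    ∃ e' o, Reach F a n e' ∧ o ≠ e'.2 ∧ e ∈ neighbors F e'.1 o := by
  obtain ⟨l, hl, hw, ha⟩ := h
  cases l with
  | nil => simp at hl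
  | cons t l =>
    exact ⟨(t.1, t.2.1), t.2.2, ⟨l, by simpa using hl, hw.2.2, ha⟩, hw.1.symm, hw.2.1⟩

lemma NoLasso.reach_unique {F : Formula k N M} {a : Fin M} {L : ℕ} (h : NoLasso F a L) {n n' : ℕ}
    {e e' : Fin M × Fin k} (hn : n + n' ≤ L + 1) (hr : Reach F a n e) (hr' : Reach F a n' e')
    (he : e.1 = e'.1) : n = n' ∧ (n ≠ 0 → e = e') := by
  obtain ⟨l, hl, hw, ha⟩ := hr
  obtain ⟨l', hl', hw', ha'⟩ := hr'
  subst hl hl'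
  have := h.unique hn hw hw' ha ha' he
  exact ⟨this.1, fun h0 => this.2 (by rintro rfl; exact h0 rfl)⟩

/-! ### Walks and the diameter of the factor graph -/

lemma factorGraph_adj {F : Formula k N M} {i : Fin N} {a : Fin M} :
    (factorGraph F).Adj (Sum.inl i) (Sum.inr a) ↔ ∃ j, F.var a j = i := by
  rw [factorGraph, SimpleGraph.fromRel_adj]
  simp only [ne_eq, reduceCtorEq, not_false_eq_true, Sum.inl.injEq, Sum.inr.injEq, true_and,
    false_and, exists_false, or_false]
  constructor
  · rintro ⟨b, j, h1, rfl⟩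
    exact ⟨j, h1.symm⟩
  · rintro ⟨j, h⟩
    exact ⟨a, j, h.symm, rfl⟩

lemma factorGraph_not_adj_inl {F : Formula k N M} {i i' : Fin N} :
    ¬ (factorGraph F).Adj (Sum.inl i) (Sum.inl i') := by
  rw [factorGraph, SimpleGraph.fromRel_adj]
  simp

lemma factorGraph_not_adj_inr {F : Formula k N M} {a b : Fin M} :
    ¬ (factorGraph F).Adj (Sum.inr a) (Sum.inr b) := by
  rw [factorGraph, SimpleGraph.fromRel_adj]
  simp

/-- The clauses that are reached by walks with at most `n` passages are closed under one more step,
backtracking or not. -/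
lemma reach_of_shared_var (hk : 2 ≤ k) {F : Formula k N M} {a b c : Fin M} {n : ℕ}
    (hb : ∃ m ≤ n, ∃ i, Reach F a m (b, i)) {j p : Fin k} (h : F.var c p = F.var b j) :
    ∃ m ≤ n + 1, ∃ i, Reach F a m (c, i) := by
  obtain ⟨m, hm, i, hr⟩ := hb
  rcases eq_or_ne c b with rfl | hcb
  · exact ⟨m, by omega, i, hr⟩
  by_cases hj : j = i
  · subst hj
    cases m with
    | zero =>
      -- the position of entry at the start of a walk is arbitrary
      obtain ⟨i', hi'⟩ := Fintype.exists_ne_of_one_lt_card (by rw [Fintype.card_fin]; omega) j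
      have hba : b = a := reach_zero.1 hr
      exact ⟨1, by omega, p, Reach.step (e := (b, i')) (o := j) (reach_zero.2 hba)
        hi'.symm (mem_neighbors.2 ⟨hcb, h⟩)⟩
    | succ m =>
      obtain ⟨e', o, hr', ho, he⟩ := hr.exists_pred
      rcases eq_or_ne c e'.1 with rfl | hne
      · exact ⟨m, by omega, e'.2, hr'⟩
      · exact ⟨m + 1, by omega, p, hr'.step ho
          (mem_neighbors.2 ⟨hne, h.trans (mem_neighbors.1 he).2⟩)⟩
  · exact ⟨m + 1, by omega, p, hr.step hj (mem_neighbors.2 ⟨hcb, h⟩)⟩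

/-- A path in the factor graph with `2 m` edges between clauses yields a walk with at most `m`
passages. The path starts at the far end; the second part is for paths that start at a variable. -/
lemma reach_of_factorGraph_walk (hk : 2 ≤ k) {F : Formula k N M} {a : Fin M}
    {v u : Fin N ⊕ Fin M} (p : (factorGraph F).Walk v u) (hu : u = Sum.inr a) :
    (∀ b, v = Sum.inr b → ∃ m ≤ p.length / 2, ∃ i, Reach F a m (b, i)) ∧
    (∀ i, v = Sum.inl i → ∃ b j, F.var b j = i ∧ 1 ≤ p.length ∧
      ∃ m ≤ (p.length - 1) / 2, ∃ i, Reach F a m (b, i)) := by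
  induction p with
  | nil =>
    subst hu
    refine ⟨fun b hb => ?_, fun i hi => by simp at hi⟩
    obtain rfl : a = b := by simpa using hb
    exact ⟨0, by simp, ⟨0, by omega⟩, reach_zero.2 rfl⟩
  | @cons v w u h p ih =>
    obtain ⟨ih1, ih2⟩ := ih hu
    refine ⟨?_, ?_⟩
    · rintro b rfl
      cases w with
      | inr c => exact absurd h factorGraph_not_adj_inr
      | inl i =>
        obtain ⟨c, j, hc, hp, hr⟩ := ih2 i rfl
        obtain ⟨j', hj'⟩ := factorGraph_adj.1 h.symm
        obtain ⟨m, hm, hr'⟩ := reach_of_shared_var hk hr (hj'.trans hc.symm)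
        refine ⟨m, ?_, hr'⟩
        rw [SimpleGraph.Walk.length_cons]
        omega
    · rintro i rfl
      cases w with
      | inl c => exact absurd h factorGraph_not_adj_inl
      | inr b =>
        obtain ⟨m, hm, hr⟩ := ih1 b rfl
        obtain ⟨j, hj⟩ := factorGraph_adj.1 h
        refine ⟨b, j, hj, by simp, m, ?_, hr⟩
        rw [SimpleGraph.Walk.length_cons]
        omega

lemma Reach.reachable {F : Formula k N M} {a : Fin M} {n : ℕ} {e : Fin M × Fin k}
    (h : Reach F a n e) : (factorGraph F).Reachable (Sum.inr e.1) (Sum.inr a) := by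
  induction n generalizing e with
  | zero => rw [reach_zero.1 h]
  | succ n ih =>
    obtain ⟨e', o, hr, -, he⟩ := h.exists_pred
    have hn := (mem_neighbors.1 he).2
    have h1 : (factorGraph F).Adj (Sum.inl (F.var e'.1 o)) (Sum.inr e'.1) :=
      factorGraph_adj.2 ⟨o, rfl⟩
    have h2 : (factorGraph F).Adj (Sum.inl (F.var e'.1 o)) (Sum.inr e.1) :=
      factorGraph_adj.2 ⟨e.2, hn⟩
    exact h2.symm.reachable.trans (h1.reachable.trans (ih hr))

lemma dist_le_diameter (F : Formula k N M) (u v : Fin N ⊕ Fin M) :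
    (factorGraph F).dist u v ≤ diameter F :=
  le_sup (f := fun p : (Fin N ⊕ Fin M) × (Fin N ⊕ Fin M) => (factorGraph F).dist p.1 p.2)
    (mem_univ (u, v))

lemma one_le_diameter (hk : 2 ≤ k) (F : Formula k N M) (a : Fin M) : 1 ≤ diameter F := by
  have h : (factorGraph F).Adj (Sum.inl (F.var a ⟨0, by omega⟩)) (Sum.inr a) :=
    factorGraph_adj.2 ⟨_, rfl⟩
  rw [← SimpleGraph.dist_eq_one_iff_adj.2 h]
  exact dist_le_diameter F _ _

/-- A positive influence from `n` steps away is carried by a walk with `n` passages. -/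
lemma exists_reach_of_influence_ne_zero {F : Formula k N M} {a : Fin M} {m n : ℕ}
    {e : Fin M × Fin k} (hr : Reach F a m e) (h : influence F n e ≠ 0) :
    ∃ e', Reach F a (m + n) e' := by
  induction n generalizing m e with
  | zero => exact ⟨e, hr⟩
  | succ n ih =>
    rw [influence] at h
    obtain ⟨l, hl, h1⟩ := exists_ne_zero_of_sum_ne_zero (right_ne_zero_of_mul h)
    obtain ⟨e', he', h2⟩ := exists_ne_zero_of_sum_ne_zero h1
    obtain ⟨e'', h3⟩ := ih (hr.step (ne_of_mem_erase hl) he') h2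
    exact ⟨e'', by rwa [show m + (n + 1) = m + 1 + n by omega]⟩

/-- If the number of iterations is smaller than the radius of a tree-like neighbourhood, then this
neighbourhood is the whole component, and no walk with that many steps exists. -/
lemma influence_diameter_eq_zero (hk : 2 ≤ k) {F : Formula k N M} {a : Fin M} {L : ℕ}
    (h : NoLasso F a L) (hL : 2 * diameter F ≤ L + 1) (i : Fin k) :
    influence F (diameter F) (a, i) = 0 := by
  by_contra hne
  obtain ⟨e, he⟩ := exists_reach_of_influence_ne_zero (reach_zero.2 rfl) hne
  rw [zero_add] at he
  obtain ⟨p, hp⟩ := he.reachable.exists_walk_length_eq_dist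
  obtain ⟨m, hm, j, hr⟩ := (reach_of_factorGraph_walk hk p rfl).1 e.1 rfl
  have h1 := dist_le_diameter F (Sum.inr e.1) (Sum.inr (a, i).1)
  have h2 := one_le_diameter hk F a
  have h3 := (h.reach_unique (by omega) hr he rfl).1
  omega

end KSat

/-! ### Belief propagation is exact on tree-like neighbourhoods with a fixed boundary -/

namespace KSat

variable {k N M : ℕ}

/-- `f` does not depend on the variable `i`. -/
def FreeOf (f : (Fin N → Bool) → ℝ) (i : Fin N) : Prop :=
  ∀ x b, f (Function.update x i b) = f x

lemma FreeOf.mul {f g : (Fin N → Bool) → ℝ} {i : Fin N} (hf : FreeOf f i) (hg : FreeOf g i) :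
    FreeOf (fun x => f x * g x) i := fun x b => by simp only [hf x b, hg x b]

lemma FreeOf.prod {ι : Type*} {s : Finset ι} {f : ι → (Fin N → Bool) → ℝ} {i : Fin N}
    (hf : ∀ j ∈ s, FreeOf (f j) i) : FreeOf (fun x => ∏ j ∈ s, f j x) i := fun x b =>
  prod_congr rfl fun j hj => hf j hj x b

lemma freeOf_comp {i i' : Fin N} (h : i' ≠ i) (φ : Bool → ℝ) : FreeOf (fun x => φ (x i')) i :=
  fun x b => by simp only [Function.update_of_ne h]

lemma var_injective (F : Formula k N M) (c : Fin M) : Function.Injective (F.var c) :=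
  (F c).1.injective

/-- Under the uniform distribution, `f` is independent of the value of a variable on which it does
not depend. -/
lemma sum_mul_of_freeOf {f : (Fin N → Bool) → ℝ} {i : Fin N} (hf : FreeOf f i) (φ : Bool → ℝ) :
    ∑ x, f x * φ (x i) = (∑ v, φ v) / 2 * ∑ x, f x := by
  have hinv : Function.Involutive fun x : Fin N → Bool => Function.update x i (!(x i)) := by
    intro x
    simp
  have h := Equiv.sum_comp hinv.toPerm fun x => f x * φ (x i)
  have h2 : ∑ x, f x * φ (x i) + ∑ x, f x * φ (!(x i)) = (∑ v, φ v) * ∑ x, f x := by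
    rw [← sum_add_distrib, mul_sum]
    refine sum_congr rfl fun x _ => ?_
    rw [Fintype.sum_bool]
    cases x i <;> simp <;> ring
  have h3 : ∑ x, f x * φ (!(x i)) = ∑ x, f x * φ (x i) := by
    rw [← h]
    refine sum_congr rfl fun x _ => ?_
    simp only [Function.Involutive.coe_toPerm, Function.update_self]
    rw [hf]
  rw [h3] at h2
  linarith

lemma sum_mul_prod_of_freeOf {ι : Type*} {J : Finset ι} {v : ι → Fin N}
    (hv : Function.Injective v) {f : (Fin N → Bool) → ℝ} (hf : ∀ l ∈ J, FreeOf f (v l))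
    (φ : ι → Bool → ℝ) :
    ∑ x, f x * ∏ l ∈ J, φ l (x (v l)) = (∏ l ∈ J, (∑ b, φ l b) / 2) * ∑ x, f x := by
  classical
  induction J using Finset.induction_on with
  | empty => simp
  | insert l J hl ih =>
    have hfree : FreeOf (fun x => f x * ∏ l ∈ J, φ l (x (v l))) (v l) :=
      (hf l (mem_insert_self l J)).mul (FreeOf.prod fun l' hl' =>
        freeOf_comp (hv.ne (by rintro rfl; exact hl hl')) _)
    have h1 := sum_mul_of_freeOf hfree (φ l)
    rw [ih fun l' hl' => hf l' (mem_insert_of_mem hl')] at h1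
    rw [prod_insert hl, mul_assoc, ← h1]
    refine sum_congr rfl fun x _ => ?_
    rw [prod_insert hl]
    ring

/-- The energy of clause `c` as a function of an assignment of all `N` variables. -/
noncomputable def violation (F : Formula k N M) (c : Fin M) (x : Fin N → Bool) : ℝ :=
  clauseEnergy F c fun j => x (F.var c j)

lemma violation_eq_prod (F : Formula k N M) (c : Fin M) (x : Fin N → Bool) :
    violation F c x = ∏ j, if x (F.var c j) ≠ F.sign c j then (1 : ℝ) else 0 :=
  clauseEnergy_eq_prod F c _

lemma violation_nonneg (F : Formula k N M) (c : Fin M) (x : Fin N → Bool) :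
    0 ≤ violation F c x := by
  unfold violation clauseEnergy; split_ifs <;> norm_num

lemma violation_le_one (F : Formula k N M) (c : Fin M) (x : Fin N → Bool) :
    violation F c x ≤ 1 := by
  unfold violation clauseEnergy; split_ifs <;> norm_num

lemma freeOf_violation {F : Formula k N M} {c : Fin M} {i : Fin N} (h : ∀ j, F.var c j ≠ i) :
    FreeOf (violation F c) i := fun x b => by
  simp only [violation, Function.update_of_ne (h _)]

lemma energy_eq_sum (F : Formula k N M) (x : Fin N → Bool) :
    (energy F x : ℝ) = ∑ c, violation F c x := by
  simp only [energy, violation, clauseEnergy, sum_boole]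

/-- The Boltzmann weight. -/
noncomputable def boltzmann (β : ℝ) (F : Formula k N M) (x : Fin N → Bool) : ℝ :=
  Real.exp (-β * energy F x)

lemma boltzmann_eq_prod (β : ℝ) (F : Formula k N M) (x : Fin N → Bool) :
    boltzmann β F x = ∏ c, Real.exp (-β * violation F c x) := by
  rw [boltzmann, energy_eq_sum, mul_sum, Real.exp_sum]

lemma exp_neg_mul_violation (β : ℝ) (F : Formula k N M) (c : Fin M) (x : Fin N → Bool) :
    Real.exp (-β * violation F c x) = 1 - (1 - Real.exp (-β)) * violation F c x :=
  exp_neg_mul_clauseEnergy β F c _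

/-- Depths `dep` and positions of entry `par` of the clauses, such that up to depth `n` the
neighbourhood of clause `a` is a tree. -/
structure IsTree (F : Formula k N M) (a : Fin M) (n : ℕ) (dep : Fin M → ℕ) (par : Fin M → Fin k) :
    Prop where
  dep_eq_zero : ∀ c, dep c = 0 ↔ c = a
  child : ∀ c l e, dep c ≤ n → (c ≠ a → l ≠ par c) → e ∈ neighbors F c l →
    dep e.1 = dep c + 1 ∧ par e.1 = e.2

/-- The depth of a clause is the length of the walks from `a` to it, and `n + 2` if there is none
with at most `n + 1` passages. -/
lemma NoLasso.exists_isTree (hk : 2 ≤ k) {F : Formula k N M} {a : Fin M} {L n : ℕ}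
    (h : NoLasso F a L) (hL : 2 * n + 2 ≤ L + 1) : ∃ dep par, IsTree F a n dep par := by
  classical
  have hex : ∀ c, ∃ d : ℕ × Fin k, (d.1 ≤ n + 1 → Reach F a d.1 (c, d.2)) ∧
      ((∃ m ≤ n + 1, ∃ i, Reach F a m (c, i)) → d.1 ≤ n + 1) := by
    intro c
    by_cases hc : ∃ m ≤ n + 1, ∃ i, Reach F a m (c, i)
    · obtain ⟨m, hm, i, hr⟩ := hc
      exact ⟨(m, i), fun _ => hr, fun _ => hm⟩
    · exact ⟨(n + 2, ⟨0, by omega⟩), fun h => by simp at h, fun h => absurd h hc⟩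
  choose d hd hd' using hex
  have h0 : ∀ c, (d c).1 = 0 ↔ c = a := by
    intro c
    constructor
    · intro hc
      have := hd c (by omega)
      rw [hc, reach_zero] at this
      exact this
    · rintro rfl
      have h1 : Reach F c 0 (c, (d c).2) := reach_zero.2 rfl
      have h2 := hd' c ⟨0, by omega, _, h1⟩
      exact (h.reach_unique (by omega) (hd c h2) h1 rfl).1
  refine ⟨fun c => (d c).1, fun c => (d c).2, h0, ?_⟩
  rintro c l ⟨b, p⟩ hc hl he
  have hr : Reach F a ((d c).1 + 1) (b, p) := by
    by_cases hca : c = a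
    · obtain ⟨i', hi'⟩ := Fintype.exists_ne_of_one_lt_card (by rw [Fintype.card_fin]; omega) l
      have h1 : (d c).1 = 0 := (h0 c).2 hca
      rw [h1]
      exact Reach.step (e := (c, i')) (reach_zero.2 hca) hi'.symm he
    · exact (hd c (by omega)).step (hl hca) he
  have hb := hd' b ⟨_, by omega, p, hr⟩
  obtain ⟨h1, h2⟩ := h.reach_unique (by omega) (hd b hb) hr rfl
  refine ⟨h1, ?_⟩
  have := h2 (by omega)
  exact congrArg Prod.snd this

section Elimination

variable (F : Formula k N M) (a : Fin M) (n : ℕ) (dep : Fin M → ℕ) (par : Fin M → Fin k)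

/-- The positions of the variables through which walks from `a` leave clause `c`. -/
def exits (c : Fin M) : Finset (Fin k) := {l | c ≠ a → l ≠ par c}

lemma mem_exits {a : Fin M} {par : Fin M → Fin k} {c : Fin M} {l : Fin k} :
    l ∈ exits a par c ↔ (c ≠ a → l ≠ par c) := by
  rw [exits, mem_filter, and_iff_right (mem_univ l)]

/-- The variables of the neighbourhood of clause `a` of radius `n`. -/
def interior : Set (Fin N) := {v | ∃ c l, dep c ≤ n ∧ l ∈ exits a par c ∧ F.var c l = v}

open Classical in
/-- The indicator of the assignments that coincide with `η` outside the interior. -/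
noncomputable def pin (η x : Fin N → Bool) : ℝ :=
  if ∀ v ∉ interior F a n dep par, x v = η v then 1 else 0

open Classical in
/-- The messages that the clauses send if their other variables have the values `η`: the clause
penalizes the violation of its remaining literal if `η` satisfies no other one, and has no effect
otherwise. -/
noncomputable def boundaryMessage (β : ℝ) (η : Fin N → Bool) : Messages k M :=
  fun c p => if ∀ l ≠ p, η (F.var c l) ≠ F.sign c l then β / 2 else 0

lemma boundaryMessage_mem {β : ℝ} (hβ : 0 ≤ β) (η : Fin N → Bool) (c : Fin M) (p : Fin k) :
    boundaryMessage F β η c p ∈ Set.Icc 0 (β / 2) := by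
  unfold boundaryMessage
  split_ifs
  · exact ⟨by linarith, le_rfl⟩
  · exact ⟨le_rfl, by linarith⟩

/-- The message that clause `c` sends towards clause `a`. -/
noncomputable def upMessage (β : ℝ) (η : Fin N → Bool) (c : Fin M) : ℝ :=
  msgIter β F (n + 1 - dep c) (boundaryMessage F β η) c (par c)

/-- The factor that replaces clause `c` and the branch behind it. -/
noncomputable def upFactor (β : ℝ) (η : Fin N → Bool) (c : Fin M) (x : Fin N → Bool) : ℝ :=
  Real.exp (upMessage F n dep par β η c * spin F c (par c) (x (F.var c (par c))))

/-- The weight of an assignment after all clauses outside `S` have been replaced by their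
messages. -/
noncomputable def partialWeight (β : ℝ) (η : Fin N → Bool) (S : Finset (Fin M))
    (x : Fin N → Bool) : ℝ :=
  pin F a n dep par η x * (∏ c ∈ S, Real.exp (-β * violation F c x)) *
    ∏ c with c ∉ S ∧ dep c ≤ n + 1, upFactor F n dep par β η c x

variable {F a n dep par}

lemma exp_mul_spin {c : Fin M} {p : Fin k} (u : ℝ) (b : Bool) :
    Real.exp (u * spin F c p b) =
      Real.exp u * (1 - (1 - Real.exp (-2 * u)) * if b ≠ F.sign c p then 1 else 0) := by
  unfold spin
  by_cases h : b = F.sign c p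
  · simp [h]
  · simp only [h, if_false, ne_eq, not_false_eq_true, if_true]
    rw [mul_one, sub_sub_cancel, ← Real.exp_add]
    ring_nf

/-- The clauses of depth more than `n` contain no variable of the interior but, at depth `n + 1`,
that of their entry. So they act on the pinned assignments through a constant factor and a message.
-/
lemma boltzmann_mul_pin (hT : IsTree F a n dep par) (β : ℝ) (η : Fin N → Bool) :
    ∃ C : ℝ, 0 < C ∧ ∀ x, boltzmann β F x * pin F a n dep par η x =
      C * partialWeight F a n dep par β η {c | dep c ≤ n} x := by
  classical
  have hout : ∀ c, ¬ dep c ≤ n → ∀ l, F.var c l ∈ interior F a n dep par →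
      dep c = n + 1 ∧ l = par c := by
    rintro c hc l ⟨c', l', hc', hl', hv⟩
    have hne : c ≠ c' := by rintro rfl; exact hc hc'
    have := hT.child c' l' (c, l) hc' (mem_exits.1 hl') (mem_neighbors.2 ⟨hne, hv.symm⟩)
    exact ⟨by dsimp only at this; omega, this.2.symm⟩
  set D : Fin M → ℝ := fun c => if dep c ≤ n + 1 then Real.exp (-upMessage F n dep par β η c)
    else Real.exp (-β * violation F c η) with hD
  refine ⟨∏ c with ¬ dep c ≤ n, D c, prod_pos fun c _ => ?_, fun x => ?_⟩
  · simp only [hD]; split_ifs <;> exact Real.exp_pos _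
  by_cases hx : ∀ v ∉ interior F a n dep par, x v = η v
  swap
  · simp [partialWeight, pin, hx]
  have hfac : ∀ c, ¬ dep c ≤ n → Real.exp (-β * violation F c x) =
      D c * if dep c ≤ n + 1 then upFactor F n dep par β η c x else 1 := by
    intro c hc
    by_cases hc1 : dep c ≤ n + 1
    · have hdep : dep c = n + 1 := by omega
      have hoth : ∀ l, l ≠ par c → x (F.var c l) = η (F.var c l) := fun l hl =>
        hx _ fun hmem => hl (hout c hc l hmem).2
      have hup : upMessage F n dep par β η c = boundaryMessage F β η c (par c) := by
        rw [upMessage, hdep, Nat.sub_self]; rfl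
      simp only [hD, hc1, if_true, upFactor, hup]
      rw [exp_mul_spin, ← mul_assoc, ← Real.exp_add, neg_add_cancel, Real.exp_zero, one_mul,
        exp_neg_mul_violation, violation_eq_prod, ← mul_prod_erase univ _ (mem_univ (par c))]
      unfold boundaryMessage
      by_cases hall : ∀ l ≠ par c, η (F.var c l) ≠ F.sign c l
      · rw [if_pos hall, prod_eq_one fun l hl => ?_, mul_one]
        · congr 3
          ring_nf
        · rw [hoth l (ne_of_mem_erase hl), if_pos (hall l (ne_of_mem_erase hl))]
      · rw [if_neg hall]
        push Not at hall
        obtain ⟨l, hl, hl'⟩ := hall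
        rw [prod_eq_zero (mem_erase.2 ⟨hl, mem_univ l⟩) (by rw [hoth l hl, hl']; simp)]
        simp
    · simp only [hD, hc1, if_false, mul_one]
      congr 2
      unfold violation
      congr 1
      funext j
      exact hx _ fun hmem => hc1 (hout c hc j hmem).1.le
  rw [boltzmann_eq_prod, partialWeight,
    ← prod_filter_mul_prod_filter_not univ (fun c => dep c ≤ n),
    prod_congr rfl (s₁ := univ.filter fun c => ¬ dep c ≤ n) fun c hc => hfac c (mem_filter.1 hc).2,
    prod_mul_distrib, ← prod_filter, filter_filter]
  have : (univ.filter fun c => ¬ dep c ≤ n ∧ dep c ≤ n + 1) =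
      univ.filter fun c => c ∉ (univ.filter fun c => dep c ≤ n) ∧ dep c ≤ n + 1 := by
    ext c; simp
  rw [this]
  ring

/-- The factors of the clauses behind clause `c`. -/
lemma prod_upFactor_children (hT : IsTree F a n dep par) {c : Fin M} (hc : dep c ≤ n) (β : ℝ)
    (η x : Fin N → Bool) :
    ∏ l ∈ exits a par c, Real.exp
      (fieldOf F (msgIter β F (n - dep c) (boundaryMessage F β η)) c l *
        spin F c l (x (F.var c l))) =
    ∏ b ∈ (exits a par c).biUnion fun l => (neighbors F c l).image Prod.fst,
      upFactor F n dep par β η b x := by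
  classical
  rw [prod_biUnion]
  · refine prod_congr rfl fun l hl => ?_
    have hch := fun e he => hT.child c l e hc (mem_exits.1 hl) he
    rw [prod_image]
    swap
    · intro e he e' he' hee
      have h1 := (hch e he).2
      have h2 := (hch e' he').2
      exact Prod.ext hee (by rw [← h1, ← h2, hee])
    set u := msgIter β F (n - dep c) (boundaryMessage F β η) with hu
    have hE : ∀ e ∈ neighbors F c l, upFactor F n dep par β η e.1 x =
        Real.exp (u e.1 e.2 * spin F e.1 e.2 (x (F.var c l))) := by
      intro e he
      obtain ⟨h1, h2⟩ := hch e he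
      rw [upFactor, upMessage, h1, h2, (mem_neighbors.1 he).2, hu,
        show n + 1 - (dep c + 1) = n - dep c by omega]
    rw [prod_congr rfl hE, ← Real.exp_sum, ← agreeing_union_disagreeing,
      sum_union (agreeing_disjoint_disagreeing F c l), fieldOf, sub_mul, sum_mul, sum_mul,
      sub_eq_add_neg, ← sum_neg_distrib]
    congr 2
    · refine sum_congr rfl fun e he => ?_
      rw [spin, spin, (mem_agreeing.1 he).2.2]
    · refine sum_congr rfl fun e he => ?_
      have h1 := (mem_disagreeing.1 he).2.2
      unfold spin
      revert h1
      cases F.sign e.1 e.2 <;> cases F.sign c l <;> cases x (F.var c l) <;> simp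
  · intro l hl l' hl' hll
    rw [Function.onFun, disjoint_left]
    intro b hb hb'
    obtain ⟨e, he, rfl⟩ := mem_image.1 hb
    obtain ⟨e', he', hee⟩ := mem_image.1 hb'
    have h1 := (hT.child c l e hc (mem_exits.1 hl) he).2
    have h2 := (hT.child c l' e' hc (mem_exits.1 hl') he').2
    have h3 : e' = e := Prod.ext hee (by rw [← h1, ← h2, hee])
    subst h3
    exact hll (var_injective F c
      ((mem_neighbors.1 he).2.symm.trans (mem_neighbors.1 he').2))

/-- Summation over the variables behind clause `c`, in the form in which it is needed for the other
clauses and for the root. `S` contains the clauses that are not yet replaced, other than `c`. -/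
lemma exists_elimination (hT : IsTree F a n dep par) {c : Fin M} (hc : dep c ≤ n)
    {S : Finset (Fin M)} (hcS : c ∉ S) (hS : ∀ b ∈ S, dep b ≤ dep c) (β : ℝ) (η : Fin N → Bool)
    {f : (Fin N → Bool) → ℝ} (hf : ∀ l ∈ exits a par c, FreeOf f (F.var c l)) :
    ∃ g : (Fin N → Bool) → ℝ, (∀ l ∈ exits a par c, FreeOf g (F.var c l)) ∧
      (∀ x, f x * (pin F a n dep par η x * (∏ b ∈ S, Real.exp (-β * violation F b x)) *
        ∏ b with b ∉ insert c S ∧ dep b ≤ n + 1, upFactor F n dep par β η b x) =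
      g x * ∏ l ∈ exits a par c, Real.exp
        (fieldOf F (msgIter β F (n - dep c) (boundaryMessage F β η)) c l *
          spin F c l (x (F.var c l)))) := by
  classical
  set B := (exits a par c).biUnion fun l => (neighbors F c l).image Prod.fst with hB
  set R : Finset (Fin M) := univ.filter fun b => b ∉ insert c S ∧ dep b ≤ n + 1 with hR
  have hBR : B ⊆ R := by
    intro b hb
    obtain ⟨l, hl, hb⟩ := mem_biUnion.1 hb
    obtain ⟨e, he, rfl⟩ := mem_image.1 hb
    have h1 := (hT.child c l e hc (mem_exits.1 hl) he).1
    rw [hR, mem_filter, mem_insert]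
    refine ⟨mem_univ _, ?_, by omega⟩
    rintro (h | h)
    · exact (mem_neighbors.1 he).1 h
    · have := hS _ h
      omega
  refine ⟨fun x => f x * (pin F a n dep par η x * (∏ b ∈ S, Real.exp (-β * violation F b x)) *
    ∏ b ∈ R \ B, upFactor F n dep par β η b x), fun l hl => ?_, fun x => ?_⟩
  · refine (hf l hl).mul ((FreeOf.mul ?_ (FreeOf.prod fun b hb => ?_)).mul
      (FreeOf.prod fun b hb => ?_))
    · intro x v
      have hmem : F.var c l ∈ interior F a n dep par := ⟨c, l, hc, hl, rfl⟩
      have : (∀ v' ∉ interior F a n dep par, Function.update x (F.var c l) v v' = η v') ↔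
          ∀ v' ∉ interior F a n dep par, x v' = η v' := by
        refine forall_congr' fun v' => forall_congr' fun hv' => ?_
        rw [Function.update_of_ne (by rintro rfl; exact hv' hmem)]
      simp only [pin, this]
    · have : FreeOf (violation F b) (F.var c l) := freeOf_violation fun j hj => by
        have hne : b ≠ c := by rintro rfl; exact hcS hb
        have := (hT.child c l (b, j) hc (mem_exits.1 hl) (mem_neighbors.2 ⟨hne, hj⟩)).1
        have h2 := hS b hb
        dsimp only at this
        omega
      intro x v
      simp only [this x v]
    · have hne : F.var b (par b) ≠ F.var c l := by
        intro hv
        rw [Finset.mem_sdiff] at hb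
        have hbc : b ≠ c := by
          rintro rfl
          exact (mem_filter.1 hb.1).2.1 (mem_insert_self _ _)
        exact hb.2 (mem_biUnion.2 ⟨l, hl, mem_image.2 ⟨(b, par b),
          mem_neighbors.2 ⟨hbc, hv⟩, rfl⟩⟩)
      intro x v
      simp only [upFactor, Function.update_of_ne hne]
  · rw [prod_upFactor_children hT hc, ← hB, ← prod_sdiff hBR]
    ring

lemma sum_mul_prod_exp_spin {c : Fin M} {J : Finset (Fin k)} {g : (Fin N → Bool) → ℝ}
    (hg : ∀ l ∈ J, FreeOf g (F.var c l)) (h : Fin k → ℝ) :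
    ∑ x, g x * ∏ l ∈ J, Real.exp (h l * spin F c l (x (F.var c l))) =
      (∏ l ∈ J, (Real.exp (h l) + Real.exp (-h l)) / 2) * ∑ x, g x := by
  rw [sum_mul_prod_of_freeOf (v := F.var c) (var_injective F c) hg
    fun l b => Real.exp (h l * spin F c l b)]
  simp only [sum_bool_exp_spin]

lemma sum_mul_prod_unsat_exp_spin {c : Fin M} {J : Finset (Fin k)} {g : (Fin N → Bool) → ℝ}
    (hg : ∀ l ∈ J, FreeOf g (F.var c l)) (h : Fin k → ℝ) :
    ∑ x, g x * ∏ l ∈ J, ((if x (F.var c l) ≠ F.sign c l then (1 : ℝ) else 0) *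
        Real.exp (h l * spin F c l (x (F.var c l)))) =
      (∏ l ∈ J, (Real.exp (h l) + Real.exp (-h l)) / 2) * (∏ l ∈ J, unsat (h l)) *
        ∑ x, g x := by
  rw [sum_mul_prod_of_freeOf (v := F.var c) (var_injective F c) hg
    fun l b => (if b ≠ F.sign c l then (1 : ℝ) else 0) * Real.exp (h l * spin F c l b)]
  simp only [sum_bool_unsat_exp_spin, ← prod_mul_distrib]
  congr 1
  exact prod_congr rfl fun l _ => by ring

/-- Replacing one more clause by its message multiplies all sums by the same factor. -/
lemma sum_partialWeight_insert (hT : IsTree F a n dep par) {c : Fin M} (hc : dep c ≤ n)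
    (hca : c ≠ a) {S : Finset (Fin M)} (hcS : c ∉ S) (hS : ∀ b ∈ S, dep b ≤ dep c) (β : ℝ)
    (η : Fin N → Bool) : ∃ C : ℝ, 0 < C ∧ ∀ f : (Fin N → Bool) → ℝ,
      (∀ l ∈ exits a par c, FreeOf f (F.var c l)) →
      ∑ x, f x * partialWeight F a n dep par β η (insert c S) x =
        C * ∑ x, f x * partialWeight F a n dep par β η S x := by
  classical
  set U := upMessage F n dep par β η c with hU
  set h := fieldOf F (msgIter β F (n - dep c) (boundaryMessage F β η)) c with hh
  have hJ : exits a par c = univ.erase (par c) := by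
    ext l; rw [mem_exits, mem_erase]; simp [hca]
  have hUq : Real.exp (-2 * U) = 1 - (1 - Real.exp (-β)) * ∏ l ∈ exits a par c, unsat (h l) := by
    rw [hU, upMessage, show n + 1 - dep c = (n - dep c) + 1 by omega, msgIter_succ, clauseMessage,
      exp_neg_two_mul_messageFun, hJ]
  refine ⟨Real.exp (-U), Real.exp_pos _, fun f hf => ?_⟩
  obtain ⟨g, hg, hfg⟩ := exists_elimination hT hc hcS hS β η hf
  rw [← hh] at hfg
  set A := ∏ l ∈ exits a par c, (Real.exp (h l) + Real.exp (-h l)) / 2 with hA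
  set bad : (Fin N → Bool) → ℝ :=
    fun x => if x (F.var c (par c)) ≠ F.sign c (par c) then 1 else 0 with hbad
  have hgbad : ∀ l ∈ exits a par c, FreeOf (fun x => g x * bad x) (F.var c l) := by
    intro l hl
    refine (hg l hl).mul (freeOf_comp ((var_injective F c).ne ?_)
      fun v => if v ≠ F.sign c (par c) then 1 else 0)
    rw [hJ] at hl
    exact (ne_of_mem_erase hl).symm
  have e1 : ∑ x, f x * partialWeight F a n dep par β η (insert c S) x =
      A * ∑ x, g x - (1 - Real.exp (-β)) *
        (A * (∏ l ∈ exits a par c, unsat (h l)) * ∑ x, g x * bad x) := by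
    rw [hA, ← sum_mul_prod_exp_spin hg h, ← sum_mul_prod_unsat_exp_spin hgbad h, mul_sum,
      ← sum_sub_distrib]
    refine sum_congr rfl fun x _ => ?_
    have hv : violation F c x = bad x *
        ∏ l ∈ exits a par c, if x (F.var c l) ≠ F.sign c l then (1 : ℝ) else 0 := by
      rw [hJ, violation_eq_prod, ← mul_prod_erase univ _ (mem_univ (par c))]
    rw [partialWeight, prod_insert hcS, prod_mul_distrib]
    have := hfg x
    rw [exp_neg_mul_violation, hv]
    linear_combination (1 - (1 - Real.exp (-β)) * (bad x *
      ∏ l ∈ exits a par c, if x (F.var c l) ≠ F.sign c l then (1 : ℝ) else 0)) * this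
  have hfil : (univ.filter fun b => b ∉ S ∧ dep b ≤ n + 1) =
      insert c (univ.filter fun b => b ∉ insert c S ∧ dep b ≤ n + 1) := by
    ext b
    simp only [mem_filter, mem_univ, true_and, mem_insert, not_or]
    by_cases hb : b = c
    · subst hb; simp [hcS]; omega
    · simp [hb]
  have e2 : ∑ x, f x * partialWeight F a n dep par β η S x =
      Real.exp U * (A * ∑ x, g x) - Real.exp U * (1 - Real.exp (-2 * U)) *
        (A * ∑ x, g x * bad x) := by
    rw [hA, ← sum_mul_prod_exp_spin hg h, ← sum_mul_prod_exp_spin hgbad h, mul_sum, mul_sum,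
      ← sum_sub_distrib]
    refine sum_congr rfl fun x _ => ?_
    rw [partialWeight, hfil, prod_insert (by simp)]
    have hup : upFactor F n dep par β η c x =
        Real.exp U * (1 - (1 - Real.exp (-2 * U)) * bad x) := exp_mul_spin _ _
    rw [hup]
    linear_combination (Real.exp U * (1 - (1 - Real.exp (-2 * U)) * bad x)) * hfg x
  rw [e1, e2, hUq]
  have : Real.exp (-U) * Real.exp U = 1 := by rw [← Real.exp_add]; simp
  linear_combination (-(A * ∑ x, g x) + (1 - Real.exp (-β)) *
    (∏ l ∈ exits a par c, unsat (h l)) * (A * ∑ x, g x * bad x)) * this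

/-- All clauses other than `a` can be replaced by their messages. -/
lemma sum_partialWeight (hT : IsTree F a n dep par) (β : ℝ) (η : Fin N → Bool) :
    ∀ m (S : Finset (Fin M)), #((univ.filter fun c => dep c ≤ n) \ S) = m → a ∈ S →
      (∀ c ∈ S, dep c ≤ n) →
      (∀ c ∈ S, ∀ b ∉ S, dep c ≤ dep b) → ∃ C : ℝ, 0 < C ∧ ∀ f : (Fin N → Bool) → ℝ,
      (∀ c, dep c ≤ n → c ≠ a → ∀ l ∈ exits a par c, FreeOf f (F.var c l)) →
      ∑ x, f x * partialWeight F a n dep par β η {c | dep c ≤ n} x =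
        C * ∑ x, f x * partialWeight F a n dep par β η S x := by
  classical
  intro m
  induction m with
  | zero =>
    intro S hm _ hS _
    have : S = univ.filter fun c => dep c ≤ n := by
      refine Subset.antisymm (fun c hc => by simpa using hS c hc) ?_
      rwa [card_eq_zero, sdiff_eq_empty_iff_subset] at hm
    exact ⟨1, one_pos, fun f _ => by rw [this, one_mul]⟩
  | succ m ih =>
    intro S hm ha hS hseg
    have hne : ((univ.filter fun c => dep c ≤ n) \ S).Nonempty := by
      rw [← card_pos, hm]; omega
    obtain ⟨c, hc, hmin⟩ := exists_min_image _ dep hne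
    rw [Finset.mem_sdiff, mem_filter] at hc
    have hca : c ≠ a := by rintro rfl; exact hc.2 ha
    obtain ⟨C₁, hC₁, h₁⟩ := ih (insert c S)
      (by
        rw [sdiff_insert, card_erase_of_mem (by simpa using hc), hm, Nat.add_sub_cancel])
      (mem_insert_of_mem ha)
      (fun b hb => by
        rcases mem_insert.1 hb with rfl | hb
        · exact hc.1.2
        · exact hS b hb)
      (fun b hb b' hb' => by
        rw [mem_insert, not_or] at hb'
        rcases mem_insert.1 hb with rfl | hb
        · by_cases h : dep b' ≤ n
          · exact hmin b' (Finset.mem_sdiff.2 ⟨mem_filter.2 ⟨mem_univ _, h⟩, hb'.2⟩)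
          · have := hc.1.2
            omega
        · exact hseg b hb b' hb'.2)
    obtain ⟨C₂, hC₂, h₂⟩ := sum_partialWeight_insert hT hc.1.2 hca hc.2
      (fun b hb => hseg b hb c hc.2) β η
    refine ⟨C₁ * C₂, mul_pos hC₁ hC₂, fun f hf => ?_⟩
    rw [h₁ f hf, h₂ f (hf c hc.1.2 hca), mul_assoc]

/-- Given the values of the variables outside the interior, the probability that `a` is violated is
the one computed by belief propagation from the boundary messages. -/
lemma sum_violation_mul_pin (hT : IsTree F a n dep par) (β : ℝ) (η : Fin N → Bool) :
    ∑ x, violation F a x * (boltzmann β F x * pin F a n dep par η x) =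
      violProb β univ (fieldOf F (msgIter β F n (boundaryMessage F β η)) a) *
        ∑ x, boltzmann β F x * pin F a n dep par η x := by
  classical
  have hda : dep a = 0 := (hT.dep_eq_zero a).2 rfl
  obtain ⟨C, -, hC⟩ := boltzmann_mul_pin hT β η
  obtain ⟨C', -, hC'⟩ := sum_partialWeight hT β η _ {a} rfl (mem_singleton_self a)
    (fun c hc => by rw [mem_singleton.1 hc, hda]; omega)
    (fun c hc b _ => by rw [mem_singleton.1 hc, hda]; omega)
  have hfree : ∀ c, dep c ≤ n → c ≠ a → ∀ l ∈ exits a par c,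
      FreeOf (violation F a) (F.var c l) := by
    intro c hc hca l hl
    refine freeOf_violation fun j hj => ?_
    have := (hT.child c l (a, j) hc (mem_exits.1 hl) (mem_neighbors.2 ⟨hca.symm, hj⟩)).1
    dsimp only at this
    omega
  have key : ∑ x, violation F a x * partialWeight F a n dep par β η {a} x =
      violProb β univ (fieldOf F (msgIter β F n (boundaryMessage F β η)) a) *
        ∑ x, 1 * partialWeight F a n dep par β η {a} x := by
    obtain ⟨g, hg, hfg⟩ := exists_elimination (f := fun _ => 1) hT (c := a) (S := ∅)
      (by omega) (by simp) (by simp) β η (fun _ _ _ _ => rfl)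
    rw [hda, Nat.sub_zero] at hfg
    set h := fieldOf F (msgIter β F n (boundaryMessage F β η)) a with hh
    have hJ : exits a par a = univ := by ext l; rw [mem_exits]; simp
    rw [hJ] at hg hfg
    set A := ∏ l, (Real.exp (h l) + Real.exp (-h l)) / 2 with hA
    have hvv : ∀ x, violation F a x * violation F a x = violation F a x := by
      intro x; unfold violation clauseEnergy; split_ifs <;> simp
    have hpw : ∀ x, partialWeight F a n dep par β η {a} x =
        (1 - (1 - Real.exp (-β)) * violation F a x) *
          (g x * ∏ l, Real.exp (h l * spin F a l (x (F.var a l)))) := by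
      intro x
      rw [← hfg x, partialWeight, prod_singleton, exp_neg_mul_violation]
      simp only [insert_empty_eq, prod_empty]
      ring
    have e0 := sum_mul_prod_exp_spin hg h
    have e1 : ∑ x, violation F a x * (g x * ∏ l, Real.exp (h l * spin F a l (x (F.var a l)))) =
        A * (∏ l, unsat (h l)) * ∑ x, g x := by
      rw [hA, ← sum_mul_prod_unsat_exp_spin hg h]
      refine sum_congr rfl fun x _ => ?_
      rw [violation_eq_prod, prod_mul_distrib]
      ring
    have e2 : ∑ x, violation F a x * partialWeight F a n dep par β η {a} x =
        Real.exp (-β) * (A * (∏ l, unsat (h l)) * ∑ x, g x) := by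
      rw [← e1, mul_sum]
      refine sum_congr rfl fun x _ => ?_
      rw [hpw]
      linear_combination (-(1 - Real.exp (-β)) *
        (g x * ∏ l, Real.exp (h l * spin F a l (x (F.var a l))))) * hvv x
    have e3 : ∑ x, 1 * partialWeight F a n dep par β η {a} x =
        A * ∑ x, g x - (1 - Real.exp (-β)) * (A * (∏ l, unsat (h l)) * ∑ x, g x) := by
      rw [← e1, hA, ← e0, mul_sum, ← sum_sub_distrib]
      refine sum_congr rfl fun x _ => ?_
      rw [hpw]
      ring
    rw [e2, e3, violProb]
    have := (one_sub_mul_pos β univ h).ne'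
    rw [div_mul_eq_mul_div, eq_div_iff this]
    ring
  simp only [hC]
  have h1 := hC' _ hfree
  have h2 := hC' (fun _ => 1) fun _ _ _ _ _ _ _ => rfl
  calc ∑ x, violation F a x * (C * partialWeight F a n dep par β η {c | dep c ≤ n} x)
      = C * ∑ x, violation F a x * partialWeight F a n dep par β η {c | dep c ≤ n} x := by
        rw [mul_sum]; exact sum_congr rfl fun x _ => by ring
    _ = violProb β univ (fieldOf F (msgIter β F n (boundaryMessage F β η)) a) *
          (C * ∑ x, 1 * partialWeight F a n dep par β η {c | dep c ≤ n} x) := by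
        rw [h1, h2, key]; ring
    _ = _ := by
        congr 1
        rw [mul_sum]
        exact sum_congr rfl fun x _ => by ring

end Elimination

/-- The Gibbs expectation of the energy of clause `a`. -/
noncomputable def gibbsClauseEnergy (β : ℝ) (F : Formula k N M) (a : Fin M) : ℝ :=
  (∑ x, violation F a x * boltzmann β F x) / ∑ x, boltzmann β F x

/-- In a tree-like neighbourhood of clause `a`, belief propagation approximates the expectation of
the energy of `a` up to the influence of the boundary. -/
lemma abs_gibbs_sub_le (hk : 2 ≤ k) {β : ℝ} (hβ : 0 ≤ β) {F : Formula k N M} {a : Fin M} {n L : ℕ}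
    (hN : NoLasso F a L) (hL : 2 * n + 2 ≤ L + 1) {u : Messages k M}
    (hu : ∀ a j, u a j ∈ Set.Icc 0 (β / 2)) :
    |gibbsClauseEnergy β F a - violProb β univ (fieldOf F (msgIter β F n u) a)| ≤
      β * ∑ i, influence F (n + 1) (a, i) := by
  classical
  obtain ⟨dep, par, hT⟩ := hN.exists_isTree hk hL
  set I := interior F a n dep par with hI
  set B := violProb β univ (fieldOf F (msgIter β F n u) a) with hB
  set δ := β * ∑ i, influence F (n + 1) (a, i) with hδ
  have hw : ∀ x, 0 < boltzmann β F x := fun x => Real.exp_pos _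
  -- the assignments that vanish in the interior represent all boundary values
  set R : Finset (Fin N → Bool) := univ.filter fun η => ∀ v ∈ I, η v = false with hR
  have hone : ∀ x, ∑ η ∈ R, pin F a n dep par η x = 1 := by
    intro x
    rw [sum_eq_single_of_mem (fun v => if v ∈ I then false else x v)]
    · rw [pin, if_pos]
      intro v hv
      exact (if_neg hv).symm
    · rw [hR, mem_filter]
      exact ⟨mem_univ _, fun v hv => if_pos hv⟩
    · intro η hη hne
      rw [pin, if_neg]
      intro hall
      apply hne
      funext v
      by_cases hv : v ∈ I
      · rw [if_pos hv]; exact (mem_filter.1 hη).2 v hv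
      · rw [if_neg hv]; exact (hall v hv).symm
  have hsplit : ∀ f : (Fin N → Bool) → ℝ,
      ∑ x, f x = ∑ η ∈ R, ∑ x, f x * pin F a n dep par η x := by
    intro f
    rw [sum_comm]
    refine sum_congr rfl fun x _ => ?_
    rw [← mul_sum, hone, mul_one]
  have hZ : 0 < ∑ x, boltzmann β F x := sum_pos (fun x _ => hw x) ⟨fun _ => true, mem_univ _⟩
  have hpin : ∀ η x, 0 ≤ pin F a n dep par η x := by
    intro η x; unfold pin; split_ifs <;> norm_num
  -- the exact energy is an average of the values for the boundary conditions
  have hdiff : ∑ x, violation F a x * boltzmann β F x - B * ∑ x, boltzmann β F x =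
      ∑ η ∈ R, (violProb β univ (fieldOf F (msgIter β F n (boundaryMessage F β η)) a) - B) *
        ∑ x, boltzmann β F x * pin F a n dep par η x := by
    rw [hsplit, hsplit (boltzmann β F), mul_sum, ← sum_sub_distrib]
    refine sum_congr rfl fun η _ => ?_
    rw [sub_mul, ← sum_violation_mul_pin hT]
    congr 1
    exact sum_congr rfl fun x _ => by ring
  rw [gibbsClauseEnergy, div_sub' hZ.ne', abs_div, abs_of_pos hZ, div_le_iff₀ hZ,
    mul_comm (∑ x, boltzmann β F x) B, hdiff]
  refine (abs_sum_le_sum_abs _ _).trans ?_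
  rw [hsplit (boltzmann β F), mul_sum]
  refine sum_le_sum fun η _ => ?_
  rw [abs_mul, abs_of_nonneg (a := ∑ x, boltzmann β F x * pin F a n dep par η x)
    (sum_nonneg fun x _ => mul_nonneg (hw x).le (hpin η x))]
  exact mul_le_mul_of_nonneg_right
    (abs_violProb_msgIter_sub_le hk hβ F hu (boundaryMessage_mem F hβ η) n a)
    (sum_nonneg fun x _ => mul_nonneg (hw x).le (hpin η x))

lemma gibbsClauseEnergy_mem (β : ℝ) (F : Formula k N M) (a : Fin M) :
    gibbsClauseEnergy β F a ∈ Set.Icc (0 : ℝ) 1 := by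
  have hw : ∀ x, 0 < boltzmann β F x := fun x => Real.exp_pos _
  have hZ : 0 < ∑ x, boltzmann β F x := sum_pos (fun x _ => hw x) ⟨fun _ => true, mem_univ _⟩
  refine ⟨div_nonneg (sum_nonneg fun x _ => mul_nonneg (violation_nonneg F a x) (hw x).le) hZ.le,
    (div_le_one hZ).2 (sum_le_sum fun x _ => ?_)⟩
  exact mul_le_of_le_one_left (hw x).le (violation_le_one F a x)

lemma clauseMessage_mem {β : ℝ} (hβ : 0 ≤ β) (h : Messages k M) (a : Fin M) (j : Fin k) :
    clauseMessage β h a j ∈ Set.Icc 0 (β / 2) :=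
  ⟨messageFun_nonneg hβ _ _, messageFun_le hβ _ _⟩

/-- The error of belief propagation, with as many iterations as the diameter of the factor graph,
for the energy of a clause with a tree-like neighbourhood. -/
lemma abs_gibbs_sub_bp_le (hk : 2 ≤ k) {β : ℝ} (hβ : 0 ≤ β) {F : Formula k N M} {a : Fin M}
    {n L : ℕ} (hN : NoLasso F a L) (hL : 2 * n + 2 ≤ L + 1) :
    |gibbsClauseEnergy β F a - bpClauseEnergy β F a| ≤
      β * ∑ i, influence F (n + 1) (a, i) := by
  have hbp : ∀ m, m + 1 ≤ diameter F → bpClauseEnergy β F a = violProb β univ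
      (fieldOf F (msgIter β F m (clauseMessage β ((bpStep β F)^[diameter F - (m + 1)] 0))) a) := by
    intro m hm
    rw [bpClauseEnergy_eq, bpMessages]
    conv_lhs => rw [← Nat.add_sub_of_le hm, Function.iterate_add_apply, bpStep_iterate_succ]
  have hpos := one_le_diameter hk F a
  -- the first `diameter F - (n + 1)` iterations only produce initial messages for the last ones
  by_cases h : n + 1 ≤ diameter F
  · rw [hbp n h]
    exact abs_gibbs_sub_le hk hβ hN hL (clauseMessage_mem hβ _)
  · obtain ⟨m, hm⟩ : ∃ m, diameter F = m + 1 := ⟨diameter F - 1, by omega⟩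
    have h1 := abs_gibbs_sub_le hk hβ hN (n := m) (by omega)
      (clauseMessage_mem hβ ((bpStep β F)^[diameter F - (m + 1)] 0))
    rw [← hbp m hm.ge] at h1
    have h2 : ∀ i, influence F (m + 1) (a, i) = 0 := fun i => by
      rw [← hm]; exact influence_diameter_eq_zero hk hN (by omega) i
    rw [sum_eq_zero fun i _ => h2 i, mul_zero] at h1
    exact h1.trans (mul_nonneg hβ (sum_nonneg fun i _ => influence_nonneg F _ _))

end KSat

/-! ### Random clauses and random formulas -/

namespace KSat

variable {k N M : ℕ}

open Classical in
/-- The indicator of a proposition. -/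
noncomputable def ind (p : Prop) : ℝ := if p then 1 else 0

lemma ind_pos {p : Prop} (h : p) : ind p = 1 := if_pos h

lemma ind_neg {p : Prop} (h : ¬ p) : ind p = 0 := if_neg h

lemma ind_nonneg (p : Prop) : 0 ≤ ind p := by unfold ind; split_ifs <;> norm_num

lemma ind_le_one (p : Prop) : ind p ≤ 1 := by unfold ind; split_ifs <;> norm_num

lemma ind_mono {p q : Prop} (h : p → q) : ind p ≤ ind q := by
  by_cases hp : p
  · rw [ind_pos hp, ind_pos (h hp)]
  · rw [ind_neg hp]; exact ind_nonneg q

lemma ind_and (p q : Prop) : ind (p ∧ q) = ind p * ind q := by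
  by_cases hp : p <;> by_cases hq : q <;> simp [ind, hp, hq]

lemma expect_mono {ι : Type*} [Fintype ι] {f g : ι → ℝ} (h : ∀ i, f i ≤ g i) :
    𝔼 i, f i ≤ 𝔼 i, g i := expect_le_expect fun i _ => h i

lemma expect_nonneg' {ι : Type*} [Fintype ι] {f : ι → ℝ} (h : ∀ i, 0 ≤ f i) : 0 ≤ 𝔼 i, f i :=
  expect_nonneg fun i _ => h i

lemma sum_ind_eq {ι : Type*} (s : Finset ι) (v : ι) : ∑ w ∈ s, ind (v = w) = ind (v ∈ s) := by
  by_cases h : v ∈ s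
  · rw [sum_eq_single_of_mem v h fun w _ hw => ind_neg hw.symm, ind_pos rfl, ind_pos h]
  · rw [ind_neg h, sum_eq_zero]
    rintro w hw
    exact ind_neg (by rintro rfl; exact h hw)

lemma card_filter_eq_sum_ind {ι : Type*} (s : Finset ι) (p : ι → Prop) [DecidablePred p] :
    (#(s.filter p) : ℝ) = ∑ i ∈ s, ind (p i) := by
  rw [← sum_boole]
  exact sum_congr rfl fun i _ => by by_cases h : p i <;> simp [ind, h]

lemma expect_prod_type {ι κ : Type*} [Fintype ι] [Fintype κ] (f : ι × κ → ℝ) :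
    𝔼 p, f p = 𝔼 i, 𝔼 j, f (i, j) := by
  rw [← univ_product_univ, expect_product]

lemma prob_eq_expect (P : Formula k N M → Prop) : prob k N M P = 𝔼 F, ind (P F) := by
  classical
  rw [prob, Fintype.expect_eq_sum_div_card, Nat.card_eq_fintype_card, Nat.card_eq_fintype_card,
    Fintype.card_subtype, ← sum_boole]
  rfl

/-! ### Resampling -/

/-- The formula `F` with the clauses in `O` taken from `G`. -/
def mix (O : Finset (Fin M)) (F G : Formula k N M) : Formula k N M :=
  fun c => if c ∈ O then G c else F c

/-- The clauses in `O` are independent of the others, so they may be drawn from a second formula. -/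
lemma expect_mix (O : Finset (Fin M)) (Ψ : Formula k N M → ℝ) :
    𝔼 F, Ψ F = 𝔼 F, 𝔼 G, Ψ (mix O F G) := by
  rcases isEmpty_or_nonempty (Formula k N M) with h | h
  · simp
  have hinv : Function.Involutive fun p : Formula k N M × Formula k N M =>
      (mix O p.1 p.2, mix O p.2 p.1) := by
    rintro ⟨F, G⟩
    refine Prod.ext (funext fun c => ?_) (funext fun c => ?_) <;> by_cases hc : c ∈ O <;>
      simp [mix, hc]
  calc 𝔼 F, Ψ F = 𝔼 F, 𝔼 _G : Formula k N M, Ψ F := by simp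
    _ = 𝔼 p : Formula k N M × Formula k N M, Ψ p.1 := by
        rw [expect_prod_type]
    _ = 𝔼 p : Formula k N M × Formula k N M, Ψ (mix O p.1 p.2) :=
        (Fintype.expect_equiv hinv.toPerm _ _ fun _ => rfl).symm
    _ = _ := by rw [expect_prod_type]

/-- A single clause may be drawn again. -/
lemma expect_update (c : Fin M) (Ψ : Formula k N M → ℝ) :
    𝔼 F, Ψ F = 𝔼 F, 𝔼 ω : Clause k N, Ψ (Function.update F c ω) := by
  rcases isEmpty_or_nonempty (Clause k N) with h | h
  · have : IsEmpty (Formula k N M) := ⟨fun F => h.elim (F c)⟩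
    simp
  have hinv : Function.Involutive fun p : Formula k N M × Clause k N =>
      ((Function.update p.1 c p.2 : Formula k N M), p.1 c) := by
    rintro ⟨F, ω⟩
    simp
  calc 𝔼 F, Ψ F = 𝔼 F, 𝔼 _ω : Clause k N, Ψ F := by simp
    _ = 𝔼 p : Formula k N M × Clause k N, Ψ p.1 := by
        rw [expect_prod_type]
    _ = 𝔼 p : Formula k N M × Clause k N, Ψ (Function.update p.1 c p.2) :=
        (Fintype.expect_equiv hinv.toPerm _ _ fun _ => rfl).symm
    _ = _ := by rw [expect_prod_type]

/-- The clauses of a random formula are independent. -/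
lemma expect_prod_eq_pow (O : Finset (Fin M)) (hN : Nonempty (Clause k N)) (g : Clause k N → ℝ) :
    𝔼 F : Formula k N M, ∏ c ∈ O, g (F c) = (𝔼 ω, g ω) ^ #O := by
  have h1 : ∀ F : Formula k N M, ∏ c ∈ O, g (F c) = ∏ c, if c ∈ O then g (F c) else 1 := by
    intro F
    rw [prod_ite_mem, univ_inter]
  have h2 : ∑ F : Formula k N M, ∏ c, (if c ∈ O then g (F c) else 1) =
      ∏ c : Fin M, ∑ ω, if c ∈ O then g ω else 1 := by
    rw [prod_univ_sum (fun _ => univ) fun c ω => if c ∈ O then g ω else 1, Fintype.piFinset_univ]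
  rw [Fintype.expect_eq_sum_div_card, Fintype.expect_eq_sum_div_card]
  simp_rw [h1]
  have hc : (Fintype.card (Formula k N M) : ℝ) = ∏ _c : Fin M, (Fintype.card (Clause k N) : ℝ) := by
    rw [prod_const, card_univ, Fintype.card_fin]
    norm_cast
    rw [Fintype.card_fun, Fintype.card_fin]
  rw [h2, hc, ← prod_div_distrib]
  have h0 : (Fintype.card (Clause k N) : ℝ) ≠ 0 := by
    exact_mod_cast Fintype.card_ne_zero
  calc ∏ c : Fin M, (∑ ω, if c ∈ O then g ω else 1) / (Fintype.card (Clause k N) : ℝ)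
      = ∏ c : Fin M, if c ∈ O then (∑ ω, g ω) / (Fintype.card (Clause k N) : ℝ) else 1 := by
        refine prod_congr rfl fun c _ => ?_
        split_ifs
        · rfl
        · rw [sum_const, card_univ, nsmul_eq_mul, mul_one, div_self h0]
    _ = _ := by rw [prod_ite_mem, univ_inter, prod_const]

/-! ### Random signs and random variables -/

lemma nonempty_clause (hN : k ≤ N) : Nonempty (Clause k N) :=
  ⟨(Fin.castLEEmb hN, fun _ => true)⟩

lemma expect_clause (f : (Fin k ↪ Fin N) → ℝ) (g : (Fin k → Bool) → ℝ) :
    𝔼 ω : Clause k N, f ω.1 * g ω.2 = (𝔼 e, f e) * 𝔼 σ, g σ := by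
  rw [Fintype.expect_mul_expect, ← univ_product_univ, expect_product]

lemma expect_sign_mul {g : (Fin k → Bool) → ℝ} {i : Fin k}
    (hg : ∀ σ b, g (Function.update σ i b) = g σ) (φ : Bool → ℝ) :
    𝔼 σ : Fin k → Bool, φ (σ i) * g σ = (φ true + φ false) / 2 * 𝔼 σ, g σ := by
  have hinv : Function.Involutive fun σ : Fin k → Bool => Function.update σ i (!(σ i)) := by
    intro σ; simp
  have h1 : 𝔼 σ : Fin k → Bool, φ (!(σ i)) * g σ = 𝔼 σ : Fin k → Bool, φ (σ i) * g σ :=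
    Fintype.expect_equiv hinv.toPerm _ _ fun σ => by
      simp only [Function.Involutive.coe_toPerm, Function.update_self]
      rw [hg]
  have h2 : 𝔼 σ : Fin k → Bool, φ (σ i) * g σ + 𝔼 σ : Fin k → Bool, φ (!(σ i)) * g σ =
      (φ true + φ false) * 𝔼 σ, g σ := by
    rw [← expect_add_distrib, mul_expect]
    refine expect_congr rfl fun σ _ => ?_
    cases σ i <;> simp <;> ring
  rw [h1] at h2
  linarith

lemma expect_sign (i : Fin k) (φ : Bool → ℝ) :
    𝔼 σ : Fin k → Bool, φ (σ i) = (φ true + φ false) / 2 := by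
  have := expect_sign_mul (g := fun _ => 1) (i := i) (fun _ _ => rfl) φ
  simpa using this

lemma expect_sign_two {i j : Fin k} (hij : i ≠ j) (s s' : Bool) :
    𝔼 σ : Fin k → Bool, ind (σ i = s) * ind (σ j = s') = 1 / 4 := by
  rw [expect_sign_mul (g := fun σ => ind (σ j = s')) (i := i)
    (fun σ b => by rw [Function.update_of_ne hij.symm]) fun b => ind (b = s),
    expect_sign j fun b => ind (b = s')]
  cases s <;> cases s' <;> simp [ind] <;> norm_num

/-- The distribution of the variables of a random clause is invariant under permutations. -/
lemma expect_embedding_perm (π : Equiv.Perm (Fin N)) (f : (Fin k ↪ Fin N) → ℝ) :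
    𝔼 e : Fin k ↪ Fin N, f (e.trans π.toEmbedding) = 𝔼 e, f e :=
  Fintype.expect_equiv (Equiv.embeddingCongr (Equiv.refl _) π) _ _ fun e => by
    congr 1

lemma expect_var (hN : k ≤ N) (i : Fin k) (v : Fin N) :
    𝔼 e : Fin k ↪ Fin N, ind (e i = v) = 1 / N := by
  have : Nonempty (Fin k ↪ Fin N) := ⟨Fin.castLEEmb hN⟩
  -- by symmetry all variables are equally likely
  have hsym : ∀ w, 𝔼 e : Fin k ↪ Fin N, ind (e i = w) = 𝔼 e : Fin k ↪ Fin N, ind (e i = v) := by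
    intro w
    rw [← expect_embedding_perm (Equiv.swap v w)]
    refine expect_congr rfl fun e _ => ?_
    congr 1
    simp [Equiv.swap_apply_eq_iff]
  have hsum : ∑ w, 𝔼 e : Fin k ↪ Fin N, ind (e i = w) = 1 := by
    rw [← expect_sum_comm]
    have : ∀ e : Fin k ↪ Fin N, ∑ w, ind (e i = w) = 1 := by
      intro e
      rw [sum_ind_eq, ind_pos (mem_univ _)]
    simp [this]
  simp_rw [hsym] at hsum
  rw [sum_const, card_univ, Fintype.card_fin, nsmul_eq_mul] at hsum
  have : (N : ℝ) ≠ 0 := by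
    rintro h
    rw [h, zero_mul] at hsum
    exact zero_ne_one hsum
  field_simp
  linarith

lemma expect_var_two (hN : k ≤ N) {i j : Fin k} (hij : i ≠ j) (v w : Fin N) :
    𝔼 e : Fin k ↪ Fin N, ind (e i = v) * ind (e j = w) ≤ 1 / (N * (N - 1)) := by
  have : Nonempty (Fin k ↪ Fin N) := ⟨Fin.castLEEmb hN⟩
  have hN2 : 2 ≤ N := by
    have h1 := i.2
    have h2 := j.2
    have h3 : (i : ℕ) ≠ j := fun h => hij (Fin.ext h)
    omega
  have hN2' : (2 : ℝ) ≤ N := by exact_mod_cast hN2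
  by_cases hvw : v = w
  · subst hvw
    rw [expect_eq_zero]
    · have : (0 : ℝ) ≤ N - 1 := by linarith
      positivity
    · intro e _
      rw [← ind_and, ind_neg]
      rintro ⟨h1, h2⟩
      exact hij (e.injective (h1.trans h2.symm))
  have hsym : ∀ w', w' ≠ v → 𝔼 e : Fin k ↪ Fin N, ind (e i = v) * ind (e j = w') =
      𝔼 e : Fin k ↪ Fin N, ind (e i = v) * ind (e j = w) := by
    intro w' hw'
    rw [← expect_embedding_perm (Equiv.swap w w')]
    refine expect_congr rfl fun e _ => ?_
    congr 2
    · simp only [Function.Embedding.trans_apply, Equiv.toEmbedding_apply,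
        Equiv.swap_apply_eq_iff, Equiv.swap_apply_of_ne_of_ne hvw hw'.symm]
    · simp [Equiv.swap_apply_eq_iff]
  have hsum : ∑ w' ∈ univ.erase v, 𝔼 e : Fin k ↪ Fin N, ind (e i = v) * ind (e j = w') ≤
      1 / N := by
    rw [← expect_sum_comm, ← expect_var hN i v]
    refine expect_mono fun e => ?_
    rw [← mul_sum]
    refine mul_le_of_le_one_right (ind_nonneg _) ?_
    calc ∑ w' ∈ univ.erase v, ind (e j = w') ≤ ∑ w', ind (e j = w') :=
          sum_le_sum_of_subset_of_nonneg (erase_subset _ _) fun _ _ _ => ind_nonneg _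
      _ = 1 := by rw [sum_ind_eq, ind_pos (mem_univ _)]
  rw [sum_congr rfl fun w' hw' => hsym w' (ne_of_mem_erase hw'), sum_const,
    card_erase_of_mem (mem_univ v), card_univ, Fintype.card_fin, nsmul_eq_mul,
    Nat.cast_sub (by omega), Nat.cast_one] at hsum
  rw [le_div_iff₀ (by nlinarith)]
  rw [le_div_iff₀ (by linarith)] at hsum
  linarith

/-- The probability that a given position of a random clause contains a given variable, weighted
with a function of the sign. -/
lemma expect_link (hN : k ≤ N) (i : Fin k) (v : Fin N) (φ : Bool → ℝ) :
    𝔼 ω : Clause k N, ind (ω.1 i = v) * φ (ω.2 i) = (φ true + φ false) / (2 * N) := by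
  rw [expect_clause (fun e => ind (e i = v)) fun σ => φ (σ i), expect_var hN, expect_sign]
  ring

lemma expect_link_mem_le (hN : k ≤ N) {i j : Fin k} (hij : i ≠ j) (v : Fin N) (W : Finset (Fin N))
    {φ : Bool → ℝ} (hφ : ∀ b, 0 ≤ φ b) :
    𝔼 ω : Clause k N, ind (ω.1 i = v) * φ (ω.2 i) * ind (ω.1 j ∈ W) ≤
      (φ true + φ false) / 2 * (#W / (N * (N - 1))) := by
  have h1 : ∀ ω : Clause k N, ind (ω.1 i = v) * φ (ω.2 i) * ind (ω.1 j ∈ W) =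
      (ind (ω.1 i = v) * ind (ω.1 j ∈ W)) * φ (ω.2 i) := fun ω => by ring
  simp_rw [h1]
  rw [expect_clause (fun e => ind (e i = v) * ind (e j ∈ W)) fun σ => φ (σ i), expect_sign,
    mul_comm]
  refine mul_le_mul_of_nonneg_left ?_ (by linarith [hφ true, hφ false])
  have h2 : ∀ e : Fin k ↪ Fin N, ind (e i = v) * ind (e j ∈ W) =
      ∑ w ∈ W, ind (e i = v) * ind (e j = w) := by
    intro e
    rw [← mul_sum]
    rw [sum_ind_eq]
  simp_rw [h2]
  rw [expect_sum_comm]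
  refine (sum_le_sum fun w _ => expect_var_two hN hij v w).trans ?_
  rw [sum_const, nsmul_eq_mul]
  exact le_of_eq (by ring)

/-- Clause `ω` contains the literal `lam`. -/
def HasLit (ω : Clause k N) (lam : Fin N × Bool) : Prop := ∃ i, ω.1 i = lam.1 ∧ ω.2 i = lam.2

/-- The first two Bonferroni inequalities, pointwise: `X` is the number of events that occur. -/
lemma ind_eq_zero_bounds (X : ℕ) :
    1 - (X : ℝ) ≤ ind (X = 0) ∧ ind (X = 0) ≤ 1 - X + (X * X - X) / 2 := by
  rcases Nat.eq_zero_or_pos X with rfl | h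
  · simp [ind]
  · rw [ind_neg h.ne']
    have h1 : (1 : ℝ) ≤ X := by exact_mod_cast h
    refine ⟨by linarith, ?_⟩
    rcases eq_or_lt_of_le (Nat.succ_le_of_lt h) with h2 | h2
    · rw [← h2]; norm_num
    · have : (2 : ℝ) ≤ X := by exact_mod_cast h2
      nlinarith

/-- Bonferroni bounds for the probability that a random clause avoids the literals in `B`. -/
lemma expect_avoid (hN : k ≤ N) (hN2 : 2 ≤ N) (B : Finset (Fin N × Bool)) :
    1 - #B * k / (2 * N) ≤ 𝔼 ω : Clause k N, ind (∀ lam ∈ B, ¬ HasLit ω lam) ∧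
    𝔼 ω : Clause k N, ind (∀ lam ∈ B, ¬ HasLit ω lam) ≤
      1 - #B * k / (2 * N) + (#B * k) ^ 2 / (8 * (N * (N - 1))) := by
  classical
  have := nonempty_clause hN
  set I : Clause k N → (Fin N × Bool) × Fin k → ℝ :=
    fun ω p => ind (ω.1 p.2 = p.1.1) * ind (ω.2 p.2 = p.1.2) with hI
  set P : Finset ((Fin N × Bool) × Fin k) := B ×ˢ univ with hP
  have hcardP : (#P : ℝ) = #B * k := by rw [hP, card_product, card_univ, Fintype.card_fin]; simp
  set X : Clause k N → ℕ := fun ω => #{p ∈ P | ω.1 p.2 = p.1.1 ∧ ω.2 p.2 = p.1.2} with hX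
  have hXI : ∀ ω, (X ω : ℝ) = ∑ p ∈ P, I ω p := by
    intro ω
    rw [hX, card_filter_eq_sum_ind]
    exact sum_congr rfl fun p _ => ind_and _ _
  have hzero : ∀ ω, ind (∀ lam ∈ B, ¬ HasLit ω lam) = ind (X ω = 0) := by
    intro ω
    congr 1
    rw [hX, card_eq_zero, filter_eq_empty_iff, hP]
    simp only [mem_product, mem_univ, and_true, HasLit, not_exists, Prod.forall, eq_iff_iff]
    exact ⟨fun h v s i hi => h v s hi i, fun h v s hi i => h v s i hi⟩
  have hE1 : 𝔼 ω, (X ω : ℝ) = #B * k / (2 * N) := by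
    simp_rw [hXI]
    rw [expect_sum_comm, ← hcardP]
    have : ∀ p ∈ P, 𝔼 ω, I ω p = 1 / (2 * N) := by
      intro p _
      rw [hI]
      dsimp only
      rw [expect_link hN p.2 p.1.1 fun b => ind (b = p.1.2)]
      cases p.1.2 <;> simp [ind]
    rw [sum_congr rfl this, sum_const, nsmul_eq_mul]
    ring
  have hpair : ∀ p q, p ≠ q → 𝔼 ω, I ω p * I ω q ≤ 1 / (4 * (N * (N - 1))) := by
    rintro ⟨⟨v, s⟩, i⟩ ⟨⟨w, s'⟩, j⟩ hpq
    have hN2' : (2 : ℝ) ≤ N := by exact_mod_cast hN2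
    by_cases hij : i = j
    · subst hij
      rw [expect_eq_zero]
      · have : (0 : ℝ) ≤ N - 1 := by linarith
        positivity
      · intro ω _
        simp only [hI, ← ind_and]
        rw [ind_neg]
        rintro ⟨⟨h1, h2⟩, h3, h4⟩
        apply hpq
        rw [← h1, ← h2, ← h3, ← h4]
    · have h1 : ∀ ω : Clause k N, I ω ((v, s), i) * I ω ((w, s'), j) =
          (ind (ω.1 i = v) * ind (ω.1 j = w)) * (ind (ω.2 i = s) * ind (ω.2 j = s')) := by
        intro ω; simp only [hI]; ring
      simp_rw [h1]
      rw [expect_clause (fun e => ind (e i = v) * ind (e j = w))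
        fun σ => ind (σ i = s) * ind (σ j = s'), expect_sign_two hij]
      have := expect_var_two hN hij v w
      calc _ ≤ 1 / ((N : ℝ) * (N - 1)) * (1 / 4) :=
            mul_le_mul_of_nonneg_right this (by norm_num)
        _ = _ := by rw [one_div_mul_one_div, mul_comm]
  have hE2 : 𝔼 ω, ((X ω : ℝ) * X ω - X ω) ≤ (#B * k) ^ 2 / (4 * (N * (N - 1))) := by
    have h1 : ∀ ω, (X ω : ℝ) * X ω - X ω = ∑ p ∈ P, ∑ q ∈ P.erase p, I ω p * I ω q := by
      intro ω
      rw [hXI, sum_mul_sum, ← sum_sub_distrib]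
      refine sum_congr rfl fun p hp => ?_
      rw [← add_sum_erase _ _ hp]
      have : I ω p * I ω p = I ω p := by
        simp only [hI, ← ind_and, and_self]
      rw [this]
      ring
    simp_rw [h1]
    rw [expect_sum_comm]
    have hpos : (0 : ℝ) ≤ 1 / (4 * (N * (N - 1))) := by
      have hN2' : (2 : ℝ) ≤ N := by exact_mod_cast hN2
      have : (0 : ℝ) ≤ N - 1 := by linarith
      positivity
    calc ∑ p ∈ P, 𝔼 ω, ∑ q ∈ P.erase p, I ω p * I ω q
        ≤ ∑ p ∈ P, ∑ q ∈ P, (1 / (4 * (N * (N - 1))) : ℝ) := by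
          refine sum_le_sum fun p _ => ?_
          rw [expect_sum_comm]
          refine (sum_le_sum fun q hq => hpair p q (ne_of_mem_erase hq).symm).trans ?_
          exact sum_le_sum_of_subset_of_nonneg (erase_subset _ _) fun _ _ _ => hpos
      _ = _ := by
          rw [sum_const, sum_const, nsmul_eq_mul, nsmul_eq_mul, hcardP]
          ring
  simp_rw [hzero]
  constructor
  · rw [← hE1]
    calc 1 - 𝔼 ω, (X ω : ℝ) = 𝔼 ω : Clause k N, (1 - (X ω : ℝ)) := by
          rw [expect_sub_distrib, Fintype.expect_const]
      _ ≤ _ := expect_mono fun ω => (ind_eq_zero_bounds _).1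
  · calc 𝔼 ω, ind (X ω = 0) ≤ 𝔼 ω : Clause k N, (1 - (X ω : ℝ) + (X ω * X ω - X ω) / 2) :=
          expect_mono fun ω => (ind_eq_zero_bounds _).2
      _ = 1 - 𝔼 ω, (X ω : ℝ) + (𝔼 ω, ((X ω : ℝ) * X ω - X ω)) / 2 := by
          rw [expect_add_distrib, expect_sub_distrib, Fintype.expect_const, expect_div]
      _ ≤ _ := by
          rw [hE1]
          have : ((#B : ℝ) * k) ^ 2 / (8 * (N * (N - 1))) =
              (#B * k) ^ 2 / (4 * (N * (N - 1))) / 2 := by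
            rw [div_div]; congr 1; ring
          rw [this]
          linarith

end KSat

namespace KSat

variable {k N M : ℕ}

/-! ### Products of dampings in a random formula -/

lemma prod_ind {ι : Type*} (s : Finset ι) (p : ι → Prop) :
    ∏ i ∈ s, ind (p i) = ind (∀ i ∈ s, p i) := by
  by_cases h : ∀ i ∈ s, p i
  · rw [ind_pos h, prod_eq_one fun i hi => ind_pos (h i hi)]
  · rw [ind_neg h]
    push Not at h
    obtain ⟨i, hi, hp⟩ := h
    exact prod_eq_zero hi (ind_neg hp)

/-- If the sets of literals in `B ⊆ Λ` are avoided approximately independently, then the factors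
`1 / 2` for the avoided literals multiply approximately. -/
lemma expect_prod_damped_le (hN : k ≤ N) (O : Finset (Fin M)) (Lam : Finset (Fin N × Bool))
    {q err : ℝ}
    (herr : ∀ B ⊆ Lam,
      |(𝔼 ω : Clause k N, ind (∀ lam ∈ B, ¬ HasLit ω lam)) ^ #O - q ^ #B| ≤ err) :
    𝔼 F : Formula k N M, ∏ lam ∈ Lam, (1 - 1 / 2 * ind (∀ c ∈ O, ¬ HasLit (F c) lam)) ≤
      (1 - q / 2) ^ #Lam + (3 / 2) ^ #Lam * err := by
  classical
  have hne := nonempty_clause hN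
  have hpow : ∀ x : ℝ, ∑ B ∈ Lam.powerset, x ^ #B = (1 + x) ^ #Lam := by
    intro x
    have := prod_one_add (f := fun _ : Fin N × Bool => x) Lam
    simp only [prod_const] at this
    exact this.symm
  have h1 : ∀ F : Formula k N M,
      ∏ lam ∈ Lam, (1 - 1 / 2 * ind (∀ c ∈ O, ¬ HasLit (F c) lam)) =
        ∑ B ∈ Lam.powerset, (-(1 / 2)) ^ #B *
          ∏ c ∈ O, ind (∀ lam ∈ B, ¬ HasLit (F c) lam) := by
    intro F
    have h2 : ∀ lam, 1 - 1 / 2 * ind (∀ c ∈ O, ¬ HasLit (F c) lam) =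
        1 + -(1 / 2) * ind (∀ c ∈ O, ¬ HasLit (F c) lam) := fun lam => by ring
    simp_rw [h2]
    rw [prod_one_add]
    refine sum_congr rfl fun B _ => ?_
    rw [prod_mul_distrib, prod_const, prod_ind, prod_ind]
    congr 2
    exact propext ⟨fun h c hc lam hl => h lam hl c hc, fun h lam hl c hc => h c hc lam hl⟩
  have h2 : ∀ B : Finset (Fin N × Bool), 𝔼 F : Formula k N M, (-(1 / 2) : ℝ) ^ #B *
      ∏ c ∈ O, ind (∀ lam ∈ B, ¬ HasLit (F c) lam) =
        (-(1 / 2)) ^ #B * (𝔼 ω : Clause k N, ind (∀ lam ∈ B, ¬ HasLit ω lam)) ^ #O := by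
    intro B
    rw [← mul_expect, expect_prod_eq_pow O hne fun ω => ind (∀ lam ∈ B, ¬ HasLit ω lam)]
  simp_rw [h1]
  rw [expect_sum_comm, sum_congr rfl fun B _ => h2 B]
  -- expanding the product over the subsets `B` of `Λ`, each error is weighted by `2 ^ (-#B)`
  calc ∑ B ∈ Lam.powerset, (-(1 / 2)) ^ #B *
        (𝔼 ω : Clause k N, ind (∀ lam ∈ B, ¬ HasLit ω lam)) ^ #O
      ≤ ∑ B ∈ Lam.powerset, ((-(q / 2)) ^ #B + (1 / 2) ^ #B * err) := by
        refine sum_le_sum fun B hB => ?_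
        have h3 := herr B (mem_powerset.1 hB)
        set p := (𝔼 ω : Clause k N, ind (∀ lam ∈ B, ¬ HasLit ω lam)) ^ #O
        have h4 : (-(q / 2)) ^ #B = (-(1 / 2)) ^ #B * q ^ #B := by rw [← mul_pow]; ring_nf
        have h5 : (-(1 / 2) : ℝ) ^ #B * (p - q ^ #B) ≤ (1 / 2) ^ #B * err := by
          refine (le_abs_self _).trans ?_
          rw [abs_mul, abs_pow, abs_neg, abs_of_pos (by norm_num : (0 : ℝ) < 1 / 2)]
          exact mul_le_mul_of_nonneg_left h3 (by positivity)
        rw [h4]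
        linarith
    _ = (1 - q / 2) ^ #Lam + (3 / 2) ^ #Lam * err := by
        rw [sum_add_distrib, ← sum_mul, hpow, hpow]
        norm_num [sub_eq_add_neg]

lemma exp_neg_le_quadratic {x : ℝ} (hx : 0 ≤ x) : Real.exp (-x) ≤ 1 - x + x ^ 2 / 2 := by
  have h := Real.quadratic_le_exp_of_nonneg hx
  rw [Real.exp_neg, inv_le_comm₀ (Real.exp_pos x) (by nlinarith [sq_nonneg (x - 1)])]
  refine le_trans ?_ h
  rw [inv_le_iff_one_le_mul₀ (by nlinarith [sq_nonneg (x - 1)])]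
  nlinarith [sq_nonneg (x ^ 2)]

lemma abs_pow_sub_pow_le_mul {a b : ℝ} (ha : 0 ≤ a) (ha1 : a ≤ 1) (hb : 0 ≤ b) (hb1 : b ≤ 1)
    (n : ℕ) : |a ^ n - b ^ n| ≤ n * |a - b| := by
  refine (abs_pow_sub_pow_le a b n).trans ?_
  have : max |a| |b| ^ (n - 1) ≤ 1 :=
    pow_le_one₀ (le_max_of_le_left (abs_nonneg a))
      (max_le (by rwa [abs_of_nonneg ha]) (by rwa [abs_of_nonneg hb]))
  calc |a - b| * n * max |a| |b| ^ (n - 1) ≤ |a - b| * n * 1 :=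
        mul_le_mul_of_nonneg_left this (by positivity)
    _ = _ := by ring

/-- Up to an error of order `1 / N`, the numbers of occurrences of few literals are independent
Poisson variables. -/
lemma abs_avoid_pow_sub_le (hN : k ≤ N) (hN2 : 2 ≤ N) (hM : M ≤ N) {r b : ℕ} (hr : r ≤ M)
    {B : Finset (Fin N × Bool)} (hB : #B ≤ b) :
    |(𝔼 ω : Clause k N, ind (∀ lam ∈ B, ¬ HasLit ω lam)) ^ (M - r) -
        Real.exp (-(k * M / (2 * N))) ^ #B| ≤ ((b * k) ^ 2 + r * b * k) / N := by
  have hne := nonempty_clause hN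
  have hN2' : (2 : ℝ) ≤ N := by exact_mod_cast hN2
  have hN0 : (0 : ℝ) < N := by linarith
  have hM' : (M : ℝ) ≤ N := by exact_mod_cast hM
  obtain ⟨h1, h2⟩ := expect_avoid hN hN2 B
  set p := 𝔼 ω : Clause k N, ind (∀ lam ∈ B, ¬ HasLit ω lam) with hp
  have hp0 : 0 ≤ p := expect_nonneg' fun ω => ind_nonneg _
  have hp1 : p ≤ 1 := by
    calc p ≤ 𝔼 _ω : Clause k N, (1 : ℝ) := expect_mono fun ω => ind_le_one _
      _ = 1 := Fintype.expect_one
  set x : ℝ := #B * k / (2 * N) with hx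
  have hx0 : 0 ≤ x := by positivity
  set y := Real.exp (-x) with hy
  have hy0 : 0 ≤ y := (Real.exp_pos _).le
  have hy1 : y ≤ 1 := Real.exp_le_one_iff.2 (by linarith)
  have hyM : Real.exp (-(k * M / (2 * N))) ^ #B = y ^ M := by
    rw [hy, ← Real.exp_nat_mul, ← Real.exp_nat_mul]
    congr 1
    rw [hx]
    ring
  have hy2 := exp_neg_le_quadratic hx0
  have hy3 : 1 - x ≤ y := by have := Real.add_one_le_exp (-x); linarith
  have hBk : ((#B : ℝ) * k) ^ 2 ≤ (b * k) ^ 2 := by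
    have : (#B : ℝ) ≤ b := by exact_mod_cast hB
    gcongr
  have hD1 : ((#B : ℝ) * k) ^ 2 / (8 * (N * (N - 1))) ≤ (b * k) ^ 2 / (4 * N ^ 2) := by
    calc ((#B : ℝ) * k) ^ 2 / (8 * (N * (N - 1))) ≤ (#B * k) ^ 2 / (4 * N ^ 2) :=
          div_le_div_of_nonneg_left (by positivity) (by positivity) (by nlinarith)
      _ ≤ _ := by gcongr
  have hD2 : x ^ 2 / 2 ≤ (b * k) ^ 2 / (4 * N ^ 2) := by
    have : x ^ 2 / 2 = (#B * k) ^ 2 / (4 * N ^ 2) / 2 := by rw [hx]; ring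
    rw [this]
    have h5 : ((#B : ℝ) * k) ^ 2 / (4 * N ^ 2) ≤ (b * k) ^ 2 / (4 * N ^ 2) := by gcongr
    have h6 : (0 : ℝ) ≤ (#B * k) ^ 2 / (4 * N ^ 2) := by positivity
    linarith
  have hpy : |p - y| ≤ (b * k) ^ 2 / (4 * N ^ 2) := by
    rw [abs_le]
    constructor <;> linarith
  have hA : |p ^ M - y ^ M| ≤ (b * k) ^ 2 / N := by
    refine (abs_pow_sub_pow_le_mul hp0 hp1 hy0 hy1 M).trans ?_
    calc (M : ℝ) * |p - y| ≤ N * ((b * k) ^ 2 / (4 * N ^ 2)) :=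
          mul_le_mul hM' hpy (abs_nonneg _) hN0.le
      _ = (b * k) ^ 2 / N / 4 := by field_simp
      _ ≤ (b * k) ^ 2 / N := by
          have : (0 : ℝ) ≤ (b * k) ^ 2 / N := by positivity
          linarith
  have hC : |p ^ (M - r) - p ^ M| ≤ r * b * k / N := by
    have h3 : p ^ M = p ^ (M - r) * p ^ r := by rw [← pow_add]; congr 1; omega
    have h4 := one_add_mul_le_pow (show -2 ≤ p - 1 by linarith) r
    rw [add_sub_cancel] at h4
    have h5 : p ^ (M - r) ≤ 1 := pow_le_one₀ hp0 hp1
    have h6 : p ^ r ≤ 1 := pow_le_one₀ hp0 hp1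
    have h7 : 0 ≤ p ^ (M - r) := pow_nonneg hp0 _
    rw [h3, abs_of_nonneg (by nlinarith)]
    calc p ^ (M - r) - p ^ (M - r) * p ^ r = p ^ (M - r) * (1 - p ^ r) := by ring
      _ ≤ 1 * (1 - p ^ r) := mul_le_mul_of_nonneg_right h5 (by linarith)
      _ ≤ r * (1 - p) := by linarith
      _ ≤ r * x := mul_le_mul_of_nonneg_left (by linarith) (by positivity)
      _ ≤ r * (b * k / N) := by
          refine mul_le_mul_of_nonneg_left ?_ (by positivity)
          have : (#B : ℝ) ≤ b := by exact_mod_cast hB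
          rw [hx, div_le_div_iff₀ (by positivity) hN0]
          have h8 : (#B : ℝ) * k ≤ b * k := by gcongr
          have h9 : (0 : ℝ) ≤ b * k := by positivity
          nlinarith
      _ = _ := by ring
  rw [hyM, add_div]
  calc |p ^ (M - r) - y ^ M| = |(p ^ M - y ^ M) + (p ^ (M - r) - p ^ M)| := by congr 1; ring
    _ ≤ _ := (abs_add_le _ _).trans (add_le_add hA hC)

/-! ### Chains of clauses -/

/-- The weight of the link between the exit of the passage `t` and the edge `e`: zero unless they
belong to the same variable, and then a function of whether the two literals agree. -/
noncomputable def linkWeight (g : Bool → ℝ) (F : Formula k N M) (t : Passage k M)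
    (e : Fin M × Fin k) : ℝ :=
  ind (F.var e.1 e.2 = F.var t.1 t.2.2) * g (F.sign e.1 e.2 == F.sign t.1 t.2.2)

/-- The product of the weights of the links of a walk. -/
noncomputable def chainWeight (g : Bool → ℝ) (F : Formula k N M) :
    List (Passage k M) → Fin M × Fin k → ℝ
  | [], _ => 1
  | t :: l, e => linkWeight g F t e * chainWeight g F l (t.1, t.2.1)

lemma linkWeight_nonneg {g : Bool → ℝ} (hg : ∀ b, 0 ≤ g b) (F : Formula k N M) (t : Passage k M)
    (e : Fin M × Fin k) : 0 ≤ linkWeight g F t e := mul_nonneg (ind_nonneg _) (hg _)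

lemma chainWeight_nonneg {g : Bool → ℝ} (hg : ∀ b, 0 ≤ g b) (F : Formula k N M)
    (l : List (Passage k M)) (e : Fin M × Fin k) : 0 ≤ chainWeight g F l e := by
  induction l generalizing e with
  | nil => exact zero_le_one
  | cons t l ih => exact mul_nonneg (linkWeight_nonneg hg _ _ _) (ih _)

lemma visited_cons (t : Passage k M) (l : List (Passage k M)) (e : Fin M × Fin k) :
    visited (t :: l) e = e.1 :: visited l (t.1, t.2.1) := rfl

lemma chainWeight_congr (g : Bool → ℝ) {F G : Formula k N M} {l : List (Passage k M)}
    {e : Fin M × Fin k} (h : ∀ c ∈ visited l e, F c = G c) :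
    chainWeight g F l e = chainWeight g G l e := by
  induction l generalizing e with
  | nil => rfl
  | cons t l ih =>
    have h1 : F e.1 = G e.1 := h e.1 List.mem_cons_self
    have h2 : F t.1 = G t.1 := h t.1 (by simp [visited])
    rw [chainWeight, chainWeight,
      ih fun c hc => h c (by rw [visited_cons]; exact List.mem_cons_of_mem _ hc)]
    simp only [linkWeight, Formula.var, Formula.sign, h1, h2]

lemma chainWeight_update (g : Bool → ℝ) (F : Formula k N M) {c : Fin M} (ω : Clause k N)
    {l : List (Passage k M)} {e : Fin M × Fin k} (hc : c ∉ visited l e) :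
    chainWeight g (Function.update F c ω) l e = chainWeight g F l e :=
  chainWeight_congr g fun b hb =>
    Function.update_of_ne (by rintro rfl; exact hc hb) _ _

lemma linkWeight_update (g : Bool → ℝ) (F : Formula k N M) (ω : Clause k N) {t : Passage k M}
    {e : Fin M × Fin k} (h : t.1 ≠ e.1) :
    linkWeight g (Function.update F e.1 ω) t e =
      ind (ω.1 e.2 = F.var t.1 t.2.2) * g (ω.2 e.2 == F.sign t.1 t.2.2) := by
  simp only [linkWeight, Formula.var, Formula.sign, Function.update_self,
    Function.update_of_ne h]

lemma sum_bool_beq (g : Bool → ℝ) (s : Bool) :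
    g (true == s) + g (false == s) = g true + g false := by
  cases s
  · exact add_comm _ _
  · rfl

/-- The links of a walk through distinct clauses are independent: by resampling the last clause,
each link exists with probability `1 / N` and has, given that, the mean weight `(g true + g false) /
2`. -/
lemma expect_chainWeight (hN : k ≤ N) (g : Bool → ℝ) {l : List (Passage k M)}
    {e : Fin M × Fin k} (hl : (visited l e).Nodup) :
    𝔼 F, chainWeight (N := N) g F l e = ((g true + g false) / (2 * N)) ^ l.length := by
  have hne := nonempty_clause hN
  induction l generalizing e with
  | nil => simp [chainWeight]
  | cons t l ih =>
    rw [visited_cons, List.nodup_cons] at hl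
    have hte : t.1 ≠ e.1 := by
      intro h
      exact hl.1 (by simp [visited, h])
    have h2 : ∀ F : Formula k N M, 𝔼 ω : Clause k N,
        chainWeight g (Function.update F e.1 ω) (t :: l) e =
          (g true + g false) / (2 * N) * chainWeight g F l (t.1, t.2.1) := by
      intro F
      simp_rw [chainWeight, linkWeight_update _ _ _ hte, chainWeight_update _ _ _ hl.1]
      rw [← expect_mul, expect_link hN e.2 _ fun b => g (b == F.sign t.1 t.2.2), sum_bool_beq]
    rw [expect_update e.1]
    simp_rw [h2]
    rw [← mul_expect, ih hl.2, List.length_cons, pow_succ']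

/-- The exit of the passage `s` leads to a variable of a clause in the list `l`. -/
def Closes (F : Formula k N M) (l : List (Passage k M)) (s : Passage k M) : Prop :=
  ∃ t ∈ l, ∃ p, F.var s.1 s.2.2 = F.var t.1 p

/-- That the last passage of a walk leads back to the walk costs a factor of order `1 / N`, beyond
the probabilities of the links. -/
lemma expect_chainWeight_mul_closes_le (hN : k ≤ N) {g : Bool → ℝ} (hg : ∀ b, 0 ≤ g b)
    {t : Passage k M} {l : List (Passage k M)} {s : Passage k M}
    (hl : (visited (t :: l) (s.1, s.2.1)).Nodup) (ho : s.2.1 ≠ s.2.2) :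
    𝔼 F, chainWeight (N := N) g F (t :: l) (s.1, s.2.1) * ind (Closes F (t :: l) s) ≤
      (g true + g false) / 2 * (((l.length + 1 : ℕ) * k : ℝ) / (N * (N - 1))) *
        ((g true + g false) / (2 * N)) ^ l.length := by
  classical
  rw [visited_cons, List.nodup_cons] at hl
  have hsm : s.1 ∉ (t :: l).map Prod.fst := hl.1
  have hte : t.1 ≠ s.1 := by
    intro h
    exact hsm (by simp [h])
  have hN1 : (0 : ℝ) ≤ N * (N - 1) := by
    rcases Nat.eq_zero_or_pos N with h | h
    · simp [h]
    · have : (1 : ℝ) ≤ N := by exact_mod_cast h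
      nlinarith
  rw [expect_update s.1, ← expect_chainWeight hN g hl.2, mul_expect]
  refine expect_mono fun (F : Formula k N M) => ?_
  set W : Finset (Fin N) := (t :: l).toFinset.biUnion fun t' => univ.image (F.var t'.1) with hW
  have hWcard : #W ≤ (l.length + 1) * k := by
    refine card_biUnion_le.trans ?_
    calc ∑ t' ∈ (t :: l).toFinset, #(univ.image (F.var t'.1))
        ≤ ∑ _t' ∈ (t :: l).toFinset, k := sum_le_sum fun t' _ =>
          card_image_le.trans (by rw [card_univ, Fintype.card_fin])
      _ ≤ _ := by
          rw [sum_const, smul_eq_mul]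
          exact Nat.mul_le_mul_right k (List.toFinset_card_le _)
  have hcl : ∀ ω, ind (Closes (Function.update F s.1 ω) (t :: l) s) = ind (ω.1 s.2.2 ∈ W) := by
    intro ω
    congr 1
    rw [hW, mem_biUnion]
    refine propext (exists_congr fun t' => ?_)
    rw [List.mem_toFinset]
    refine and_congr_right fun ht' => ?_
    have hne : t'.1 ≠ s.1 := by
      intro h
      exact hsm (List.mem_map.2 ⟨t', ht', h⟩)
    simp only [Formula.var, Function.update_self, Function.update_of_ne hne, mem_image, mem_univ,
      true_and, eq_comm]
  simp_rw [chainWeight, linkWeight_update (e := (s.1, s.2.1)) _ _ _ hte,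
    chainWeight_update _ _ _ hl.1, hcl]
  have h2 := expect_link_mem_le hN ho (F.var t.1 t.2.2) W
    (φ := fun b => g (b == F.sign t.1 t.2.2)) fun b => hg _
  rw [sum_bool_beq] at h2
  calc 𝔼 ω : Clause k N, ind (ω.1 s.2.1 = F.var t.1 t.2.2) *
          g (ω.2 s.2.1 == F.sign t.1 t.2.2) * chainWeight g F l (t.1, t.2.1) * ind (ω.1 s.2.2 ∈ W)
      = (𝔼 ω : Clause k N, ind (ω.1 s.2.1 = F.var t.1 t.2.2) *
          g (ω.2 s.2.1 == F.sign t.1 t.2.2) * ind (ω.1 s.2.2 ∈ W)) *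
            chainWeight g F l (t.1, t.2.1) := by
        rw [expect_mul]
        exact expect_congr rfl fun ω _ => by ring
    _ ≤ _ := by
        refine mul_le_mul_of_nonneg_right (h2.trans ?_) (chainWeight_nonneg hg _ _ _)
        refine mul_le_mul_of_nonneg_left ?_ (by linarith [hg true, hg false])
        refine div_le_div_of_nonneg_right ?_ hN1
        exact_mod_cast hWcard

/-! ### The expected number of lassos -/

/-- The total weight of the lassos with `n + 1` passages from the set `Q`: the chains through
distinct clauses that end with a passage to a variable of an earlier clause. -/
noncomputable def lassoCount (g : Bool → ℝ) (Q : Finset (Passage k M)) (n : ℕ)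
    (F : Formula k N M) : ℝ :=
  ∑ f ∈ Fintype.piFinset fun _ : Fin n => Q, ∑ s ∈ Q,
    ind ((visited (List.ofFn f) (s.1, s.2.1)).Nodup ∧ s.2.1 ≠ s.2.2) *
      (chainWeight g F (List.ofFn f) (s.1, s.2.1) * ind (Closes F (List.ofFn f) s))

/-- There are `#Q ^ (n + 1)` sequences of passages, and `n + 1` coincidences of variables in a
lasso, each with a probability of order `1 / N`. -/
lemma expect_lassoCount_le (hN : k ≤ N) (hN2 : 2 ≤ N) {g : Bool → ℝ} (hg : ∀ b, 0 ≤ g b)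
    {ρ : ℝ} (hρ : 0 < ρ) (hgρ : (g true + g false) / 2 = ρ) (Q : Finset (Passage k M)) (n : ℕ) :
    𝔼 F, lassoCount (N := N) g Q n F ≤ 2 * k * n / ρ * (#Q * ρ / N) ^ (n + 1) := by
  have hN2' : (2 : ℝ) ≤ N := by exact_mod_cast hN2
  have hN0 : (0 : ℝ) < N := by linarith
  have hterm : ∀ f : Fin n → Passage k M, ∀ s : Passage k M,
      𝔼 F, ind ((visited (List.ofFn f) (s.1, s.2.1)).Nodup ∧ s.2.1 ≠ s.2.2) *
        (chainWeight (N := N) g F (List.ofFn f) (s.1, s.2.1) * ind (Closes F (List.ofFn f) s)) ≤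
        2 * k * n / ρ * (ρ / N) ^ (n + 1) := by
    intro f s
    rw [← mul_expect]
    by_cases h : (visited (List.ofFn f) (s.1, s.2.1)).Nodup ∧ s.2.1 ≠ s.2.2
    swap
    · rw [ind_neg h, zero_mul]; positivity
    rw [ind_pos h, one_mul]
    cases n with
    | zero =>
      rw [expect_eq_zero fun F _ => ?_]
      · positivity
      · rw [ind_neg, mul_zero]
        rintro ⟨t, ht, -⟩
        simp at ht
    | succ n =>
      have hl := List.ofFn_succ (f := f)
      rw [hl] at h ⊢
      refine (expect_chainWeight_mul_closes_le hN hg h.1 h.2).trans ?_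
      rw [List.length_ofFn, hgρ]
      have h2 : (g true + g false) / (2 * N) = ρ / N := by rw [← hgρ]; field_simp
      rw [h2]
      have h3 : ((n + 1 : ℕ) * k : ℝ) / (N * (N - 1)) ≤ 2 * (n + 1 : ℕ) * k / (N * N) := by
        rw [div_le_div_iff₀ (by nlinarith) (by positivity)]
        have h4 : (0 : ℝ) ≤ (n + 1 : ℕ) * k := by positivity
        nlinarith [mul_nonneg h4 hN0.le]
      calc ρ * (((n + 1 : ℕ) * k : ℝ) / (N * (N - 1))) * (ρ / N) ^ n
          ≤ ρ * (2 * (n + 1 : ℕ) * k / (N * N)) * (ρ / N) ^ n := by gcongr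
        _ = _ := by
            rw [pow_succ, pow_succ]
            field_simp
  simp_rw [lassoCount]
  rw [expect_sum_comm]
  calc _ ≤ ∑ _f ∈ Fintype.piFinset fun _ : Fin n => Q, ∑ _s ∈ Q,
        (2 * k * n / ρ * (ρ / N) ^ (n + 1) : ℝ) := by
        refine sum_le_sum fun f _ => ?_
        rw [expect_sum_comm]
        exact sum_le_sum fun s _ => hterm f s
    _ = _ := by
        rw [sum_const, sum_const, nsmul_eq_mul, nsmul_eq_mul, Fintype.card_piFinset, prod_const,
          card_univ, Fintype.card_fin, mul_div_assoc (#Q : ℝ), mul_pow]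
        push_cast
        ring

end KSat

/-! ### The expected influence in a random formula -/

namespace KSat

variable {k N M : ℕ}

/-- The product of the weights of the clauses that a walk passes. -/
noncomputable def walkWeight (F : Formula k N M) : List (Passage k M) → ℝ
  | [] => 1
  | t :: l => clauseWeight F (t.1, t.2.1) * walkWeight F l

lemma walkWeight_nonneg (F : Formula k N M) (l : List (Passage k M)) : 0 ≤ walkWeight F l := by
  induction l with
  | nil => exact zero_le_one
  | cons t l ih => exact mul_nonneg (clauseWeight_nonneg F _) ih

/-- The positions, in the clause of the passage `t`, of the literals whose negations are not known
to occur: all but the entry, and the exit only if the walk continues to the same literal. -/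
def freePositions (F : Formula k N M) (t : Passage k M) (e : Fin M × Fin k) : Finset (Fin k) :=
  {p | p ≠ t.2.1 ∧ (p ≠ t.2.2 ∨ F.sign e.1 e.2 = F.sign t.1 t.2.2)}

lemma mem_freePositions {F : Formula k N M} {t : Passage k M} {e : Fin M × Fin k} {p : Fin k} :
    p ∈ freePositions F t e ↔
      p ≠ t.2.1 ∧ (p ≠ t.2.2 ∨ F.sign e.1 e.2 = F.sign t.1 t.2.2) := by simp [freePositions]

lemma card_freePositions {F : Formula k N M} {t : Passage k M} (ht : t.2.1 ≠ t.2.2)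
    (e : Fin M × Fin k) :
    #(freePositions F t e) = if F.sign e.1 e.2 = F.sign t.1 t.2.2 then k - 1 else k - 2 := by
  split_ifs with h
  · have : freePositions F t e = univ.erase t.2.1 := by
      ext p; rw [mem_freePositions, mem_erase]; simp [h]
    rw [this, card_erase_of_mem (mem_univ _), card_univ, Fintype.card_fin]
  · have : freePositions F t e = (univ.erase t.2.1).erase t.2.2 := by
      ext p; rw [mem_freePositions, mem_erase, mem_erase]; simp [h]; tauto
    rw [this, card_erase_of_mem (mem_erase.2 ⟨ht.symm, mem_univ _⟩),
      card_erase_of_mem (mem_univ _), card_univ, Fintype.card_fin]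
    rfl

/-- The negations of the literals at the free positions along a walk. -/
def oppositeLits (F : Formula k N M) : List (Passage k M) → Fin M × Fin k → Finset (Fin N × Bool)
  | [], _ => ∅
  | t :: l, e => (freePositions F t e).image (fun p => (F.var t.1 p, !F.sign t.1 p)) ∪
      oppositeLits F l (t.1, t.2.1)

/-- The number of free positions along a walk. -/
def freeCount (F : Formula k N M) : List (Passage k M) → Fin M × Fin k → ℕ
  | [], _ => 0
  | t :: l, e => #(freePositions F t e) + freeCount F l (t.1, t.2.1)

lemma freeCount_le (F : Formula k N M) (l : List (Passage k M)) (e : Fin M × Fin k) :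
    freeCount F l e ≤ l.length * k := by
  induction l generalizing e with
  | nil => simp [freeCount]
  | cons t l ih =>
    have h1 : #(freePositions F t e) ≤ k := (card_le_univ _).trans_eq (Fintype.card_fin k)
    have h2 := ih (t.1, t.2.1)
    rw [freeCount, List.length_cons, Nat.succ_mul]
    omega

lemma exists_of_mem_oppositeLits {F : Formula k N M} {l : List (Passage k M)}
    {e : Fin M × Fin k} {lam : Fin N × Bool} (h : lam ∈ oppositeLits F l e) :
    ∃ t ∈ l, ∃ p, F.var t.1 p = lam.1 := by
  induction l generalizing e with
  | nil => simp [oppositeLits] at h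
  | cons t l ih =>
    rcases mem_union.1 h with h | h
    · obtain ⟨p, -, rfl⟩ := mem_image.1 h
      exact ⟨t, List.mem_cons_self, p, rfl⟩
    · obtain ⟨t', ht', hp⟩ := ih h
      exact ⟨t', List.mem_cons_of_mem _ ht', hp⟩

lemma walk_congr {F G : Formula k N M} {l : List (Passage k M)} {e : Fin M × Fin k}
    (h : ∀ c ∈ visited l e, F c = G c) :
    (IsWalk F l e ↔ IsWalk G l e) ∧ oppositeLits F l e = oppositeLits G l e ∧
      freeCount F l e = freeCount G l e := by
  induction l generalizing e with
  | nil => simp [IsWalk, oppositeLits, freeCount]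
  | cons t l ih =>
    have h1 : F e.1 = G e.1 := h e.1 List.mem_cons_self
    have h2 : F t.1 = G t.1 := h t.1 (by simp [visited])
    obtain ⟨i1, i2, i3⟩ := ih (e := (t.1, t.2.1)) fun c hc =>
      h c (by rw [visited_cons]; exact List.mem_cons_of_mem _ hc)
    have h3 : freePositions F t e = freePositions G t e := by
      ext p
      rw [mem_freePositions, mem_freePositions]
      simp only [Formula.sign, h1, h2]
    refine ⟨?_, ?_, ?_⟩
    · simp only [IsWalk, i1, mem_neighbors, Formula.var, h1, h2]
    · simp only [oppositeLits, i2, h3, Formula.var, Formula.sign, h2]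
    · simp only [freeCount, i3, h3]

/-- In a tree-like neighbourhood, the literals at the free positions along a walk belong to distinct
variables, and are damped by the clauses outside of the walk only. The set `O` stands for these
clauses; those of the clauses that are neither in `O` nor on the walk do not matter if they do not
meet the walk. -/
lemma NoLasso.walkWeight_le {F : Formula k N M} {a : Fin M} {L : ℕ} (hN : NoLasso F a L)
    {l : List (Passage k M)} {e : Fin M × Fin k} {O : Finset (Fin M)} (hl : l.length ≤ L)
    (hw : IsWalk F l e) (ho : origin l e = a)
    (hO : ∀ c ∉ O, c ∉ visited l e → ∀ p', ∀ t ∈ l, ∀ p ≠ t.2.1, F.var c p' ≠ F.var t.1 p) :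
    #(oppositeLits F l e) = freeCount F l e ∧
      walkWeight F l ≤
        ∏ lam ∈ oppositeLits F l e, (1 - 1 / 2 * ind (∀ c ∈ O, ¬ HasLit (F c) lam)) := by
  induction l generalizing e with
  | nil => simp [oppositeLits, freeCount, walkWeight]
  | cons t l ih =>
    have hnd := hN.nodup (hl.trans (Nat.le_succ L)) hw ho
    have hl' : l.length ≤ L := by simp only [List.length_cons] at hl; omega
    obtain ⟨hio, hlink, hw'⟩ := hw
    have hlink' := mem_neighbors.1 hlink
    have hnd' : (visited l (t.1, t.2.1)).Nodup := (List.nodup_cons.1 hnd).2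
    -- a variable that is left from `t` does not occur earlier
    have hback : ∀ o ≠ t.2.1, ∀ t' ∈ l, ∀ p, F.var t.1 o ≠ F.var t'.1 p := fun o ho' =>
      hN l (t.1, t.2.1) o hl' hw' ho hnd' ho'
    have hfwd : ∀ o ≠ e.2, ∀ t' ∈ t :: l, ∀ p, F.var e.1 o ≠ F.var t'.1 p := fun o ho' =>
      hN (t :: l) e o hl ⟨hio, hlink, hw'⟩ ho hnd ho'
    obtain ⟨ih1, ih2⟩ := ih (e := (t.1, t.2.1)) hl' hw' ho (by
      intro c hcO hcv p' t' ht' p hp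
      by_cases hce : c = e.1
      · subst hce
        by_cases hp' : p' = e.2
        · rw [hp', hlink'.2]
          exact hback _ hio.symm t' ht' p
        · exact hfwd p' hp' t' (List.mem_cons_of_mem _ ht') p
      · refine hO c hcO ?_ p' t' (List.mem_cons_of_mem _ ht') p hp
        rw [visited_cons, List.mem_cons, not_or]
        exact ⟨hce, hcv⟩)
    set φ : Fin k → Fin N × Bool := fun p => (F.var t.1 p, !F.sign t.1 p) with hφ
    have hφinj : Function.Injective φ := fun p p' h =>
      var_injective F t.1 (congrArg Prod.fst h)
    have hdisj : Disjoint ((freePositions F t e).image φ) (oppositeLits F l (t.1, t.2.1)) := by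
      rw [disjoint_left]
      intro lam h1 h2
      obtain ⟨p, hp, rfl⟩ := mem_image.1 h1
      obtain ⟨t', ht', p', hp'⟩ := exists_of_mem_oppositeLits h2
      exact hback p (mem_freePositions.1 hp).1 t' ht' p' hp'.symm
    have hnn : ∀ lam, 0 ≤ 1 - 1 / 2 * ind (∀ c ∈ O, ¬ HasLit (F c) lam) := fun lam => by
      have := ind_le_one (∀ c ∈ O, ¬ HasLit (F c) lam); linarith
    refine ⟨?_, ?_⟩
    · rw [oppositeLits, freeCount, card_union_of_disjoint hdisj, ih1,
        card_image_of_injective _ hφinj]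
    · rw [oppositeLits, prod_union hdisj, walkWeight]
      refine mul_le_mul ?_ ih2 (walkWeight_nonneg F l) (prod_nonneg fun lam _ => hnn lam)
      rw [prod_image hφinj.injOn, clauseWeight]
      have hsub : freePositions F t e ⊆ univ.erase t.2.1 := fun p hp =>
        mem_erase.2 ⟨(mem_freePositions.1 hp).1, mem_univ _⟩
      rw [← prod_sdiff hsub]
      refine (mul_le_of_le_one_left (prod_nonneg fun _ _ => damping_nonneg F _ _)
        (prod_le_one (fun _ _ => damping_nonneg F _ _) fun _ _ => damping_le_one F _ _)).trans ?_
      refine prod_le_prod (fun _ _ => damping_nonneg F _ _) fun p hp => ?_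
      by_cases hz : ∀ c ∈ O, ¬ HasLit (F c) (φ p)
      swap
      · rw [ind_neg hz, mul_zero, sub_zero]; exact damping_le_one F _ _
      rw [ind_pos hz]
      obtain ⟨hp1, hp2⟩ := mem_freePositions.1 hp
      -- an opposing occurrence outside of `O` would be in a later clause of the walk, where only
      -- the next link can meet this variable, or in an earlier one, or close a cycle
      have hempty : disagreeing F t.1 p = ∅ := by
        rw [eq_empty_iff_forall_notMem]
        rintro ⟨c, p'⟩ hc
        obtain ⟨hct, hv, hs⟩ := mem_disagreeing.1 hc
        dsimp only at hct hv hs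
        have hcO : c ∉ O := fun hmem => hz c hmem
          ⟨p', hv, by
            revert hs
            simp only [hφ, Formula.sign]
            cases (F c).2 p' <;> cases (F t.1).2 p <;> simp⟩
        by_cases hcv : c ∈ visited (t :: l) e
        · rw [visited_cons, List.mem_cons] at hcv
          rcases hcv with rfl | hcv
          · by_cases hp' : p' = e.2
            · subst hp'
              have hpo : p = t.2.2 := var_injective F t.1 (hv.symm.trans hlink'.2)
              subst hpo
              rcases hp2 with h | h
              · exact h rfl
              · exact hs h
            · exact hfwd p' hp' t List.mem_cons_self p hv
          · rcases List.mem_cons.1 hcv with h | h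
            · exact hct h
            · obtain ⟨t', ht', rfl⟩ := List.mem_map.1 h
              exact hback p hp1 t' ht' p' hv.symm
        · exact hO c hcO hcv p' t List.mem_cons_self p hp1 hv
      rw [damping, if_pos hempty]
      norm_num

/-- The number of free positions depends on the signs at the links only, so that its exponential is
a product over the links. -/
lemma pow_freeCount_eq {F : Formula k N M} {l : List (Passage k M)} {e : Fin M × Fin k} (y : ℝ)
    (hw : IsWalk F l e) :
    y ^ freeCount F l e =
      chainWeight (fun b => if b then y ^ (k - 1) else y ^ (k - 2)) F l e := by
  induction l generalizing e with
  | nil => simp [freeCount, chainWeight]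
  | cons t l ih =>
    rw [freeCount, pow_add, ih hw.2.2, chainWeight, linkWeight,
      ind_pos (mem_neighbors.1 hw.2.1).2, one_mul, card_freePositions hw.1]
    congr 1
    by_cases h : F.sign e.1 e.2 = F.sign t.1 t.2.2 <;> simp [h]

lemma chainWeight_one {F : Formula k N M} {l : List (Passage k M)} {e : Fin M × Fin k}
    (hw : IsWalk F l e) : chainWeight (fun _ => 1) F l e = 1 := by
  induction l generalizing e with
  | nil => rfl
  | cons t l ih =>
    rw [chainWeight, ih hw.2.2, linkWeight, ind_pos (mem_neighbors.1 hw.2.1).2]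
    norm_num

/-- The probability `e ^ (-kM/(2N))`, in the limit of large formulas, that a literal does not
occur. -/
noncomputable def absence (k N M : ℕ) : ℝ := Real.exp (-(k * M / (2 * N)))

lemma absence_pos : 0 < absence k N M := Real.exp_pos _

lemma absence_le_one : absence k N M ≤ 1 := by
  refine Real.exp_le_one_iff.2 ?_
  have : (0 : ℝ) ≤ k * M / (2 * N) := by positivity
  linarith

/-- The expected weight per passage. With `q` the probability that a literal does not occur, the `k
- 2` literals at which the walk neither enters nor leaves the clause contribute `1 - q / 2` each.
The literal at the exit contributes `1 - q / 2` as well if the walk continues to the same literal,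
and `1` if it continues to its negation: in the mean, `1 - q / 4`. -/
noncomputable def meanWeight (k N M : ℕ) : ℝ :=
  (1 - absence k N M / 2) ^ (k - 2) * (1 - absence k N M / 4)

lemma meanWeight_nonneg : 0 ≤ meanWeight k N M := by
  have h1 := @absence_le_one k N M
  exact mul_nonneg (pow_nonneg (by linarith) _) (by linarith)

/-- The error term in the expected weight of a walk with `n` passages. -/
noncomputable def walkError (k N n : ℕ) : ℝ :=
  (3 / 2) ^ (n * k) * ((((n * k : ℕ) : ℝ) * k) ^ 2 + ((n + 1 : ℕ) : ℝ) * (n * k : ℕ) * k) / N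

lemma walkError_nonneg (n : ℕ) : 0 ≤ walkError k N n := by unfold walkError; positivity

/-- The clauses outside of the walk are independent of it, and damp its free literals almost
independently. This leaves an expectation over the links of the walk, which is the product of
`1 / N` and the mean weight of a passage. -/
lemma expect_walkWeight_le (hk : 2 ≤ k) (hN : k ≤ N) (hM : M ≤ N) {L : ℕ}
    {l : List (Passage k M)} {e : Fin M × Fin k} (hl : l.length ≤ L) :
    𝔼 F : Formula k N M, ind (NoLasso F (origin l e) L ∧ IsWalk F l e) * walkWeight F l ≤
      (1 / N) ^ l.length * (meanWeight k N M ^ l.length + walkError k N l.length) := by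
  classical
  have hN2 : 2 ≤ N := hk.trans hN
  set n := l.length with hn
  set q := absence k N M with hq
  have hq1 : q ≤ 1 := absence_le_one
  have hq0 : 0 < q := absence_pos
  by_cases hnd : (visited l e).Nodup
  swap
  · rw [expect_eq_zero]
    · exact mul_nonneg (by positivity)
        (add_nonneg (pow_nonneg meanWeight_nonneg _) (walkError_nonneg _))
    · intro F _
      rw [ind_neg, zero_mul]
      rintro ⟨h1, h2⟩
      exact hnd (h1.nodup (hl.trans (Nat.le_succ L)) h2 rfl)
  set V : Finset (Fin M) := (visited l e).toFinset with hV
  have hVcard : #V = n + 1 := by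
    rw [hV, List.toFinset_card_of_nodup hnd, visited, List.length_cons, List.length_map]
  set O : Finset (Fin M) := univ \ V with hO
  have hnM : n + 1 ≤ M := by
    rw [← hVcard]; exact (card_le_univ _).trans_eq (Fintype.card_fin M)
  have hOcard : #O = M - (n + 1) := by
    rw [hO, card_sdiff_of_subset (subset_univ _), card_univ, Fintype.card_fin, hVcard]
  set T : Formula k N M → ℝ := fun F =>
    ind (IsWalk F l e ∧ #(oppositeLits F l e) = freeCount F l e) with hT
  set W : Formula k N M → Formula k N M → ℝ := fun F G =>
    ∏ lam ∈ oppositeLits F l e, (1 - 1 / 2 * ind (∀ c ∈ O, ¬ HasLit (G c) lam)) with hW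
  have hW0 : ∀ F G, 0 ≤ W F G := fun F G => prod_nonneg fun lam _ => by
    have := ind_le_one (∀ c ∈ O, ¬ HasLit (G c) lam); linarith
  -- `T` depends on the clauses of the walk only, and the products in `W` on the clauses in `O` only
  have h1 : ∀ F : Formula k N M,
      ind (NoLasso F (origin l e) L ∧ IsWalk F l e) * walkWeight F l ≤ T F * W F F := by
    intro F
    by_cases h : NoLasso F (origin l e) L ∧ IsWalk F l e
    · obtain ⟨h2, h3⟩ := h.1.walkWeight_le hl h.2 rfl (O := O) (by
        intro c hcO hcv
        exfalso
        rw [hO, Finset.mem_sdiff, not_and, not_not] at hcO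
        exact hcv (List.mem_toFinset.1 (hcO (mem_univ c))))
      rw [ind_pos h, hT]
      dsimp only
      rw [ind_pos ⟨h.2, h2⟩, one_mul, one_mul]
      exact h3
    · rw [ind_neg h, zero_mul]
      exact mul_nonneg (ind_nonneg _) (hW0 F F)
  have hmixV : ∀ F G : Formula k N M, ∀ c ∈ visited l e, mix O F G c = F c := by
    intro F G c hc
    have : c ∉ O := by
      rw [hO, Finset.mem_sdiff, not_and, not_not]
      exact fun _ => List.mem_toFinset.2 hc
    simp only [mix, this, if_false]
  have h2 : ∀ F G : Formula k N M, T (mix O F G) * W (mix O F G) (mix O F G) = T F * W F G := by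
    intro F G
    obtain ⟨w1, w2, w3⟩ := walk_congr (hmixV F G)
    simp only [hT, hW, w1, w2, w3]
    congr 1
    refine prod_congr rfl fun lam _ => ?_
    congr 3
    refine propext (forall_congr' fun c => forall_congr' fun hc => ?_)
    simp only [mix, hc, if_true]
  set err : ℝ := ((((n * k : ℕ) : ℝ) * k) ^ 2 + ((n + 1 : ℕ) : ℝ) * (n * k : ℕ) * k) / N with herr
  have herr0 : 0 ≤ err := by positivity
  have h3 : ∀ F : Formula k N M, T F * 𝔼 G, W F G ≤
      chainWeight (fun b => if b then (1 - q / 2) ^ (k - 1) else (1 - q / 2) ^ (k - 2)) F l e +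
        walkError k N n * chainWeight (fun _ => 1) F l e := by
    intro F
    by_cases h : IsWalk F l e ∧ #(oppositeLits F l e) = freeCount F l e
    · have hT1 : T F = 1 := ind_pos h
      have hcnt : freeCount F l e ≤ n * k := freeCount_le F l e
      rw [hT1, one_mul, ← pow_freeCount_eq _ h.1, chainWeight_one h.1, mul_one, ← h.2]
      refine (expect_prod_damped_le hN O (oppositeLits F l e) (q := q) (err := err)
        fun B hB => ?_).trans ?_
      · rw [hOcard]
        refine abs_avoid_pow_sub_le hN hN2 hM hnM ?_
        exact (card_le_card hB).trans (h.2.le.trans hcnt)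
      · have : (3 / 2 : ℝ) ^ #(oppositeLits F l e) * err ≤ walkError k N n := by
          rw [walkError, mul_div_assoc]
          refine mul_le_mul_of_nonneg_right ?_ herr0
          exact pow_le_pow_right₀ (by norm_num) (h.2.le.trans hcnt)
        linarith
    · have hT0 : T F = 0 := ind_neg h
      rw [hT0, zero_mul]
      refine add_nonneg (chainWeight_nonneg (fun b => ?_) _ _ _)
        (mul_nonneg (walkError_nonneg _) (chainWeight_nonneg (fun _ => zero_le_one) _ _ _))
      split_ifs <;> exact pow_nonneg (by linarith) _
  calc 𝔼 F : Formula k N M, ind (NoLasso F (origin l e) L ∧ IsWalk F l e) * walkWeight F l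
      ≤ 𝔼 F, T F * W F F := expect_mono h1
    _ = 𝔼 F, T F * 𝔼 G, W F G := by
        rw [expect_mix O]
        refine expect_congr rfl fun F _ => ?_
        rw [mul_expect]
        exact expect_congr rfl fun G _ => h2 F G
    _ ≤ _ := expect_mono h3
    _ = _ := by
        rw [expect_add_distrib, ← mul_expect, expect_chainWeight hN _ hnd,
          expect_chainWeight hN _ hnd, ← hn]
        have e1 : ((if true = true then (1 - q / 2) ^ (k - 1) else (1 - q / 2) ^ (k - 2)) +
            if false = true then (1 - q / 2) ^ (k - 1) else (1 - q / 2) ^ (k - 2)) / (2 * N) =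
              1 / N * meanWeight k N M := by
          obtain ⟨m, rfl⟩ : ∃ m, k = m + 2 := ⟨k - 2, by omega⟩
          simp only [if_true, Bool.false_eq_true, if_false, meanWeight, ← hq,
            show m + 2 - 1 = m + 1 by omega, Nat.add_sub_cancel, pow_succ]
          have : (N : ℝ) ≠ 0 := by
            have : (0 : ℝ) < N := by exact_mod_cast (by omega : 0 < N)
            exact this.ne'
          field_simp
          ring
        have e2 : ((1 : ℝ) + 1) / (2 * N) = 1 / N := by
          rw [one_add_one_eq_two, mul_comm, div_mul_cancel_right₀ two_ne_zero, one_div]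
        rw [e1, e2, mul_pow]
        ring

/-- The expected sum of the weights of all continuations of a walk by `m` steps. -/
lemma expect_walkWeight_mul_influence_le {L n : ℕ} {X : ℝ} (a : Fin M)
    (hX : ∀ (l : List (Passage k M)) (e : Fin M × Fin k), l.length = n → origin l e = a →
      𝔼 F : Formula k N M, ind (NoLasso F a L ∧ IsWalk F l e) * walkWeight F l ≤ X)
    (m : ℕ) (l : List (Passage k M)) (e : Fin M × Fin k) (hl : l.length + m = n)
    (ho : origin l e = a) :
    𝔼 F : Formula k N M, ind (NoLasso F a L ∧ IsWalk F l e) * walkWeight F l *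
      influence F m e ≤ (((k - 1 : ℕ) : ℝ) * (M * k)) ^ m * X := by
  induction m generalizing l e with
  | zero =>
    simp only [influence, mul_one, pow_zero, one_mul]
    exact hX l e hl ho
  | succ m ih =>
    have h1 : ∀ F : Formula k N M,
        ind (NoLasso F a L ∧ IsWalk F l e) * walkWeight F l * influence F (m + 1) e ≤
        ∑ o ∈ univ.erase e.2, ∑ e' : Fin M × Fin k,
          ind (NoLasso F a L ∧ IsWalk F ((e.1, e.2, o) :: l) e') *
            walkWeight F ((e.1, e.2, o) :: l) * influence F m e' := by
      intro F
      rw [influence, mul_sum, mul_sum]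
      refine sum_le_sum fun o ho => ?_
      rw [mul_sum, mul_sum]
      refine (sum_le_sum fun e' he' => ?_).trans
        (sum_le_sum_of_subset_of_nonneg (subset_univ (neighbors F e.1 o)) fun e' _ _ =>
          mul_nonneg (mul_nonneg (ind_nonneg _) (walkWeight_nonneg _ _))
            (influence_nonneg F m e'))
      have hiff : (NoLasso F a L ∧ IsWalk F ((e.1, e.2, o) :: l) e') ↔
          (NoLasso F a L ∧ IsWalk F l e) := by
        refine and_congr_right fun _ => ⟨fun h => h.2.2, fun h => ⟨?_, he', h⟩⟩
        exact (ne_of_mem_erase ho).symm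
      rw [walkWeight, hiff]
      exact le_of_eq (by ring)
    calc _ ≤ _ := expect_mono h1
      _ = ∑ o ∈ univ.erase e.2, ∑ e' : Fin M × Fin k, 𝔼 F : Formula k N M,
          ind (NoLasso F a L ∧ IsWalk F ((e.1, e.2, o) :: l) e') *
            walkWeight F ((e.1, e.2, o) :: l) * influence F m e' := by
          rw [expect_sum_comm]
          exact sum_congr rfl fun o _ => expect_sum_comm _ _ _
      _ ≤ ∑ _o ∈ univ.erase e.2, ∑ _e' : Fin M × Fin k,
            (((k - 1 : ℕ) : ℝ) * (M * k)) ^ m * X :=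
          sum_le_sum fun o _ => sum_le_sum fun e' _ =>
            ih _ _ (by simp only [List.length_cons]; omega) ho
      _ = _ := by
          rw [sum_const, sum_const, card_erase_of_mem (mem_univ _), card_univ, card_univ,
            Fintype.card_fin, Fintype.card_prod, Fintype.card_fin, Fintype.card_fin,
            nsmul_eq_mul, nsmul_eq_mul, pow_succ']
          push_cast
          ring

/-- There are `((k - 1) * M * k) ^ n` candidates for a walk with `n` steps from a given edge, each
of expected weight about `(meanWeight / N) ^ n`; with `M / N = α`, the bound is about `κ(α) ^ n`. -/
lemma expect_influence_le (hk : 2 ≤ k) (hN : k ≤ N) (hM : M ≤ N) {L n : ℕ} (hn : n ≤ L)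
    (e : Fin M × Fin k) :
    𝔼 F : Formula k N M, ind (NoLasso F e.1 L) * influence F n e ≤
      (k * (k - 1) * (M / N)) ^ n * (meanWeight k N M ^ n + walkError k N n) := by
  have h := expect_walkWeight_mul_influence_le (N := N) (L := L) (n := n) e.1
    (X := (1 / N) ^ n * (meanWeight k N M ^ n + walkError k N n)) (fun l e' hl ho => by
      have := expect_walkWeight_le hk hN hM (l := l) (e := e') (hl.le.trans hn)
      rwa [ho, hl] at this) n [] e (by simp) rfl
  simp only [IsWalk, and_true, walkWeight, mul_one] at h
  refine h.trans_eq ?_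
  rw [← mul_assoc, ← mul_pow, Nat.cast_sub (by omega)]
  congr 2
  push_cast
  ring

end KSat

/-! ### Clauses near short cycles -/

namespace KSat

variable {k N M : ℕ}

/-- Every lasso contributes its weight to `lassoCount`; so if each of the elements of a set is
assigned to a lasso of weight `1`, then `lassoCount` bounds their number. -/
lemma sum_ind_lasso_le {g : Bool → ℝ} (hg : ∀ b, 0 ≤ g b) (Q : Finset (Passage k M)) (L : ℕ)
    (F : Formula k N M) (φ : List (Passage k M) → Passage k M → Fin M) (P : Fin M → Prop)
    (hP : ∀ a, P a → ∃ (l : List (Passage k M)) (s : Passage k M), l.length < L ∧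
      (∀ t ∈ l, t ∈ Q) ∧ s ∈ Q ∧ (visited l (s.1, s.2.1)).Nodup ∧ s.2.1 ≠ s.2.2 ∧
      chainWeight g F l (s.1, s.2.1) = 1 ∧ Closes F l s ∧ φ l s = a) :
    ∑ a, ind (P a) ≤ ∑ n ∈ range L, lassoCount g Q n F := by
  have hnn : ∀ (n : ℕ) (f : Fin n → Passage k M) (s : Passage k M),
      0 ≤ ind ((visited (List.ofFn f) (s.1, s.2.1)).Nodup ∧ s.2.1 ≠ s.2.2) *
        (chainWeight g F (List.ofFn f) (s.1, s.2.1) * ind (Closes F (List.ofFn f) s)) :=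
    fun n f s => mul_nonneg (ind_nonneg _) (mul_nonneg (chainWeight_nonneg hg _ _ _) (ind_nonneg _))
  have hsplit : ∀ n, lassoCount g Q n F = ∑ a, ∑ f ∈ Fintype.piFinset fun _ : Fin n => Q,
      ∑ s ∈ Q, ind (φ (List.ofFn f) s = a) *
        (ind ((visited (List.ofFn f) (s.1, s.2.1)).Nodup ∧ s.2.1 ≠ s.2.2) *
          (chainWeight g F (List.ofFn f) (s.1, s.2.1) * ind (Closes F (List.ofFn f) s))) := by
    intro n
    rw [lassoCount]
    refine (sum_comm.trans (sum_congr rfl fun f _ => ?_)).symm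
    refine sum_comm.trans (sum_congr rfl fun s _ => ?_)
    rw [← sum_mul, sum_ind_eq, ind_pos (mem_univ _), one_mul]
  simp_rw [hsplit]
  rw [sum_comm]
  refine sum_le_sum fun a _ => ?_
  have h0 : ∀ n, ∀ f : Fin n → Passage k M, ∀ s : Passage k M, 0 ≤ ind (φ (List.ofFn f) s = a) *
        (ind ((visited (List.ofFn f) (s.1, s.2.1)).Nodup ∧ s.2.1 ≠ s.2.2) *
          (chainWeight g F (List.ofFn f) (s.1, s.2.1) * ind (Closes F (List.ofFn f) s))) :=
    fun n f s => mul_nonneg (ind_nonneg _) (hnn n f s)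
  by_cases h : P a
  swap
  · rw [ind_neg h]
    exact sum_nonneg fun n _ => sum_nonneg fun f _ => sum_nonneg fun s _ => h0 n f s
  obtain ⟨l, s, hl, hlQ, hsQ, hnd, hio, hw, hc, hφ⟩ := hP a h
  have hof : List.ofFn (fun i : Fin l.length => l.get i) = l := List.ofFn_get l
  rw [ind_pos h]
  refine le_trans ?_ (single_le_sum (f := fun n => ∑ f ∈ Fintype.piFinset fun _ : Fin n => Q,
      ∑ s ∈ Q, ind (φ (List.ofFn f) s = a) *
        (ind ((visited (List.ofFn f) (s.1, s.2.1)).Nodup ∧ s.2.1 ≠ s.2.2) *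
          (chainWeight g F (List.ofFn f) (s.1, s.2.1) * ind (Closes F (List.ofFn f) s))))
    (fun n _ => sum_nonneg fun f _ => sum_nonneg fun s _ => h0 n f s) (mem_range.2 hl))
  refine le_trans ?_ (single_le_sum (f := fun f : Fin l.length → Passage k M =>
      ∑ s ∈ Q, ind (φ (List.ofFn f) s = a) *
        (ind ((visited (List.ofFn f) (s.1, s.2.1)).Nodup ∧ s.2.1 ≠ s.2.2) *
          (chainWeight g F (List.ofFn f) (s.1, s.2.1) * ind (Closes F (List.ofFn f) s))))
    (fun f _ => sum_nonneg fun s _ => h0 _ f s)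
    (Fintype.mem_piFinset.2 fun i => hlQ _ (l.get_mem i)))
  refine le_trans ?_ (single_le_sum (fun s _ => h0 _ _ s) hsQ)
  rw [hof, ind_pos hφ, ind_pos ⟨hnd, hio⟩, hw, ind_pos hc]
  norm_num

lemma sum_ind_not_noLasso_le (F : Formula k N M) (L : ℕ) :
    ∑ a, ind (¬ NoLasso F a L) ≤ ∑ n ∈ range (L + 1), lassoCount (fun _ => 1) univ n F := by
  refine sum_ind_lasso_le (fun _ => zero_le_one) univ (L + 1) F
    (fun l s => origin l (s.1, s.2.1)) _ fun a ha => ?_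
  unfold NoLasso at ha
  push Not at ha
  obtain ⟨l, e, o, hl, hw, ho, hnd, hoe, t, ht, p, hp⟩ := ha
  exact ⟨l, (e.1, e.2, o), Nat.lt_succ_of_le hl, fun _ _ => mem_univ _, mem_univ _, hnd,
    hoe.symm, chainWeight_one hw, ⟨t, ht, p, hp⟩, ho⟩

/-- The bound does not depend on `N`: a random formula has few clauses near short cycles. -/
lemma expect_sum_ind_not_noLasso_le (hk : 2 ≤ k) (hN : k ≤ N) (hM : M ≤ N) (L : ℕ) :
    𝔼 F : Formula k N M, ∑ a, ind (¬ NoLasso F a L) ≤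
      (L + 1) * (2 * k * L) * ((k : ℝ) ^ 2) ^ (L + 1) := by
  have hN0 : (0 : ℝ) < N := by exact_mod_cast (by omega : 0 < N)
  have hk1 : (1 : ℝ) ≤ (k : ℝ) ^ 2 := by
    have : (2 : ℝ) ≤ k := by exact_mod_cast hk
    nlinarith
  refine (expect_mono fun F => sum_ind_not_noLasso_le F L).trans ?_
  rw [expect_sum_comm]
  calc _ ≤ ∑ _n ∈ range (L + 1), 2 * k * L * ((k : ℝ) ^ 2) ^ (L + 1) := by
        refine sum_le_sum fun n hn => ?_
        have hnL : n ≤ L := Nat.lt_succ_iff.1 (mem_range.1 hn)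
        refine (expect_lassoCount_le hN (hk.trans hN) (fun _ => zero_le_one) one_pos
          (by norm_num) univ n).trans ?_
        have h1 : ((#(univ : Finset (Passage k M)) : ℕ) : ℝ) * 1 / N ≤ (k : ℝ) ^ 2 := by
          rw [card_univ, Fintype.card_prod, Fintype.card_prod, Fintype.card_fin, Fintype.card_fin,
            mul_one, div_le_iff₀ hN0]
          push_cast
          have : (M : ℝ) ≤ N := by exact_mod_cast hM
          nlinarith [mul_nonneg (sq_nonneg (k : ℝ)) (sub_nonneg.2 this)]
        have h2 : (n : ℝ) ≤ L := by exact_mod_cast hnL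
        rw [div_one]
        calc 2 * k * (n : ℝ) * (((#(univ : Finset (Passage k M)) : ℕ) : ℝ) * 1 / N) ^ (n + 1)
            ≤ 2 * k * L * ((k : ℝ) ^ 2) ^ (n + 1) := by gcongr
          _ ≤ _ := by
            refine mul_le_mul_of_nonneg_left ?_ (by positivity)
            exact pow_le_pow_right₀ hk1 (by omega)
    _ = _ := by
        rw [sum_const, card_range, nsmul_eq_mul]
        push_cast
        ring

end KSat

/-! ### The minimal energy -/

namespace KSat

variable {k N M : ℕ}

/-- The literal at position `p` of clause `c`: its variable and its sign. -/
def lit (F : Formula k N M) (c : Fin M) (p : Fin k) : Fin N × Bool := (F.var c p, F.sign c p)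

/-- The negation of a literal. -/
def negLit (lam : Fin N × Bool) : Fin N × Bool := (lam.1, !lam.2)

lemma negLit_negLit (lam : Fin N × Bool) : negLit (negLit lam) = lam := by simp [negLit]

/-- The passages between the positions `i` and `j`, in either direction, of the clauses in `R`. -/
def shortPassages (i j : Fin k) (R : Finset (Fin M)) : Finset (Passage k M) :=
  R.image (fun c => (c, i, j)) ∪ R.image fun c => (c, j, i)

lemma mem_shortPassages {i j : Fin k} {R : Finset (Fin M)} {t : Passage k M} :
    t ∈ shortPassages i j R ↔ t.1 ∈ R ∧ (t.2 = (i, j) ∨ t.2 = (j, i)) := by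
  obtain ⟨c, p⟩ := t
  simp only [shortPassages, mem_union, mem_image, Prod.mk.injEq]
  constructor
  · rintro (⟨c', hc, rfl, rfl⟩ | ⟨c', hc, rfl, rfl⟩) <;> simp [hc]
  · rintro ⟨hc, rfl | rfl⟩
    · exact Or.inl ⟨c, hc, rfl, rfl⟩
    · exact Or.inr ⟨c, hc, rfl, rfl⟩

/-- The implications of the clauses in `R`, restricted to the two positions `i` and `j`: if the
literal at one of them is false, the literal at the other one must be true. -/
def Implies (F : Formula k N M) (i j : Fin k) (R : Finset (Fin M)) (lam mu : Fin N × Bool) : Prop :=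
  ∃ t ∈ shortPassages i j R, lam = negLit (lit F t.1 t.2.1) ∧ mu = lit F t.1 t.2.2

lemma Implies.contrapose {F : Formula k N M} {i j : Fin k} {R : Finset (Fin M)}
    {lam mu : Fin N × Bool} (h : Implies F i j R lam mu) :
    Implies F i j R (negLit mu) (negLit lam) := by
  obtain ⟨⟨c, p, q⟩, ht, rfl, rfl⟩ := h
  rw [mem_shortPassages] at ht
  refine ⟨(c, q, p), ?_, rfl, negLit_negLit _⟩
  rw [mem_shortPassages]
  refine ⟨ht.1, ?_⟩
  simp only [Prod.mk.injEq] at ht ⊢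
  tauto

lemma implies_star_contrapose {F : Formula k N M} {i j : Fin k} {R : Finset (Fin M)}
    {lam mu : Fin N × Bool} (h : Relation.ReflTransGen (Implies F i j R) lam mu) :
    Relation.ReflTransGen (Implies F i j R) (negLit mu) (negLit lam) := by
  induction h with
  | refl => exact .refl
  | tail _ h ih => exact (Relation.ReflTransGen.single h.contrapose).trans ih

/-- The weight that counts the chains of implications: a clause is left at a literal, and the next
clause is entered at its negation. -/
noncomputable def flipWeight (b : Bool) : ℝ := if b then 0 else 1

lemma flipWeight_nonneg (b : Bool) : 0 ≤ flipWeight b := by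
  unfold flipWeight; split_ifs <;> norm_num

/-- Without lassos among the chains of implications, no literal implies its negation. -/
lemma not_implies_negLit {F : Formula k N M} {i j : Fin k} (hij : i ≠ j) {R : Finset (Fin M)}
    (hR : ∀ (l : List (Passage k M)) (s : Passage k M), (∀ t ∈ l, t ∈ shortPassages i j R) →
      s ∈ shortPassages i j R → (visited l (s.1, s.2.1)).Nodup →
      chainWeight flipWeight F l (s.1, s.2.1) = 1 → ¬ Closes F l s) (lam : Fin N × Bool) :
    ¬ Relation.ReflTransGen (Implies F i j R) lam (negLit lam) := by
  have hio : ∀ t ∈ shortPassages (M := M) i j R, t.2.1 ≠ t.2.2 := by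
    intro t ht
    rcases (mem_shortPassages.1 ht).2 with h | h <;> rw [h]
    · exact hij
    · exact hij.symm
  -- a chain of implications is a walk that visits the variable of `lam` at its start; without
  -- lassos, it never returns to a clause
  have key : ∀ mu, Relation.ReflTransGen (Implies F i j R) lam mu → mu = lam ∨
      ∃ (l : List (Passage k M)) (s : Passage k M), (∀ t ∈ l, t ∈ shortPassages i j R) ∧
      s ∈ shortPassages i j R ∧ (visited l (s.1, s.2.1)).Nodup ∧
      chainWeight flipWeight F l (s.1, s.2.1) = 1 ∧ mu = lit F s.1 s.2.2 ∧
      ∃ t ∈ s :: l, F.var t.1 t.2.1 = lam.1 := by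
    intro mu h
    induction h with
    | refl => exact Or.inl rfl
    | tail _ hstep ih =>
      right
      obtain ⟨t, ht, hlam, hmu⟩ := hstep
      rcases ih with rfl | ⟨l, s, hl, hs, hnd, hw, heq, t', ht', hv⟩
      · refine ⟨[], t, by simp, ht, by simp [visited], rfl, hmu, t, by simp, ?_⟩
        rw [hlam]; rfl
      · rw [heq] at hlam
        have hv1 : F.var s.1 s.2.2 = F.var t.1 t.2.1 := congrArg Prod.fst hlam
        have hs1 : F.sign s.1 s.2.2 = !F.sign t.1 t.2.1 := congrArg Prod.snd hlam
        have hne : t.1 ≠ s.1 := by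
          intro h
          rw [h] at hv1 hs1
          rw [← var_injective F _ hv1] at hs1
          revert hs1
          cases F.sign s.1 s.2.2 <;> simp
        refine ⟨s :: l, t, ?_, ht, ?_, ?_, hmu, t', List.mem_cons_of_mem _ ht', hv⟩
        · intro u hu
          rcases List.mem_cons.1 hu with rfl | hu
          · exact hs
          · exact hl u hu
        · rw [visited_cons, List.nodup_cons]
          refine ⟨?_, hnd⟩
          intro hmem
          rcases List.mem_cons.1 hmem with h | h
          · exact hne h
          · obtain ⟨u, hu, hu1⟩ := List.mem_map.1 h
            exact hR l s hl hs hnd hw ⟨u, hu, t.2.1, by rw [hv1, hu1]⟩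
        · rw [chainWeight, hw, mul_one, linkWeight]
          dsimp only
          rw [ind_pos hv1.symm, one_mul, hs1]
          cases F.sign t.1 t.2.1 <;> simp [flipWeight]
  intro h
  rcases key _ h with h | ⟨l, s, hl, hs, hnd, hw, heq, t, ht, hv⟩
  · have := congrArg Prod.snd h
    revert this
    simp only [negLit]
    cases lam.2 <;> simp
  · have hv2 : F.var s.1 s.2.2 = F.var t.1 t.2.1 := by
      rw [hv]
      exact (congrArg Prod.fst heq).symm
    rcases List.mem_cons.1 ht with rfl | ht
    · exact hio t hs (var_injective F _ hv2).symm
    · exact hR l s hl hs hnd hw ⟨t, ht, _, hv2⟩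

/-- If no literal implies its negation, then some assignment satisfies all implications: a maximal
consistent set of literals that is closed under the implications decides all variables. -/
lemma exists_satisfying {F : Formula k N M} {i j : Fin k} {R : Finset (Fin M)}
    (h : ∀ lam, ¬ Relation.ReflTransGen (Implies F i j R) lam (negLit lam)) :
    ∃ x : Fin N → Bool, ∀ c ∈ R, x (F.var c i) = F.sign c i ∨ x (F.var c j) = F.sign c j := by
  classical
  let good : Finset (Fin N × Bool) → Prop := fun S =>
    (∀ lam ∈ S, ∀ mu, Relation.ReflTransGen (Implies F i j R) lam mu → mu ∈ S) ∧
      ∀ lam ∈ S, negLit lam ∉ S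
  obtain ⟨S, hS, hmax⟩ := (univ.filter good).exists_max_image card
    ⟨∅, mem_filter.2 ⟨mem_univ _, by simp, by simp⟩⟩
  obtain ⟨hcl, hcons⟩ := (mem_filter.1 hS).2
  have htot : ∀ v : Fin N, (v, true) ∈ S ∨ (v, false) ∈ S := by
    intro v
    by_contra! hv
    set T : Finset (Fin N × Bool) :=
      univ.filter fun mu => Relation.ReflTransGen (Implies F i j R) (v, true) mu with hT
    have hmemT : ∀ mu, mu ∈ T ↔ Relation.ReflTransGen (Implies F i j R) (v, true) mu := by
      simp [hT]
    have hST : ∀ lam ∈ S, negLit lam ∉ T := by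
      intro lam hlam hm
      have h2 := implies_star_contrapose ((hmemT _).1 hm)
      rw [negLit_negLit] at h2
      exact hv.2 (hcl lam hlam _ h2)
    have hgood : good (S ∪ T) := by
      refine ⟨?_, ?_⟩
      · intro lam hlam mu hmu
        rcases mem_union.1 hlam with hl | hl
        · exact mem_union_left _ (hcl lam hl mu hmu)
        · exact mem_union_right _ ((hmemT _).2 (((hmemT _).1 hl).trans hmu))
      · intro lam hlam hneg
        rcases mem_union.1 hlam with hl | hl <;> rcases mem_union.1 hneg with hn | hn
        · exact hcons lam hl hn
        · exact hST lam hl hn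
        · refine hST _ hn ?_
          rwa [negLit_negLit]
        · have h2 := implies_star_contrapose ((hmemT _).1 hn)
          rw [negLit_negLit] at h2
          exact h _ (((hmemT _).1 hl).trans h2)
    have hle := hmax (S ∪ T) (mem_filter.2 ⟨mem_univ _, hgood⟩)
    have heq : S = S ∪ T := eq_of_subset_of_card_le subset_union_left hle
    refine hv.1 ?_
    rw [heq]
    exact mem_union_right _ ((hmemT _).2 .refl)
  refine ⟨fun v => decide ((v, true) ∈ S), fun c hc => ?_⟩
  have hdec : ∀ v b, (v, b) ∈ S → decide ((v, true) ∈ S) = b := by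
    intro v b hb
    cases b
    · have := hcons _ hb
      simpa [negLit] using this
    · simpa using hb
  have hdec' : ∀ v b, decide ((v, true) ∈ S) ≠ b → (v, !b) ∈ S := by
    intro v b hb
    cases b
    · simpa using hb
    · rcases htot v with h | h
      · simp [h] at hb
      · exact h
  by_cases hi : decide ((F.var c i, true) ∈ S) = F.sign c i
  · exact Or.inl hi
  · right
    refine hdec _ _ (hcl _ (hdec' _ _ hi) _ (.single ⟨(c, i, j), ?_, rfl, rfl⟩))
    exact mem_shortPassages.2 ⟨hc, Or.inl rfl⟩

/-- Some assignment violates at most as many clauses as there are lassos among the chains of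
implications: without the last clauses of the lassos, the formula is satisfiable. -/
lemma exists_energy_le (F : Formula k N M) {i j : Fin k} (hij : i ≠ j) :
    ∃ x : Fin N → Bool, (energy F x : ℝ) ≤
      ∑ n ∈ range M, lassoCount flipWeight (shortPassages i j univ) n F := by
  classical
  set B : Fin M → Prop := fun c => ∃ (l : List (Passage k M)) (s : Passage k M), l.length < M ∧
      (∀ t ∈ l, t ∈ shortPassages i j univ) ∧ s ∈ shortPassages i j univ ∧
      (visited l (s.1, s.2.1)).Nodup ∧ s.2.1 ≠ s.2.2 ∧
      chainWeight flipWeight F l (s.1, s.2.1) = 1 ∧ Closes F l s ∧ s.1 = c with hB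
  set R : Finset (Fin M) := univ.filter fun c => ¬ B c with hRdef
  have hsub : ∀ t : Passage k M, t ∈ shortPassages i j R → t ∈ shortPassages i j univ := fun t ht =>
    mem_shortPassages.2 ⟨mem_univ _, (mem_shortPassages.1 ht).2⟩
  obtain ⟨x, hx⟩ := exists_satisfying (F := F) (i := i) (j := j) (R := R)
    (not_implies_negLit hij fun l s hl hs hnd hw hc => by
      have h1 := mem_shortPassages.1 hs
      refine (mem_filter.1 h1.1).2 ⟨l, s, ?_, fun t ht => hsub t (hl t ht), hsub s hs, hnd, ?_, hw,
        hc, rfl⟩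
      · have := hnd.length_le_card
        rw [Fintype.card_fin, visited, List.length_cons, List.length_map] at this
        omega
      · rcases h1.2 with h | h <;> rw [h]
        · exact hij
        · exact hij.symm)
  have hle : ∑ a, ind (B a) ≤
      ∑ n ∈ range M, lassoCount flipWeight (shortPassages i j univ) n F := by
    refine sum_ind_lasso_le flipWeight_nonneg (shortPassages i j univ) M F (fun _ s => s.1) B ?_
    rintro a ⟨l, s, h⟩
    exact ⟨l, s, h⟩
  refine ⟨x, le_trans ?_ hle⟩
  rw [energy, card_filter_eq_sum_ind]
  refine sum_le_sum fun c _ => ind_mono fun hc => ?_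
  by_contra hBc
  rcases hx c (mem_filter.2 ⟨mem_univ _, hBc⟩) with h | h
  · exact hc _ h
  · exact hc _ h

/-- The expected minimal energy is bounded if there are fewer clauses than variables: each step of a
chain of implications has `2 * M` possible passages, and the link to it has probability
`1 / (2 * N)`. -/
lemma exists_bound_expect_lassos (hk : 2 ≤ k) {α : ℝ} (hα : 0 ≤ α) (hα1 : α < 1) {i j : Fin k} :
    ∃ C : ℝ, 0 ≤ C ∧ ∀ N M : ℕ, k ≤ N → (M : ℝ) ≤ α * N →
      𝔼 F : Formula k N M, ∑ n ∈ range M, lassoCount flipWeight (shortPassages i j univ) n F ≤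
        C := by
  have hα' : ‖α‖ < 1 := by rwa [Real.norm_eq_abs, abs_of_nonneg hα]
  have hgeo : Summable fun n : ℕ => (n : ℝ) ^ 1 * α ^ n :=
    summable_pow_mul_geometric_of_norm_lt_one 1 hα'
  have hsum : Summable fun n : ℕ => 4 * k * α * ((n : ℝ) ^ 1 * α ^ n) :=
    hgeo.mul_left (4 * (k : ℝ) * α)
  have h0 : ∀ n : ℕ, 0 ≤ 4 * k * α * ((n : ℝ) ^ 1 * α ^ n) := fun n => by positivity
  refine ⟨∑' n : ℕ, 4 * k * α * ((n : ℝ) ^ 1 * α ^ n), tsum_nonneg h0, fun N M hN hM => ?_⟩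
  have hN0 : (0 : ℝ) < N := by exact_mod_cast (by omega : 0 < N)
  rw [expect_sum_comm]
  refine le_trans (sum_le_sum fun n _ => ?_) (hsum.sum_le_tsum (range M) fun n _ => h0 n)
  refine (expect_lassoCount_le hN (hk.trans hN) flipWeight_nonneg (ρ := 1 / 2) (by norm_num)
    (by simp [flipWeight]) _ n).trans ?_
  have hcard : (#(shortPassages i j (univ : Finset (Fin M))) : ℝ) ≤ 2 * M := by
    have : #(shortPassages i j (univ : Finset (Fin M))) ≤ M + M := by
      refine (card_union_le _ _).trans (add_le_add ?_ ?_) <;>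
        exact card_image_le.trans (by rw [card_univ, Fintype.card_fin])
    have h2 : (#(shortPassages i j (univ : Finset (Fin M))) : ℝ) ≤ ((M + M : ℕ) : ℝ) := by
      exact_mod_cast this
    push_cast at h2
    linarith
  have h1 : (#(shortPassages i j (univ : Finset (Fin M))) : ℝ) * (1 / 2) / N ≤ α := by
    rw [div_le_iff₀ hN0]
    linarith
  calc 2 * k * n / (1 / 2) * ((#(shortPassages i j (univ : Finset (Fin M))) : ℝ) * (1 / 2) / N) ^
        (n + 1) ≤ 2 * k * n / (1 / 2) * α ^ (n + 1) := by gcongr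
    _ = _ := by rw [pow_succ]; ring

/-- A satisfied clause stays satisfied if one of its variables is fixed. So at least `N - M`
variables can be chosen freely without raising the energy above that of `x`. -/
lemma log_partitionFunction_ge {β : ℝ} (hβ : 0 ≤ β) (F : Formula k N M) (x : Fin N → Bool) :
    ((N : ℝ) - M) * Real.log 2 - β * energy F x ≤ Real.log (partitionFunction β F) := by
  classical
  set Sat : Finset (Fin M) := univ.filter fun a => ∃ p, x (F.var a p) = F.sign a p with hSat
  have hex : ∀ a : Sat, ∃ p, x (F.var a p) = F.sign a p := fun a => (mem_filter.1 a.2).2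
  choose φ hφ using hex
  set S : Finset (Fin N) := univ.image fun a : Sat => F.var a (φ a) with hS
  have hScard : #S ≤ M := card_image_le.trans (by
    rw [card_univ, Fintype.card_coe]
    exact (card_le_univ _).trans_eq (Fintype.card_fin M))
  set A : Finset (Fin N → Bool) :=
    Fintype.piFinset fun v => if v ∈ S then {x v} else univ with hA
  have hAE : ∀ y ∈ A, energy F y ≤ energy F x := by
    intro y hy
    refine card_le_card fun a ha => ?_
    rw [mem_filter] at ha ⊢
    refine ⟨mem_univ _, fun p hp => ?_⟩
    have haS : a ∈ Sat := mem_filter.2 ⟨mem_univ _, p, hp⟩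
    have hmem : F.var a (φ ⟨a, haS⟩) ∈ S := mem_image.2 ⟨⟨a, haS⟩, mem_univ _, rfl⟩
    have h1 := Fintype.mem_piFinset.1 hy (F.var a (φ ⟨a, haS⟩))
    rw [if_pos hmem, mem_singleton] at h1
    exact ha.2 _ (h1.trans (hφ ⟨a, haS⟩))
  have hAcard : #A = 2 ^ (N - #S) := by
    rw [hA, Fintype.card_piFinset]
    have : ∀ v : Fin N, #(if v ∈ S then ({x v} : Finset Bool) else univ) =
        if v ∈ S then 1 else 2 := fun v => by
      split_ifs <;> simp
    simp_rw [this]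
    rw [prod_ite, prod_const_one, one_mul, prod_const]
    congr 1
    rw [filter_not, card_sdiff_of_subset (filter_subset _ _), card_univ, Fintype.card_fin]
    simp
  have hSN : #S ≤ N := (card_le_univ _).trans_eq (Fintype.card_fin N)
  have hZ : 2 ^ (N - #S) * Real.exp (-β * energy F x) ≤ partitionFunction β F := by
    rw [partitionFunction]
    calc (2 : ℝ) ^ (N - #S) * Real.exp (-β * energy F x)
        = ∑ _y ∈ A, Real.exp (-β * energy F x) := by
          rw [sum_const, nsmul_eq_mul, hAcard]
          norm_num
      _ ≤ ∑ y ∈ A, Real.exp (-β * energy F y) := by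
          refine sum_le_sum fun y hy => Real.exp_le_exp.2 ?_
          have : (energy F y : ℝ) ≤ energy F x := by exact_mod_cast hAE y hy
          nlinarith
      _ ≤ _ := sum_le_sum_of_subset_of_nonneg (subset_univ _) fun _ _ _ => (Real.exp_pos _).le
  have hpos : (0 : ℝ) < 2 ^ (N - #S) * Real.exp (-β * energy F x) := by positivity
  refine le_trans ?_ (Real.log_le_log hpos hZ)
  rw [Real.log_mul (by positivity) (Real.exp_pos _).ne', Real.log_exp, Real.log_pow,
    Nat.cast_sub hSN]
  have h1 : (#S : ℝ) ≤ M := by exact_mod_cast hScard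
  have h2 : 0 < Real.log 2 := Real.log_pos one_lt_two
  nlinarith

end KSat

/-! ### Interpolation in the inverse temperature -/

namespace KSat

variable {k N M : ℕ}

lemma partitionFunction_pos (β : ℝ) (F : Formula k N M) : 0 < partitionFunction β F :=
  sum_pos (fun _ _ => Real.exp_pos _) ⟨fun _ => true, mem_univ _⟩

/-- `log Z` lies above its tangents: its slope at `b` is minus the expected energy. -/
lemma log_partitionFunction_ge_tangent (b c : ℝ) (F : Formula k N M) :
    Real.log (partitionFunction b F) - (c - b) * ∑ a, gibbsClauseEnergy b F a ≤
      Real.log (partitionFunction c F) := by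
  set m := ∑ a, gibbsClauseEnergy b F a with hm
  have hZb := partitionFunction_pos b F
  have hmean : ∑ x, (energy F x : ℝ) * boltzmann b F x = m * partitionFunction b F := by
    simp_rw [energy_eq_sum, sum_mul]
    rw [sum_comm, hm, sum_mul]
    refine sum_congr rfl fun a _ => ?_
    rw [gibbsClauseEnergy]
    exact (div_mul_cancel₀ _ hZb.ne').symm
  have h1 : partitionFunction b F * Real.exp (-(c - b) * m) ≤ partitionFunction c F := by
    have h2 : ∀ x, boltzmann b F x * Real.exp (-(c - b) * m) *
        (1 - (c - b) * (energy F x - m)) ≤ boltzmann c F x := by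
      intro x
      have h3 := Real.add_one_le_exp (-(c - b) * (energy F x - m))
      have h4 : boltzmann c F x = boltzmann b F x * Real.exp (-(c - b) * m) *
          Real.exp (-(c - b) * (energy F x - m)) := by
        rw [boltzmann, boltzmann, ← Real.exp_add, ← Real.exp_add]
        congr 1
        ring
      rw [h4]
      refine mul_le_mul_of_nonneg_left (by linarith) ?_
      exact mul_nonneg (Real.exp_pos _).le (Real.exp_pos _).le
    calc partitionFunction b F * Real.exp (-(c - b) * m)
        = ∑ x, boltzmann b F x * Real.exp (-(c - b) * m) *
            (1 - (c - b) * (energy F x - m)) := by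
          have h5 : ∀ x, boltzmann b F x * Real.exp (-(c - b) * m) *
              (1 - (c - b) * (energy F x - m)) =
              (1 + (c - b) * m) * Real.exp (-(c - b) * m) * boltzmann b F x -
                (c - b) * Real.exp (-(c - b) * m) * (energy F x * boltzmann b F x) :=
            fun x => by ring
          simp_rw [h5]
          rw [sum_sub_distrib, ← mul_sum, ← mul_sum, hmean]
          change _ = _ * partitionFunction b F - _
          ring
      _ ≤ _ := sum_le_sum fun x _ => h2 x
  have h6 := Real.log_le_log (by positivity) h1
  rw [Real.log_mul hZb.ne' (Real.exp_pos _).ne', Real.log_exp] at h6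
  linarith

lemma partitionFunction_zero (F : Formula k N M) :
    Real.log (partitionFunction 0 F) = N * Real.log 2 := by
  simp [partitionFunction]

/-- The number of clauses without a tree-like neighbourhood. The radius `n` requires the absence of
lassos up to length `2 * n + 1`, as two walks of length `n + 1` may form a cycle. -/
noncomputable def cyclicCount (n : ℕ) (F : Formula k N M) : ℝ :=
  ∑ a, ind (¬ NoLasso F a (2 * n + 1))

/-- The total influence of the messages at distance `n + 1` on the clauses with a tree-like
neighbourhood. -/
noncomputable def totalInfluence (n : ℕ) (F : Formula k N M) : ℝ :=
  ∑ a, ∑ i, ind (NoLasso F a (2 * n + 1)) * influence F (n + 1) (a, i)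

lemma cyclicCount_nonneg (n : ℕ) (F : Formula k N M) : 0 ≤ cyclicCount n F :=
  sum_nonneg fun _ _ => ind_nonneg _

lemma totalInfluence_nonneg (n : ℕ) (F : Formula k N M) : 0 ≤ totalInfluence n F :=
  sum_nonneg fun _ _ => sum_nonneg fun _ _ => mul_nonneg (ind_nonneg _) (influence_nonneg F _ _)

lemma abs_sum_gibbs_sub_bpEnergy_le (hk : 2 ≤ k) {b β : ℝ} (hb : 0 ≤ b) (hbβ : b ≤ β)
    (F : Formula k N M) (n : ℕ) :
    |∑ a, gibbsClauseEnergy b F a - bpEnergy b F| ≤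
      cyclicCount n F + β * totalInfluence n F := by
  rw [bpEnergy, ← sum_sub_distrib, cyclicCount, totalInfluence, mul_sum, ← sum_add_distrib]
  refine (abs_sum_le_sum_abs _ _).trans (sum_le_sum fun a _ => ?_)
  by_cases h : NoLasso F a (2 * n + 1)
  · rw [ind_neg (not_not.2 h), ind_pos h, zero_add]
    simp_rw [one_mul]
    refine (abs_gibbs_sub_bp_le hk hb h (n := n) le_rfl).trans ?_
    exact mul_le_mul_of_nonneg_right hbβ (sum_nonneg fun i _ => influence_nonneg F _ _)
  · rw [ind_pos h, ind_neg h]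
    simp_rw [zero_mul]
    rw [sum_const_zero, mul_zero, add_zero, abs_le]
    have h1 := gibbsClauseEnergy_mem b F a
    rw [bpClauseEnergy_eq]
    have h2 := violProb_nonneg b univ (bpMessages b F a)
    have h3 := violProb_le_one b univ (bpMessages b F a)
    exact ⟨by linarith [h1.1], by linarith [h1.2]⟩

/-- The error of the interpolation formula with the energies of belief propagation. -/
lemma abs_bpLogPartition_sub_le (hk : 2 ≤ k) (hN : 0 < N) {β : ℝ} (hβ : 0 ≤ β)
    (F : Formula k N M) (n : ℕ) :
    |bpLogPartition β F - Real.log (partitionFunction β F)| ≤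
      β / (N : ℝ) ^ 2 * M + β * (cyclicCount n F + β * totalInfluence n F) := by
  set h : ℝ := β / (N : ℝ) ^ 2 with hh
  have hN0 : (0 : ℝ) < (N : ℝ) ^ 2 := by
    have : (0 : ℝ) < N := by exact_mod_cast hN
    positivity
  have hh0 : 0 ≤ h := div_nonneg hβ hN0.le
  set t : ℕ → ℝ := fun i => (i : ℝ) * β / (N : ℝ) ^ 2 with ht
  have hstep : ∀ i, t (i + 1) - t i = h := fun i => by
    simp only [ht, hh]; push_cast; ring
  have ht0 : t 0 = 0 := by simp [ht]
  have htN : t (N ^ 2) = β := by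
    simp only [ht]; push_cast; field_simp
  set G : ℕ → ℝ := fun i => ∑ a, gibbsClauseEnergy (t i) F a with hG
  set Λ : ℕ → ℝ := fun i => Real.log (partitionFunction (t i) F) with hΛ
  have hGmem : ∀ i, 0 ≤ G i ∧ G i ≤ M := by
    intro i
    refine ⟨sum_nonneg fun a _ => (gibbsClauseEnergy_mem _ F a).1, ?_⟩
    calc G i ≤ ∑ _a : Fin M, (1 : ℝ) := sum_le_sum fun a _ => (gibbsClauseEnergy_mem _ F a).2
      _ = M := by simp
  -- convexity gives both bounds for the decrements: a Riemann sum of a monotone function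
  have hlow : ∀ i, Λ i - Λ (i + 1) ≤ h * G i := by
    intro i
    have := log_partitionFunction_ge_tangent (t i) (t (i + 1)) F
    rw [hstep] at this
    simp only [hΛ, hG]
    linarith
  have hupp : ∀ i, h * G (i + 1) ≤ Λ i - Λ (i + 1) := by
    intro i
    have := log_partitionFunction_ge_tangent (t (i + 1)) (t i) F
    rw [show t i - t (i + 1) = -h by rw [← hstep i]; ring] at this
    simp only [hΛ, hG]
    linarith
  have htel : ∑ i ∈ range (N ^ 2), (Λ i - Λ (i + 1)) =
      N * Real.log 2 - Real.log (partitionFunction β F) := by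
    rw [sum_range_sub']
    simp only [hΛ, ht0, htN, partitionFunction_zero]
  have h1 : ∑ i ∈ range (N ^ 2), (Λ i - Λ (i + 1)) ≤ ∑ i ∈ range (N ^ 2), h * G i :=
    sum_le_sum fun i _ => hlow i
  have h2 : ∑ i ∈ range (N ^ 2), h * G i - h * M ≤ ∑ i ∈ range (N ^ 2), (Λ i - Λ (i + 1)) := by
    have h3 : ∑ i ∈ range (N ^ 2), h * G (i + 1) ≤ ∑ i ∈ range (N ^ 2), (Λ i - Λ (i + 1)) :=
      sum_le_sum fun i _ => hupp i
    have h4 : ∑ i ∈ range (N ^ 2), h * G (i + 1) - ∑ i ∈ range (N ^ 2), h * G i =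
        h * G (N ^ 2) - h * G 0 := by
      rw [← sum_sub_distrib]
      exact sum_range_sub (fun i => h * G i) _
    have h5 := mul_nonneg hh0 (hGmem (N ^ 2)).1
    have h6 := mul_le_mul_of_nonneg_left (hGmem 0).2 hh0
    linarith
  -- the energies of belief propagation instead of the exact ones
  have h7 : |∑ i ∈ range (N ^ 2), h * G i - ∑ i ∈ range (N ^ 2), h * bpEnergy (t i) F| ≤
      β * (cyclicCount n F + β * totalInfluence n F) := by
    rw [← sum_sub_distrib]
    refine (abs_sum_le_sum_abs _ _).trans ?_
    have h8 : ∀ i ∈ range (N ^ 2), |h * G i - h * bpEnergy (t i) F| ≤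
        h * (cyclicCount n F + β * totalInfluence n F) := by
      intro i hi
      rw [← mul_sub, abs_mul, abs_of_nonneg hh0]
      refine mul_le_mul_of_nonneg_left ?_ hh0
      refine abs_sum_gibbs_sub_bpEnergy_le hk ?_ ?_ F n
      · simp only [ht]; positivity
      · simp only [ht]
        rw [div_le_iff₀ hN0, mul_comm]
        refine mul_le_mul_of_nonneg_left ?_ hβ
        exact_mod_cast (mem_range.1 hi).le
    refine (sum_le_sum h8).trans_eq ?_
    rw [sum_const, card_range, nsmul_eq_mul, hh]
    push_cast
    field_simp
  have hΦ : bpLogPartition β F = N * Real.log 2 - ∑ i ∈ range (N ^ 2), h * bpEnergy (t i) F := rfl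
  rw [hΦ, abs_le]
  rw [abs_le] at h7
  rw [htel] at h1 h2
  have h9 : 0 ≤ h * M := mul_nonneg hh0 (Nat.cast_nonneg M)
  exact ⟨by linarith [h7.1, h7.2], by linarith [h7.1, h7.2]⟩

/-! ### The function `κ` -/

lemma one_le_kappa_one (hk : 2 ≤ k) : 1 ≤ kappa k 1 := by
  have hk' : (2 : ℝ) ≤ k := by exact_mod_cast hk
  set e := Real.exp (-(k * 1 / 2 : ℝ)) with he
  have hp : 0 < e := Real.exp_pos _
  have hmul : e * (k + 2) ≤ 2 := by
    have h1 := Real.add_one_le_exp (k * 1 / 2 : ℝ)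
    have h2 : e * Real.exp (k * 1 / 2 : ℝ) = 1 := by rw [he, ← Real.exp_add]; simp
    nlinarith
  have hb : 1 + ((k - 2 : ℕ) : ℝ) * (-(1 / 2 * e)) ≤ (1 + -(1 / 2 * e)) ^ (k - 2) :=
    one_add_mul_le_pow (by nlinarith) _
  rw [Nat.cast_sub hk, ← sub_eq_add_neg] at hb
  push_cast at hb
  have hq : 4 / (k + 2 : ℝ) ≤ (1 - 1 / 2 * e) ^ (k - 2) := by
    refine le_trans ?_ hb
    rw [div_le_iff₀ (by positivity)]
    nlinarith
  rw [kappa, ← he]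
  calc (1 : ℝ) ≤ k * (k - 1) * 1 * (3 / 4) * (4 / (k + 2)) := by
        rw [mul_div_assoc', le_div_iff₀ (by positivity)]
        nlinarith
    _ ≤ _ := by
        have h0 : (0 : ℝ) ≤ k * (k - 1) := by nlinarith
        have h3 : (3 / 4 : ℝ) ≤ 1 - 1 / 4 * e := by nlinarith
        gcongr

lemma continuous_kappa : Continuous (kappa k) := by unfold kappa; fun_prop

lemma kappa_zero : kappa k 0 = 0 := by simp [kappa]

lemma alphaStar_le_of_one_le (hk : 2 ≤ k) {x : ℝ} (hx : 0 ≤ x) (h : 1 ≤ kappa k x) :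
    alphaStar k ≤ x := by
  obtain ⟨y, hy, hy1⟩ := intermediate_value_Icc hx continuous_kappa.continuousOn
    (show (1 : ℝ) ∈ Set.Icc (kappa k 0) (kappa k x) from ⟨by rw [kappa_zero]; exact zero_le_one, h⟩)
  refine ((isLeast_alphaStar hk).2 ⟨lt_of_le_of_ne hy.1 ?_, hy1⟩).trans hy.2
  rintro rfl
  rw [kappa_zero] at hy1
  exact zero_ne_one hy1

lemma alphaStar_le_one (hk : 2 ≤ k) : alphaStar k ≤ 1 :=
  alphaStar_le_of_one_le hk zero_le_one (one_le_kappa_one hk)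

/-- By continuity, `κ` is bounded away from `1` on `[0, α]`, as `α_*` is its first crossing of `1`.
-/
lemma exists_kappa_le (hk : 2 ≤ k) {α : ℝ} (hα : 0 ≤ α) (hα1 : α < alphaStar k) :
    ∃ ρ : ℝ, 0 < ρ ∧ ρ < 1 ∧ ∀ x, 0 ≤ x → x ≤ α → kappa k x ≤ ρ := by
  obtain ⟨y, hy, hmax⟩ := isCompact_Icc.exists_isMaxOn (Set.nonempty_Icc.2 hα)
    (continuous_kappa (k := k)).continuousOn
  refine ⟨max (1 / 2) (kappa k y), by positivity, max_lt (by norm_num) ?_,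
    fun x hx hxα => le_max_of_le_right (hmax ⟨hx, hxα⟩)⟩
  by_contra! h
  exact absurd ((alphaStar_le_of_one_le hk hy.1 h).trans hy.2) (not_le.2 hα1)

lemma kappa_eq_mul_meanWeight :
    (k : ℝ) * (k - 1) * (M / N) * meanWeight k N M = kappa k (M / N) := by
  have h : ((k : ℝ) * M / (2 * N)) = k * (M / N) / 2 := by
    rw [mul_div_assoc', div_div, mul_comm (N : ℝ) 2]
  rw [kappa, meanWeight, absence, h]
  ring

/-! ### The error for a random formula -/

lemma expect_totalInfluence_le (hk : 2 ≤ k) (hN : k ≤ N) (hM : M ≤ N) {ρ : ℝ}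
    (hρ : kappa k (M / N) ≤ ρ) (n : ℕ) :
    𝔼 F : Formula k N M, totalInfluence n F ≤
      N * k * (ρ ^ (n + 1) + ((k : ℝ) ^ 2) ^ (n + 1) * walkError k N (n + 1)) := by
  have hN0 : (0 : ℝ) < N := by exact_mod_cast (by omega : 0 < N)
  have hMN : (M : ℝ) ≤ N := by exact_mod_cast hM
  have hk1 : (2 : ℝ) ≤ k := by exact_mod_cast hk
  have hκ : 0 ≤ kappa k (M / N) := by
    rw [← kappa_eq_mul_meanWeight]
    refine mul_nonneg (mul_nonneg (by nlinarith) (by positivity)) meanWeight_nonneg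
  have h1 : (k : ℝ) * (k - 1) * (M / N) ≤ (k : ℝ) ^ 2 := by
    have h2 : (M : ℝ) / N ≤ 1 := (div_le_one hN0).2 hMN
    have h3 : (0 : ℝ) ≤ M / N := by positivity
    nlinarith
  have h2 : 0 ≤ (k : ℝ) * (k - 1) * (M / N) := mul_nonneg (by nlinarith) (by positivity)
  simp_rw [totalInfluence]
  rw [expect_sum_comm]
  calc _ ≤ ∑ _a : Fin M, ∑ _i : Fin k,
        (ρ ^ (n + 1) + ((k : ℝ) ^ 2) ^ (n + 1) * walkError k N (n + 1)) := by
        refine sum_le_sum fun a _ => ?_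
        rw [expect_sum_comm]
        refine sum_le_sum fun i _ => ?_
        refine (expect_influence_le hk hN hM (L := 2 * n + 1) (by omega) (a, i)).trans ?_
        rw [mul_add, ← mul_pow, kappa_eq_mul_meanWeight]
        exact add_le_add (pow_le_pow_left₀ hκ hρ _)
          (mul_le_mul_of_nonneg_right (pow_le_pow_left₀ h2 h1 _) (walkError_nonneg _))
    _ = M * k * (ρ ^ (n + 1) + ((k : ℝ) ^ 2) ^ (n + 1) * walkError k N (n + 1)) := by
        rw [sum_const, sum_const, card_univ, card_univ, Fintype.card_fin, Fintype.card_fin,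
          nsmul_eq_mul, nsmul_eq_mul]
        ring
    _ ≤ _ := by
        have : 0 ≤ ρ ^ (n + 1) + ((k : ℝ) ^ 2) ^ (n + 1) * walkError k N (n + 1) :=
          add_nonneg (pow_nonneg (hκ.trans hρ) _)
            (mul_nonneg (by positivity) (walkError_nonneg _))
        gcongr

/-- A base of the exponential that bounds the combinatorial error terms. -/
def growthBase (k : ℕ) : ℕ := 32 * k ^ 7 * 2 ^ k

lemma two_le_growthBase (hk : 2 ≤ k) : 2 ≤ growthBase k := by
  have h1 : 1 ≤ k ^ 7 := Nat.one_le_pow _ _ (by omega)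
  have h2 : 1 ≤ 2 ^ k := Nat.one_le_two_pow
  unfold growthBase
  nlinarith [Nat.mul_le_mul h1 h2]

lemma succ_le_two_pow (n : ℕ) : (n : ℝ) + 1 ≤ 2 ^ n := by
  exact_mod_cast (Nat.lt_two_pow_self : n < 2 ^ n)

lemma le_pow_succ {x : ℝ} (hx : 1 ≤ x) (n : ℕ) : x ≤ x ^ (n + 1) :=
  le_self_pow₀ hx (Nat.succ_ne_zero n)

lemma expect_cyclicCount_le (hk : 2 ≤ k) (hN : k ≤ N) (hM : M ≤ N) (n : ℕ) :
    𝔼 F : Formula k N M, cyclicCount n F ≤ (growthBase k : ℝ) ^ (n + 1) := by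
  have hk1 : (2 : ℝ) ≤ k := by exact_mod_cast hk
  refine (expect_sum_ind_not_noLasso_le hk hN hM (2 * n + 1)).trans ?_
  have h1 := succ_le_two_pow n
  have h2 : (2 : ℝ) ^ (n + 1) = 2 * 2 ^ n := pow_succ' 2 n
  push_cast
  calc (2 * (n : ℝ) + 1 + 1) * (2 * k * (2 * n + 1)) * ((k : ℝ) ^ 2) ^ (2 * n + 1 + 1)
      ≤ 2 ^ (n + 1) * (2 * k * 2 ^ (n + 1)) * ((k : ℝ) ^ 2) ^ (2 * n + 1 + 1) := by
        gcongr <;> linarith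
    _ = 2 * (k : ℝ) * (4 * (k : ℝ) ^ 4) ^ (n + 1) := by
        rw [mul_pow, ← pow_mul, ← pow_mul, show (4 : ℝ) = 2 ^ 2 by norm_num, ← pow_mul]
        rw [show 2 * (2 * n + 1 + 1) = 4 * (n + 1) by ring]
        ring
    _ ≤ (2 * (k : ℝ)) ^ (n + 1) * (4 * (k : ℝ) ^ 4) ^ (n + 1) := by
        refine mul_le_mul_of_nonneg_right (le_pow_succ (by linarith) n) (by positivity)
    _ = (8 * (k : ℝ) ^ 5) ^ (n + 1) := by rw [← mul_pow]; ring
    _ ≤ _ := by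
        refine pow_le_pow_left₀ (by positivity) ?_ _
        unfold growthBase
        push_cast
        have h3 : (1 : ℝ) ≤ 2 ^ k := one_le_pow₀ one_le_two
        have h4 : (k : ℝ) ^ 5 ≤ k ^ 7 := pow_le_pow_right₀ (by linarith) (by norm_num)
        have h5 : (0 : ℝ) ≤ k ^ 5 := by positivity
        nlinarith [mul_le_mul h4 h3 zero_le_one (by positivity)]

lemma walkError_le (hk : 2 ≤ k) (hN : k ≤ N) (n : ℕ) :
    N * k * (((k : ℝ) ^ 2) ^ (n + 1) * walkError k N (n + 1)) ≤ (growthBase k : ℝ) ^ (n + 1) := by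
  have hk1 : (2 : ℝ) ≤ k := by exact_mod_cast hk
  have hN0 : (0 : ℝ) < N := by exact_mod_cast (by omega : 0 < N)
  have h1 := succ_le_two_pow (n + 1)
  push_cast at h1
  set x : ℝ := n + 1 with hx
  have hx0 : 0 ≤ x := by positivity
  have hpoly : (k : ℝ) * ((x * k * k) ^ 2 + (x + 1) * (x * k) * k) ≤
      (2 * (k : ℝ) ^ 5) ^ (n + 1) * 4 ^ (n + 1) := by
    have h4 : (4 : ℝ) ^ (n + 1) = 2 ^ (n + 1) * 2 ^ (n + 1) := by rw [← mul_pow]; norm_num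
    have h5 : (k : ℝ) ^ 2 ≤ k ^ 4 := pow_le_pow_right₀ (by linarith) (by norm_num)
    have h6 : x * x ≤ 4 ^ (n + 1) := by
      rw [h4]; exact mul_le_mul (by linarith) (by linarith) hx0 (by positivity)
    have h7 : (x + 1) * x ≤ 4 ^ (n + 1) := by
      rw [h4]; exact mul_le_mul (by linarith) (by linarith) hx0 (by positivity)
    calc (k : ℝ) * ((x * k * k) ^ 2 + (x + 1) * (x * k) * k)
        = k * (x * x * (k : ℝ) ^ 4 + (x + 1) * x * (k : ℝ) ^ 2) := by ring
      _ ≤ (k : ℝ) * (4 ^ (n + 1) * (k : ℝ) ^ 4 + 4 ^ (n + 1) * (k : ℝ) ^ 4) := by gcongr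
      _ = (2 * (k : ℝ) ^ 5) * 4 ^ (n + 1) := by ring
      _ ≤ _ := by
        refine mul_le_mul_of_nonneg_right (le_pow_succ ?_ n) (by positivity)
        have : (1 : ℝ) ≤ k ^ 5 := one_le_pow₀ (by linarith)
        linarith
  have hpow : ((3 : ℝ) / 2) ^ ((n + 1) * k) ≤ (2 ^ k) ^ (n + 1) := by
    rw [← pow_mul, mul_comm k]
    exact pow_le_pow_left₀ (by norm_num) (by norm_num) _
  rw [walkError]
  push_cast
  rw [← hx]
  calc N * k * (((k : ℝ) ^ 2) ^ (n + 1) * ((3 / 2) ^ ((n + 1) * k) *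
        ((x * k * k) ^ 2 + (x + 1) * (x * k) * k) / N))
      = ((k : ℝ) ^ 2) ^ (n + 1) * (3 / 2) ^ ((n + 1) * k) *
        (k * ((x * k * k) ^ 2 + (x + 1) * (x * k) * k)) := by field_simp
    _ ≤ ((k : ℝ) ^ 2) ^ (n + 1) * (2 ^ k) ^ (n + 1) *
          ((2 * k ^ 5 : ℝ) ^ (n + 1) * 4 ^ (n + 1)) := by
        gcongr
    _ = (8 * k ^ 7 * 2 ^ k : ℝ) ^ (n + 1) := by
        rw [← mul_pow, ← mul_pow, ← mul_pow]
        ring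
    _ ≤ _ := by
        refine pow_le_pow_left₀ (by positivity) ?_ _
        unfold growthBase
        push_cast
        gcongr
        norm_num

end KSat

/-! ### Concentration -/

namespace KSat

variable {k N M : ℕ}

/-- If `y` is an approximation of `z` and `z` is not small, the relative error is small. -/
lemma relative_of_absolute {y z ε c T : ℝ} (hε : 0 < ε) (hc : 0 < c) (hT : 0 ≤ T)
    (hyz : |y - z| ≤ c * ε / (1 + ε) * T) (hz : c * T ≤ z) :
    y * (1 - ε) ≤ z ∧ z ≤ y * (1 + ε) := by
  set η := c * ε / (1 + ε) with hη
  have h1 : η * (1 + ε) = c * ε := by rw [hη]; field_simp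
  have hη0 : 0 < η := by positivity
  obtain ⟨h2, h3⟩ := abs_le.1 hyz
  have hcT : 0 ≤ c * T := by positivity
  have hηc : η ≤ c := by nlinarith
  have hηT : η * T ≤ c * T := mul_le_mul_of_nonneg_right hηc hT
  have hεz : η * T + ε * (η * T) = ε * (c * T) := by
    linear_combination T * h1
  have hy : 0 ≤ y := by linarith
  have hεz' : ε * (c * T) ≤ ε * z := mul_le_mul_of_nonneg_left hz hε.le
  have hεy : ε * z - ε * (η * T) ≤ ε * y := by
    rw [← mul_sub]; exact mul_le_mul_of_nonneg_left (by linarith) hε.le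
  have hεy' : ε * y ≤ ε * z + ε * (η * T) := by
    rw [← mul_add]; exact mul_le_mul_of_nonneg_left (by linarith) hε.le
  refine ⟨?_, by linarith⟩
  by_cases h : 1 ≤ ε
  · nlinarith
  · push Not at h
    -- `y ≤ z + η T` and `ε y ≥ ε (c - η) T = η T`
    have h5 : ε * (c * T - η * T) ≤ ε * y := mul_le_mul_of_nonneg_left (by linarith) hε.le
    nlinarith

lemma expect_one (hN : k ≤ N) (c : ℝ) : 𝔼 _F : Formula k N M, c = c := by
  have := nonempty_clause (k := k) hN
  exact expect_const univ_nonempty c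

/-- The failure probability, by Markov's inequality for the error and for the minimal energy. -/
lemma one_sub_le_prob (hk : 2 ≤ k) (hN : k ≤ N) {α : ℝ} (hα1 : α < 1)
    (hM : (M : ℝ) ≤ α * N) {ρ : ℝ} (hρ : kappa k (M / N) ≤ ρ) {C : ℝ}
    (hC : 𝔼 F : Formula k N M, ∑ n ∈ range M,
      lassoCount flipWeight (shortPassages ⟨0, by omega⟩ ⟨1, by omega⟩ univ) n F ≤ C)
    {ε β : ℝ} (hε : 0 < ε) (hβ : 0 ≤ β) (n : ℕ) {c η : ℝ}
    (hc : c = (1 - α) * Real.log 2 / 2) (hη : η = c * ε / (1 + ε)) :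
    1 - ((β / N + β * ((growthBase k : ℝ) ^ (n + 1) +
        β * (N * k * ρ ^ (n + 1) + (growthBase k : ℝ) ^ (n + 1)))) / (η * N) +
        β * C / (c * N)) ≤
      prob k N M fun F => bpLogPartition β F * (1 - ε) ≤ Real.log (partitionFunction β F) ∧
        Real.log (partitionFunction β F) ≤ bpLogPartition β F * (1 + ε) := by
  have hlog : 0 < Real.log 2 := Real.log_pos one_lt_two
  have hN0 : (0 : ℝ) < N := by exact_mod_cast (by omega : 0 < N)
  have hc0 : 0 < c := by rw [hc]; have : 0 < 1 - α := by linarith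
                         positivity
  have hη0 : 0 < η := by rw [hη]; positivity
  have hMN' : (M : ℝ) ≤ N := by nlinarith
  have hMN : M ≤ N := by exact_mod_cast hMN'
  set S : Formula k N M → ℝ := fun F => ∑ n ∈ range M,
    lassoCount flipWeight (shortPassages ⟨0, by omega⟩ ⟨1, by omega⟩ univ) n F with hS
  -- a lower bound for the indicator of success that is linear in the two error terms
  have hpt : ∀ F : Formula k N M,
      1 - ((β / N + β * (cyclicCount n F + β * totalInfluence n F)) / (η * N) +
        β * S F / (c * N)) ≤
      ind (bpLogPartition β F * (1 - ε) ≤ Real.log (partitionFunction β F) ∧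
        Real.log (partitionFunction β F) ≤ bpLogPartition β F * (1 + ε)) := by
    intro F
    set X := β / N + β * (cyclicCount n F + β * totalInfluence n F) with hX
    have hX0 : 0 ≤ X := add_nonneg (by positivity) (mul_nonneg hβ
      (add_nonneg (cyclicCount_nonneg n F) (mul_nonneg hβ (totalInfluence_nonneg n F))))
    obtain ⟨x, hx⟩ := exists_energy_le F (i := ⟨0, by omega⟩) (j := ⟨1, by omega⟩)
      (by simp)
    have hS0 : 0 ≤ S F := le_trans (Nat.cast_nonneg _) hx
    have hcN : 0 < c * N := by positivity
    have hηN : 0 < η * N := by positivity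
    by_cases h1 : X ≤ η * N
    swap
    · refine le_trans ?_ (ind_nonneg _)
      have h2 : 1 ≤ X / (η * N) := (one_le_div hηN).2 (not_le.1 h1).le
      have h3 : 0 ≤ β * S F / (c * N) := by positivity
      linarith
    by_cases h2 : β * S F ≤ c * N
    swap
    · refine le_trans ?_ (ind_nonneg _)
      have h2 : 1 ≤ β * S F / (c * N) := (one_le_div hcN).2 (not_le.1 h2).le
      have h3 : 0 ≤ X / (η * N) := by positivity
      linarith
    rw [ind_pos]
    · have h3 : 0 ≤ X / (η * N) := by positivity
      have h4 : 0 ≤ β * S F / (c * N) := by positivity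
      linarith
    refine relative_of_absolute hε hc0 hN0.le ?_ ?_
    · rw [← hη]
      refine ((abs_bpLogPartition_sub_le hk (by omega) hβ F n).trans ?_).trans h1
      rw [hX]
      refine add_le_add_left ?_ _
      rw [div_mul_eq_mul_div, div_le_div_iff₀ (by positivity) hN0]
      nlinarith [mul_le_mul_of_nonneg_left hMN' (mul_nonneg hβ hN0.le)]
    · refine le_trans ?_ (log_partitionFunction_ge hβ F x)
      have h3 := mul_le_mul_of_nonneg_left hx hβ
      have h4 : β * energy F x ≤ c * N := h3.trans h2
      have h5 : (1 - α) * N * Real.log 2 ≤ (N - M) * Real.log 2 :=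
        mul_le_mul_of_nonneg_right (by linarith) hlog.le
      have h6 : c * N + c * N = (1 - α) * N * Real.log 2 := by rw [hc]; ring
      linarith
  rw [prob_eq_expect]
  refine le_trans ?_ (expect_mono hpt)
  have hexp : 𝔼 F : Formula k N M,
      (1 - ((β / N + β * (cyclicCount n F + β * totalInfluence n F)) / (η * N) +
        β * S F / (c * N))) =
      1 - ((β / N + β * (𝔼 F : Formula k N M, cyclicCount n F +
        β * 𝔼 F : Formula k N M, totalInfluence n F)) / (η * N) +
        β * (𝔼 F, S F) / (c * N)) := by
    rw [expect_sub_distrib, expect_one hN, expect_add_distrib, ← expect_div, ← expect_div,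
      expect_add_distrib, expect_one hN, ← mul_expect, expect_add_distrib, ← mul_expect,
      ← mul_expect]
  rw [hexp]
  have h1 := expect_cyclicCount_le hk hN hMN n
  have h2 := expect_totalInfluence_le hk hN hMN hρ n
  have h3 := walkError_le hk hN n
  have h4 : 𝔼 F : Formula k N M, totalInfluence n F ≤
      N * k * ρ ^ (n + 1) + (growthBase k : ℝ) ^ (n + 1) := by
    refine h2.trans ?_
    rw [mul_add]
    linarith
  have h5 : 0 < η * N := by positivity
  have h6 : 0 < c * N := by positivity
  refine sub_le_sub_left ?_ _
  gcongr

/-- The main error term: with `n + 1` the logarithm of `N` to a large base, the errors that grow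
exponentially in `n` are small powers of `N`, and `ρ ^ n` wins against the powers of `β`. -/
lemma tendsto_error {B : ℕ} (hB : 2 ≤ B) {ρ δ : ℝ} (hρ : 0 < ρ) (hδ : 0 < δ) (hδ8 : δ ≤ 1 / 8)
    (hσ : ((B ^ 4 : ℕ) : ℝ) ^ (2 * δ) * ρ < 1) (K : ℝ) :
    Tendsto (fun N : ℕ => (N : ℝ) ^ (2 * δ) * ρ ^ (Nat.log (B ^ 4) N) * K +
        (N : ℝ) ^ (2 * δ) * (B : ℝ) ^ (Nat.log (B ^ 4) N) / N) atTop (𝓝 0) := by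
  set D : ℕ := B ^ 4 with hD
  have hD1 : 1 < D := Nat.one_lt_pow (by norm_num) (by omega)
  have hlog : Tendsto (fun N : ℕ => Nat.log D N) atTop atTop := by
    refine tendsto_atTop.2 fun b => ?_
    filter_upwards [eventually_ge_atTop (D ^ b)] with N hN
    exact (Nat.le_log_iff_pow_le hD1
      (by have := Nat.pow_pos (n := b) (by omega : 0 < D); omega)).2 hN
  set σ : ℝ := (D : ℝ) ^ (2 * δ) * ρ with hσdef
  have hD0 : (0 : ℝ) < D := by exact_mod_cast (by omega : 0 < D)
  have hσ0 : 0 < σ := by positivity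
  have h1 : Tendsto (fun N : ℕ => (N : ℝ) ^ (2 * δ) * ρ ^ (Nat.log D N)) atTop (𝓝 0) := by
    have h2 : Tendsto (fun N : ℕ => (D : ℝ) ^ (2 * δ) * σ ^ (Nat.log D N)) atTop (𝓝 0) := by
      have := ((tendsto_pow_atTop_nhds_zero_of_lt_one hσ0.le hσ).comp hlog).const_mul
        ((D : ℝ) ^ (2 * δ))
      rwa [mul_zero] at this
    refine squeeze_zero (fun N => by positivity) (fun N => ?_) h2
    set m := Nat.log D N with hm
    have h3 : (N : ℝ) ≤ (D : ℝ) ^ (m + 1) := by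
      exact_mod_cast (Nat.lt_pow_succ_log_self hD1 N).le
    have h4 : (N : ℝ) ^ (2 * δ) ≤ ((D : ℝ) ^ (2 * δ)) ^ (m + 1) := by
      refine (Real.rpow_le_rpow (Nat.cast_nonneg N) h3 (by linarith)).trans_eq ?_
      rw [← Real.rpow_natCast, ← Real.rpow_natCast, ← Real.rpow_mul hD0.le, ← Real.rpow_mul hD0.le,
        mul_comm]
    calc (N : ℝ) ^ (2 * δ) * ρ ^ m ≤ ((D : ℝ) ^ (2 * δ)) ^ (m + 1) * ρ ^ m := by gcongr
      _ = _ := by rw [hσdef, mul_pow, pow_succ]; ring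
  have h5 : Tendsto (fun N : ℕ => (N : ℝ) ^ (2 * δ) * (B : ℝ) ^ (Nat.log D N) / N) atTop
      (𝓝 0) := by
    have h6 : Tendsto (fun N : ℕ => (N : ℝ) ^ (-(1 / 2) : ℝ)) atTop (𝓝 0) :=
      (tendsto_rpow_neg_atTop (by norm_num)).comp tendsto_natCast_atTop_atTop
    refine squeeze_zero' (Eventually.of_forall fun N => by positivity) ?_ h6
    filter_upwards [eventually_ge_atTop 1] with N hN
    have hN0 : (0 : ℝ) < N := by exact_mod_cast hN
    have hN1 : (1 : ℝ) ≤ N := by exact_mod_cast hN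
    have h7 : (B : ℝ) ^ (Nat.log D N) ≤ (N : ℝ) ^ (1 / 4 : ℝ) := by
      have h8 : ((B : ℝ) ^ (Nat.log D N)) ^ 4 ≤ N := by
        rw [← pow_mul, mul_comm, pow_mul]
        exact_mod_cast Nat.pow_log_le_self D (by omega)
      have h9 := Real.rpow_le_rpow (by positivity) h8 (by norm_num : (0 : ℝ) ≤ 1 / 4)
      rwa [← Real.rpow_natCast _ 4, ← Real.rpow_mul (by positivity),
        show ((4 : ℕ) : ℝ) * (1 / 4) = 1 by norm_num, Real.rpow_one] at h9
    rw [div_le_iff₀ hN0]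
    calc (N : ℝ) ^ (2 * δ) * (B : ℝ) ^ (Nat.log D N)
        ≤ (N : ℝ) ^ (1 / 4 : ℝ) * (N : ℝ) ^ (1 / 4 : ℝ) := by
          gcongr
          linarith
      _ = (N : ℝ) ^ (-(1 / 2) : ℝ) * (N : ℝ) ^ (1 : ℝ) := by
          rw [← Real.rpow_add hN0, ← Real.rpow_add hN0]; norm_num
      _ = _ := by rw [Real.rpow_one]
  simpa using (h1.mul_const K).add h5

/-- Below the threshold, belief propagation approximates `log Z` with high probability. -/
theorem tendsto_prob_bpLogPartition (hk : 2 ≤ k) {ε α : ℝ} (hε : 0 < ε) (hα : 0 ≤ α)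
    (hα1 : α < alphaStar k) :
    ∃ δ : ℝ, 0 < δ ∧ ∀ β : ℕ → ℝ, (∀ N : ℕ, β N ∈ Set.Icc (0 : ℝ) ((N : ℝ) ^ δ)) →
      Tendsto (fun N : ℕ => prob k N ⌊α * N⌋₊ fun F =>
          bpLogPartition (β N) F * (1 - ε) ≤ Real.log (partitionFunction (β N) F) ∧
            Real.log (partitionFunction (β N) F) ≤ bpLogPartition (β N) F * (1 + ε))
        atTop (𝓝 1) := by
  have hαlt : α < 1 := hα1.trans_le (alphaStar_le_one hk)
  obtain ⟨ρ, hρ0, hρ1, hρ⟩ := exists_kappa_le hk hα hα1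
  obtain ⟨C, hC0, hC⟩ := exists_bound_expect_lassos hk hα hαlt
    (i := (⟨0, by omega⟩ : Fin k)) (j := ⟨1, by omega⟩)
  set B := growthBase k with hB
  have hB2 : 2 ≤ B := two_le_growthBase hk
  have hB0 : (0 : ℝ) < ((B ^ 4 : ℕ) : ℝ) := by
    exact_mod_cast Nat.pow_pos (by omega)
  -- the exponent `δ` is so small that the decay `ρ ^ n` survives a factor `β ^ 2 ≤ N ^ (2 δ)`
  obtain ⟨δ, hδ0, hδ8, hσ⟩ : ∃ δ : ℝ, 0 < δ ∧ δ ≤ 1 / 8 ∧ ((B ^ 4 : ℕ) : ℝ) ^ (2 * δ) * ρ < 1 := by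
    have hcont : Tendsto (fun δ : ℝ => ((B ^ 4 : ℕ) : ℝ) ^ (2 * δ) * ρ) (𝓝[>] 0) (𝓝 ρ) := by
      have h1 : Continuous fun δ : ℝ => ((B ^ 4 : ℕ) : ℝ) ^ (2 * δ) * ρ :=
        (Real.continuous_const_rpow hB0.ne').comp (continuous_const.mul continuous_id) |>.mul
          continuous_const
      have h2 := h1.tendsto 0
      simp only [mul_zero, Real.rpow_zero, one_mul] at h2
      exact h2.mono_left nhdsWithin_le_nhds
    have h3 := (hcont.eventually_lt_const hρ1).and
      (Ioc_mem_nhdsGT (by norm_num : (0 : ℝ) < 1 / 8))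
    obtain ⟨δ, h4, h5⟩ := h3.exists
    exact ⟨δ, h5.1, h5.2, h4⟩
  refine ⟨δ, hδ0, fun β hβ => ?_⟩
  set c := (1 - α) * Real.log 2 / 2 with hc
  set η := c * ε / (1 + ε) with hη
  have hc0 : 0 < c := by
    have h1 : 0 < Real.log 2 := Real.log_pos one_lt_two
    have h2 : 0 < 1 - α := by linarith
    positivity
  have hη0 : 0 < η := by positivity
  have hlim := tendsto_error hB2 hρ0 hδ0 hδ8 hσ (k : ℝ)
  have hlim2 : Tendsto (fun N : ℕ => (N : ℝ) ^ δ / N) atTop (𝓝 0) := by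
    have h6 : Tendsto (fun N : ℕ => (N : ℝ) ^ (-(1 - δ) : ℝ)) atTop (𝓝 0) :=
      (tendsto_rpow_neg_atTop (by linarith)).comp tendsto_natCast_atTop_atTop
    refine h6.congr' ?_
    filter_upwards [eventually_ge_atTop 1] with N hN
    have hN0 : (0 : ℝ) < N := by exact_mod_cast hN
    rw [neg_sub, Real.rpow_sub hN0, Real.rpow_one]
  set bound : ℕ → ℝ := fun N => (1 / η) * ((N : ℝ) ^ δ / N +
    2 * ((N : ℝ) ^ (2 * δ) * ρ ^ (Nat.log (B ^ 4) N) * k +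
        (N : ℝ) ^ (2 * δ) * (B : ℝ) ^ (Nat.log (B ^ 4) N) / N)) +
      C / c * ((N : ℝ) ^ δ / N) with hbound
  have hbound0 : Tendsto bound atTop (𝓝 0) := by
    have := ((hlim2.add (hlim.const_mul 2)).const_mul (1 / η)).add (hlim2.const_mul (C / c))
    simpa only [mul_zero, add_zero] using this
  have hlow : ∀ᶠ N : ℕ in atTop, 1 - bound N ≤ prob k N ⌊α * N⌋₊ fun F =>
      bpLogPartition (β N) F * (1 - ε) ≤ Real.log (partitionFunction (β N) F) ∧
        Real.log (partitionFunction (β N) F) ≤ bpLogPartition (β N) F * (1 + ε) := by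
    filter_upwards [eventually_ge_atTop k, eventually_ge_atTop (B ^ 4)] with N hNk hNB
    have hN0 : (0 : ℝ) < N := by exact_mod_cast (by omega : 0 < N)
    have hN1 : (1 : ℝ) ≤ N := by exact_mod_cast (by omega : 1 ≤ N)
    have hM : ((⌊α * N⌋₊ : ℕ) : ℝ) ≤ α * N := Nat.floor_le (by positivity)
    -- the radius, for which the exponential error terms are at most `N ^ (1 / 4)`
    obtain ⟨n, hn⟩ : ∃ n, Nat.log (B ^ 4) N = n + 1 := by
      have : 1 ≤ Nat.log (B ^ 4) N :=
        (Nat.le_log_iff_pow_le (Nat.one_lt_pow (by norm_num) (by omega)) (by omega)).2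
          (by rwa [pow_one])
      exact ⟨_, (Nat.sub_add_cancel this).symm⟩
    have hβN := hβ N
    refine le_trans ?_ (one_sub_le_prob hk hNk hαlt hM
      (hρ _ (by positivity) ((div_le_iff₀ hN0).2 hM)) (hC N _ hNk hM) hε hβN.1 n hc hη)
    refine sub_le_sub_left ?_ _
    simp only [hbound, hn]
    have hβ2 : β N * β N ≤ (N : ℝ) ^ (2 * δ) := by
      rw [two_mul, Real.rpow_add hN0]
      exact mul_le_mul hβN.2 hβN.2 hβN.1 (by positivity)
    have hβ1 : β N ≤ (N : ℝ) ^ (2 * δ) := hβN.2.trans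
      (Real.rpow_le_rpow_of_exponent_le hN1 (by linarith))
    set b := β N with hb
    set Nd := (N : ℝ) ^ δ with hNd
    set N2 := (N : ℝ) ^ (2 * δ) with hN2
    set G := (B : ℝ) ^ (n + 1) with hG
    have hG0 : 0 ≤ G := by positivity
    have hR0 : 0 ≤ ρ ^ (n + 1) := by positivity
    have hN20 : 0 ≤ N2 := by positivity
    have e1 : b / N ≤ Nd := by
      rw [div_le_iff₀ hN0]
      nlinarith [hβN.2, hβN.1]
    have e2 : b * (G + b * (N * k * ρ ^ (n + 1) + G)) ≤
        2 * (N2 * ρ ^ (n + 1) * k * N + N2 * G) := by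
      have e3 : b * G ≤ N2 * G := mul_le_mul_of_nonneg_right hβ1 hG0
      have e4 : b * b * (N * k * ρ ^ (n + 1) + G) ≤ N2 * (N * k * ρ ^ (n + 1) + G) :=
        mul_le_mul_of_nonneg_right hβ2 (by positivity)
      have e5 : 0 ≤ N2 * (N * k * ρ ^ (n + 1)) := by positivity
      nlinarith
    have e6 : (b / N + b * (G + b * (N * k * ρ ^ (n + 1) + G))) / (η * N) ≤
        1 / η * (Nd / N + 2 * (N2 * ρ ^ (n + 1) * k + N2 * G / N)) := by
      calc _ ≤ (Nd + 2 * (N2 * ρ ^ (n + 1) * k * N + N2 * G)) / (η * N) := by gcongr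
        _ = _ := by field_simp
    have e7 : b * C / (c * N) ≤ C / c * (Nd / N) := by
      calc _ ≤ Nd * C / (c * N) := by gcongr; exact hβN.2
        _ = _ := by field_simp
    exact add_le_add e6 e7
  have hup : ∀ N : ℕ, prob k N ⌊α * N⌋₊ (fun F =>
      bpLogPartition (β N) F * (1 - ε) ≤ Real.log (partitionFunction (β N) F) ∧
        Real.log (partitionFunction (β N) F) ≤ bpLogPartition (β N) F * (1 + ε)) ≤ 1 := by
    intro N
    refine div_le_one_of_le₀ ?_ (Nat.cast_nonneg _)
    exact_mod_cast Nat.card_le_card_of_injective _ Subtype.val_injective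
  refine tendsto_of_tendsto_of_tendsto_of_le_of_le' ?_ tendsto_const_nhds hlow
    (Eventually.of_forall hup)
  simpa using hbound0.const_sub 1

end KSat

/-! ### Programs with bounded loops -/

namespace RealRAM

/-- Programs whose loops run a counter up to a bound that is fixed when the loop starts:
`loop c e p` executes `p` with `0, 1, …, e - 1` as the value of the counter at address `0` of bank
`c`. The conditional `when e₁ e₂ p` executes `p` if `e₁ < e₂`. -/
inductive Cmd where
  | setNat (b : ℕ) (i : NExpr) (e : NExpr)
  | setReal (b : ℕ) (i : NExpr) (e : RExpr)
  | seq (p q : Cmd)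
  | when (e₁ e₂ : NExpr) (p : Cmd)
  | loop (c : ℕ) (e : NExpr) (p : Cmd)

/-- The value of a loop counter, which is kept at address `0` of its own bank. -/
abbrev NExpr.var (c : ℕ) : NExpr := .get c (.lit 0)

namespace Cmd

/-- The underlying program. -/
def compile : Cmd → Program
  | setNat b i e => .setNat b i e
  | setReal b i e => .setReal b i e
  | seq p q => .seq p.compile q.compile
  | when e₁ e₂ p => .ite (.natLt e₁ e₂) p.compile .skip
  | loop c e p => .seq (.setNat c (.lit 0) (.lit 0))
      (.while (.natLt (.var c) e)
        (.seq p.compile (.setNat c (.lit 0) (.add (.var c) (.lit 1)))))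

/-- The state after `m` rounds of a loop with body `f` and counter `c`. -/
def loopState (f : State → State) (c : ℕ) (s : State) : ℕ → State
  | 0 => s.writeNat c 0 0
  | m + 1 => (f (loopState f c s m)).writeNat c 0 (m + 1)

/-- The effect on the memory. -/
noncomputable def run : Cmd → State → State
  | setNat b i e, s => s.writeNat b (i.eval s) (e.eval s)
  | setReal b i e, s => s.writeReal b (i.eval s) (e.eval s)
  | seq p q, s => q.run (p.run s)
  | when e₁ e₂ p, s => if e₁.eval s < e₂.eval s then p.run s else s
  | loop c e p, s => loopState p.run c s (e.eval s)

/-- Whether bank `b` of natural numbers is written to. -/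
def writesNat (b : ℕ) : Cmd → Bool
  | setNat b' _ _ => b == b'
  | setReal _ _ _ => false
  | seq p q => p.writesNat b || q.writesNat b
  | when _ _ p => p.writesNat b
  | loop c _ p => b == c || p.writesNat b

/-- Whether bank `b` of real numbers is written to. -/
def writesReal (b : ℕ) : Cmd → Bool
  | setNat _ _ _ => false
  | setReal b' _ _ => b == b'
  | seq p q => p.writesReal b || q.writesReal b
  | when _ _ p => p.writesReal b
  | loop _ _ p => p.writesReal b

end Cmd

lemma State.writeNat_nat_of_ne (s : State) {b c : ℕ} (h : b ≠ c) (i v : ℕ) :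
    (s.writeNat c i v).nat b = s.nat b := Function.update_of_ne h _ _

lemma State.writeNat_nat_self (s : State) (c i v : ℕ) :
    (s.writeNat c i v).nat c = Function.update (s.nat c) i v := Function.update_self _ _ _

lemma State.writeNat_real (s : State) (c i v : ℕ) : (s.writeNat c i v).real = s.real := rfl

lemma State.writeReal_real_of_ne (s : State) {b c : ℕ} (h : b ≠ c) (i : ℕ) (v : ℝ) :
    (s.writeReal c i v).real b = s.real b := Function.update_of_ne h _ _

lemma State.writeReal_real_self (s : State) (c i : ℕ) (v : ℝ) :
    (s.writeReal c i v).real c = Function.update (s.real c) i v := Function.update_self _ _ _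

namespace Cmd

lemma run_nat {b : ℕ} {p : Cmd} (h : p.writesNat b = false) (s : State) :
    (p.run s).nat b = s.nat b := by
  induction p generalizing s with
  | setNat b' i e => exact State.writeNat_nat_of_ne _ (by simpa [writesNat] using h) _ _
  | setReal b' i e => rfl
  | seq p q hp hq =>
    simp only [writesNat, Bool.or_eq_false_iff] at h
    rw [run, hq h.2, hp h.1]
  | when e₁ e₂ p hp =>
    rw [run]
    split_ifs
    · exact hp h s
    · rfl
  | loop c e p hp =>
    simp only [writesNat, Bool.or_eq_false_iff, beq_eq_false_iff_ne] at h
    rw [run]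
    induction e.eval s with
    | zero => exact State.writeNat_nat_of_ne _ h.1 _ _
    | succ m ih => rw [loopState, State.writeNat_nat_of_ne _ h.1, hp h.2, ih]

lemma run_real {b : ℕ} {p : Cmd} (h : p.writesReal b = false) (s : State) :
    (p.run s).real b = s.real b := by
  induction p generalizing s with
  | setNat b' i e => rfl
  | setReal b' i e => exact State.writeReal_real_of_ne _ (by simpa [writesReal] using h) _ _
  | seq p q hp hq =>
    simp only [writesReal, Bool.or_eq_false_iff] at h
    rw [run, hq h.2, hp h.1]
  | when e₁ e₂ p hp =>
    rw [run]
    split_ifs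
    · exact hp h s
    · rfl
  | loop c e p hp =>
    rw [run]
    induction e.eval s with
    | zero => rfl
    | succ m ih => rw [loopState, State.writeNat_real, hp h, ih]

/-- The states agree on the banks that `p` does not write to. -/
structure Frame (p : Cmd) (s s' : State) : Prop where
  nat : ∀ b, p.writesNat b = false → s'.nat b = s.nat b
  real : ∀ b, p.writesReal b = false → s'.real b = s.real b

lemma frame_run (p : Cmd) (s : State) : Frame p s (p.run s) :=
  ⟨fun _ h => run_nat h s, fun _ h => run_real h s⟩

lemma loopState_counter (f : State → State) (c : ℕ) (s : State) (m : ℕ) :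
    (loopState f c s m).nat c 0 = m := by
  cases m <;> simp [loopState, State.writeNat_nat_self]

lemma frame_loopState (c : ℕ) (e : NExpr) (p : Cmd) (s : State) (m : ℕ) :
    Frame (loop c e p) s (loopState p.run c s m) := by
  induction m with
  | zero =>
    refine ⟨fun b h => ?_, fun b h => rfl⟩
    simp only [writesNat, Bool.or_eq_false_iff, beq_eq_false_iff_ne] at h
    exact State.writeNat_nat_of_ne _ h.1 _ _
  | succ m ih =>
    refine ⟨fun b h => ?_, fun b h => ?_⟩
    · have h' := h
      simp only [writesNat, Bool.or_eq_false_iff, beq_eq_false_iff_ne] at h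
      rw [loopState, State.writeNat_nat_of_ne _ h.1, run_nat h.2, ih.nat b h']
    · rw [loopState, State.writeNat_real, run_real (p := p) h, ih.real b h]

/-- Induction over the rounds of a loop, for a property of a bank of real numbers. -/
lemma run_loop_real (r : ℕ) {c : ℕ} {e : NExpr} {p : Cmd} {s : State}
    (P : ℕ → (ℕ → ℝ) → Prop) (h0 : P 0 (s.real r))
    (hstep : ∀ i < e.eval s, ∀ s', Frame (loop c e p) s s' → s'.nat c 0 = i → P i (s'.real r) →
      P (i + 1) ((p.run s').real r)) :
    P (e.eval s) (((loop c e p).run s).real r) := by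
  have h : ∀ m ≤ e.eval s, P m ((loopState p.run c s m).real r) := by
    intro m
    induction m with
    | zero => exact fun _ => h0
    | succ m ih =>
      intro hm
      exact hstep m hm _ (frame_loopState c e p s m) (loopState_counter _ _ _ _)
        (ih (Nat.le_of_succ_le hm))
  exact h _ le_rfl

/-- Induction over the rounds of a loop, for a property of a bank of natural numbers. -/
lemma run_loop_nat (r : ℕ) {c : ℕ} {e : NExpr} {p : Cmd} {s : State} (hr : r ≠ c)
    (P : ℕ → (ℕ → ℕ) → Prop) (h0 : P 0 (s.nat r))
    (hstep : ∀ i < e.eval s, ∀ s', Frame (loop c e p) s s' → s'.nat c 0 = i → P i (s'.nat r) →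
      P (i + 1) ((p.run s').nat r)) :
    P (e.eval s) (((loop c e p).run s).nat r) := by
  have h : ∀ m ≤ e.eval s, P m ((loopState p.run c s m).nat r) := by
    intro m
    induction m with
    | zero =>
      intro _
      rw [loopState, State.writeNat_nat_of_ne _ hr]
      exact h0
    | succ m ih =>
      intro hm
      rw [loopState, State.writeNat_nat_of_ne _ hr]
      exact hstep m hm _ (frame_loopState c e p s m) (loopState_counter _ _ _ _)
        (ih (Nat.le_of_succ_le hm))
  exact h _ le_rfl

end Cmd

/-- The banks that an expression reads. -/
def NExpr.reads : NExpr → List ℕ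
  | lit _ => []
  | get b i => b :: i.reads
  | add e₁ e₂ => e₁.reads ++ e₂.reads
  | sub e₁ e₂ => e₁.reads ++ e₂.reads

lemma NExpr.eval_congr {e : NExpr} {s s' : State} (h : ∀ b ∈ e.reads, s'.nat b = s.nat b) :
    e.eval s' = e.eval s := by
  induction e with
  | lit n => rfl
  | get b i ih =>
    rw [eval, eval, h b List.mem_cons_self, ih fun b' hb' => h b' (List.mem_cons_of_mem _ hb')]
  | add e₁ e₂ h₁ h₂ =>
    rw [eval, eval, h₁ fun b hb => h b (List.mem_append_left _ hb),
      h₂ fun b hb => h b (List.mem_append_right _ hb)]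
  | sub e₁ e₂ h₁ h₂ =>
    rw [eval, eval, h₁ fun b hb => h b (List.mem_append_left _ hb),
      h₂ fun b hb => h b (List.mem_append_right _ hb)]

namespace Cmd

/-- The bounds of the loops. -/
def bounds : Cmd → List NExpr
  | setNat _ _ _ => []
  | setReal _ _ _ => []
  | seq p q => p.bounds ++ q.bounds
  | when _ _ p => p.bounds
  | loop _ e p => e :: p.bounds

/-- No loop changes its own counter, and the bounds of the loops depend only on the banks in `S`,
which are not written to. -/
def Admissible (S : List ℕ) : Cmd → Bool
  | setNat b _ _ => !S.contains b
  | setReal _ _ _ => true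
  | seq p q => p.Admissible S && q.Admissible S
  | when _ _ p => p.Admissible S
  | loop c e p => !S.contains c && !p.writesNat c && (e.reads.all fun b => S.contains b) &&
      p.Admissible S

lemma writesNat_of_admissible {S : List ℕ} {p : Cmd} (h : p.Admissible S = true) {b : ℕ}
    (hb : b ∈ S) : p.writesNat b = false := by
  induction p with
  | setNat b' i e =>
    simp only [Admissible, Bool.not_eq_true', List.contains_eq_mem, decide_eq_false_iff_not] at h
    rw [Cmd.writesNat, beq_eq_false_iff_ne]
    rintro rfl
    exact h hb
  | setReal b' i e => rfl
  | seq p q hp hq =>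
    simp only [Admissible, Bool.and_eq_true] at h
    rw [Cmd.writesNat, hp h.1, hq h.2]; rfl
  | when e₁ e₂ p hp => exact hp h
  | loop c e p hp =>
    simp only [Admissible, Bool.and_eq_true, Bool.not_eq_true', List.contains_eq_mem,
      decide_eq_false_iff_not] at h
    rw [Cmd.writesNat, hp h.2, Bool.or_false, beq_eq_false_iff_ne]
    rintro rfl
    exact h.1.1.1 hb

/-- The number of steps, as a polynomial in a common bound for the numbers of rounds. -/
noncomputable def time : Cmd → Polynomial ℕ
  | setNat _ i e => .C (i.cost + e.cost + 1)
  | setReal _ i e => .C (i.cost + e.cost + 1)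
  | seq p q => p.time + q.time
  | when e₁ e₂ p => p.time + .C (e₁.cost + e₂.cost + 3)
  | loop _ e p => .X * (p.time + .C (e.cost + 10)) + .C (e.cost + 7)

lemma reads_subset_of_admissible {S : List ℕ} {p : Cmd} (h : p.Admissible S = true) :
    ∀ e ∈ p.bounds, ∀ b ∈ e.reads, b ∈ S := by
  induction p with
  | setNat b' i e => simp [bounds]
  | setReal b' i e => simp [bounds]
  | seq p q hp hq =>
    simp only [Admissible, Bool.and_eq_true] at h
    intro e he
    rcases List.mem_append.1 he with he | he
    · exact hp h.1 e he
    · exact hq h.2 e he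
  | when e₁ e₂ p hp => exact hp h
  | loop c e p hp =>
    simp only [Admissible, Bool.and_eq_true, List.all_eq_true, List.contains_eq_mem,
      decide_eq_true_eq] at h
    intro e' he
    rcases List.mem_cons.1 he with rfl | he
    · exact h.1.2
    · exact hp h.2 e' he

/-- Bounds for the numbers of rounds persist, as these numbers depend on `S` only. -/
lemma bounds_le_of_admissible {S : List ℕ} {p : Cmd} (h : p.Admissible S = true) {K : ℕ}
    {s s' : State} (hs : ∀ b ∈ S, s'.nat b = s.nat b) (hK : ∀ e ∈ p.bounds, e.eval s ≤ K) :
    ∀ e ∈ p.bounds, e.eval s' ≤ K := fun e he => by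
  rw [NExpr.eval_congr fun b hb => hs b (reads_subset_of_admissible h e he b hb)]
  exact hK e he

/-- The compiled program has the effect `run`, in polynomial time: if no loop of `p` has more than
`K` rounds, it halts after at most `p.time.eval K` steps. -/
theorem exec_compile {S : List ℕ} {p : Cmd} (h : p.Admissible S = true) (K : ℕ) (s : State)
    (hK : ∀ e ∈ p.bounds, e.eval s ≤ K) :
    ∃ t, Exec p.compile s t (p.run s) ∧ t ≤ p.time.eval K := by
  induction p generalizing s with
  | setNat b i e => exact ⟨_, Exec.setNat s b i e, by simp [time]⟩
  | setReal b i e => exact ⟨_, Exec.setReal s b i e, by simp [time]⟩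
  | seq p q hp hq =>
    simp only [Admissible, Bool.and_eq_true] at h
    obtain ⟨t, ht, htK⟩ := hp h.1 s fun e he => hK e (List.mem_append_left _ he)
    obtain ⟨t', ht', htK'⟩ := hq h.2 (p.run s) (bounds_le_of_admissible h.2
      (fun b hb => run_nat (writesNat_of_admissible h.1 hb) s) fun e he =>
        hK e (List.mem_append_right _ he))
    refine ⟨_, Exec.seq ht ht', ?_⟩
    simp only [time, Polynomial.eval_add]
    omega
  | when e₁ e₂ p hp =>
    simp only [time, Polynomial.eval_add, Polynomial.eval_C]
    rw [run]
    split_ifs with hc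
    · obtain ⟨t, ht, htK⟩ := hp h s hK
      refine ⟨_, Exec.iteTrue hc ht, ?_⟩
      simp only [Test.cost]
      omega
    · refine ⟨_, Exec.iteFalse hc (Exec.skip s), ?_⟩
      simp only [Test.cost]
      omega
  | loop c e p hp =>
    have h' := h
    simp only [Admissible, Bool.and_eq_true, Bool.not_eq_true'] at h
    obtain ⟨⟨⟨-, hpc⟩, -⟩, hadm⟩ := h
    have hSt : ∀ m, ∀ b ∈ S, (loopState p.run c s m).nat b = s.nat b := fun m b hb =>
      (frame_loopState c e p s m).nat b (writesNat_of_admissible h' hb)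
    have he : ∀ m, e.eval (loopState p.run c s m) = e.eval s := fun m =>
      NExpr.eval_congr fun b hb => hSt m b (reads_subset_of_admissible h' e List.mem_cons_self b hb)
    set T := p.time.eval K with hT
    -- the last `j` rounds
    have hwhile : ∀ j ≤ e.eval s, ∃ t, Exec (.while (.natLt (.var c) e)
        (.seq p.compile (.setNat c (.lit 0) (.add (.var c) (.lit 1)))))
        (loopState p.run c s (e.eval s - j)) t (loopState p.run c s (e.eval s)) ∧
        t ≤ j * (T + (e.cost + 10)) + (e.cost + 4) := by
      intro j
      induction j with
      | zero =>
        intro _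
        refine ⟨_, Exec.whileFalse ?_, ?_⟩
        · simp only [Test.Holds, NExpr.eval, Nat.sub_zero, he, loopState_counter, lt_irrefl,
            not_false_eq_true]
        · simp only [Test.cost, NExpr.cost]
          omega
      | succ j ih =>
        intro hj
        obtain ⟨t, ht, htK⟩ := ih (Nat.le_of_succ_le hj)
        set i := e.eval s - (j + 1) with hi
        have hi1 : e.eval s - j = i + 1 := by omega
        obtain ⟨t₀, ht₀, htK₀⟩ := hp hadm (loopState p.run c s i)
          (bounds_le_of_admissible hadm (hSt i) fun e' he' => hK e' (List.mem_cons_of_mem _ he'))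
        have hcnt : (p.run (loopState p.run c s i)).nat c 0 = i := by
          rw [run_nat hpc, loopState_counter]
        have hset : Exec (.setNat c (.lit 0) (.add (.var c) (.lit 1)))
            (p.run (loopState p.run c s i)) 6 (loopState p.run c s (i + 1)) := by
          have := Exec.setNat (p.run (loopState p.run c s i)) c (.lit 0) (.add (.var c) (.lit 1))
          simp only [NExpr.eval, hcnt, NExpr.cost] at this
          exact this
        rw [hi1] at ht
        refine ⟨_, Exec.whileTrue ?_ (Exec.seq ht₀ hset) ht, ?_⟩
        · simp only [Test.Holds, NExpr.eval, he, loopState_counter]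
          omega
        · simp only [Test.cost, NExpr.cost]
          rw [Nat.succ_mul]
          omega
    obtain ⟨t, ht, htK⟩ := hwhile _ le_rfl
    rw [Nat.sub_self] at ht
    refine ⟨_, Exec.seq (Exec.setNat s c (.lit 0) (.lit 0)) ht, ?_⟩
    have hle : e.eval s * (T + (e.cost + 10)) ≤ K * (T + (e.cost + 10)) :=
      Nat.mul_le_mul_right _ (hK e List.mem_cons_self)
    simp only [time, Polynomial.eval_add, Polynomial.eval_mul, Polynomial.eval_X,
      Polynomial.eval_C, NExpr.cost, ← hT]
    omega

end Cmd

end RealRAM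

/-! ### Computing the diameter of the factor graph -/

namespace RealRAM

/-- `k * e`, as a repeated addition. -/
def NExpr.smul (e : NExpr) : ℕ → NExpr
  | 0 => .lit 0
  | k + 1 => .add (e.smul k) e

lemma NExpr.eval_smul (e : NExpr) (k : ℕ) (s : State) : (e.smul k).eval s = k * e.eval s := by
  induction k with
  | zero => simp [smul, eval]
  | succ k ih => rw [smul, eval, ih, Nat.succ_mul]

/-- The maximum, by means of truncated subtraction. -/
def NExpr.max (e f : NExpr) : NExpr := .add e (.sub f e)

lemma NExpr.eval_max (e f : NExpr) (s : State) :
    (e.max f).eval s = Max.max (e.eval s) (f.eval s) := by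
  simp only [NExpr.max, eval]
  omega

end RealRAM

namespace KSat

open RealRAM

variable {k N M : ℕ}

/-- The number of variables. -/
def numVars : NExpr := .get 0 (.lit 0)

/-- The number of clauses. -/
def numClauses : NExpr := .get 0 (.lit 1)

/-- The number of nodes of the factor graph. -/
def numNodes : NExpr := .add numVars numClauses

/-- The address `k * a + j` that belongs to the edge `(a, j)`, for counters `a` and `j` in the banks
`ca` and `cj`. -/
def edgeAddr (k ca cj : ℕ) : NExpr := .add ((NExpr.var ca).smul k) (.var cj)

/-- A loop over all edges, with the clause in bank `ca` and the position in bank `cj`. -/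
def edgeLoop (k ca cj : ℕ) (p : Cmd) : Cmd := .loop ca numClauses (.loop cj (.lit k) p)

/-- The state contains the formula `F` in the places of the input. -/
structure Stores (F : Formula k N M) (s : State) : Prop where
  vars : s.nat 0 0 = N
  clauses : s.nat 0 1 = M
  var : ∀ (a : Fin M) (j : Fin k), s.nat 1 (k * a + j) = F.var a j
  sign : ∀ (a : Fin M) (j : Fin k), s.nat 2 (k * a + j) = (F.sign a j).toNat

lemma Stores.of_frame {F : Formula k N M} {s s' : State} (h : Stores F s) {p : Cmd}
    (hs : p.Frame s s') (h0 : p.writesNat 0 = false) (h1 : p.writesNat 1 = false)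
    (h2 : p.writesNat 2 = false) : Stores F s' := by
  constructor
  · rw [hs.nat 0 h0, h.vars]
  · rw [hs.nat 0 h0, h.clauses]
  · rw [hs.nat 1 h1]; exact h.var
  · rw [hs.nat 2 h2]; exact h.sign

lemma edge_lt (a : Fin M) (j : Fin k) : k * a + j < M * k := by
  have h1 : k * (a + 1) ≤ k * M := Nat.mul_le_mul_left k a.2
  have := j.2
  rw [Nat.mul_succ] at h1
  rw [mul_comm M]
  omega

lemma edge_addr_inj {a a' j j' : ℕ} (hj : j < k) (hj' : j' < k) (h : k * a + j = k * a' + j') :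
    a = a' ∧ j = j' := by
  have h1 := congrArg (· / k) h
  simp only [Nat.mul_add_div (by omega : 0 < k), Nat.div_eq_of_lt hj, Nat.div_eq_of_lt hj',
    add_zero] at h1
  subst h1
  exact ⟨rfl, by omega⟩

lemma stores_inputState (β : ℝ) (F : Formula k N M) : Stores F (inputState β F) := by
  have hdiv : ∀ (a : Fin M) (j : Fin k), (⟨k * a + j, edge_lt a j⟩ : Fin (M * k)).divNat = a := by
    intro a j
    ext
    simp only [Fin.coe_divNat]
    rw [Nat.mul_add_div (by have := j.2; omega), Nat.div_eq_of_lt j.2, add_zero]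
  have hmod : ∀ (a : Fin M) (j : Fin k), (⟨k * a + j, edge_lt a j⟩ : Fin (M * k)).modNat = j := by
    intro a j
    ext
    simp only [Fin.coe_modNat]
    rw [Nat.mul_add_mod, Nat.mod_eq_of_lt j.2]
  constructor
  · simp [inputState]
  · simp [inputState]
  · intro a j
    simp [inputState, edge_lt a j, hdiv, hmod]
  · intro a j
    simp [inputState, edge_lt a j, hdiv, hmod]

end KSat

namespace RealRAM.Cmd

lemma Frame.trans {p : Cmd} {s s' s'' : State} (h : Frame p s s') (h' : Frame p s' s'') :
    Frame p s s'' :=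
  ⟨fun b hb => (h'.nat b hb).trans (h.nat b hb), fun b hb => (h'.real b hb).trans (h.real b hb)⟩

lemma Frame.mono {p q : Cmd} {s s' : State} (h : Frame p s s')
    (hn : ∀ b, q.writesNat b = false → p.writesNat b = false)
    (hr : ∀ b, q.writesReal b = false → p.writesReal b = false) : Frame q s s' :=
  ⟨fun b hb => h.nat b (hn b hb), fun b hb => h.real b (hr b hb)⟩

lemma Frame.loop {c : ℕ} {e : NExpr} {p : Cmd} {s s' s'' : State}
    (h : Frame (.loop c e p) s s') (h' : Frame p s' s'') : Frame (.loop c e p) s s'' :=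
  h.trans (h'.mono (fun b hb => by
    simp only [writesNat, Bool.or_eq_false_iff] at hb
    exact hb.2) fun b hb => hb)

lemma Frame.seq_left {p q : Cmd} {s s' : State} (h : Frame p s s') : Frame (.seq p q) s s' :=
  h.mono (fun b hb => by simp only [writesNat, Bool.or_eq_false_iff] at hb; exact hb.1)
    fun b hb => by simp only [writesReal, Bool.or_eq_false_iff] at hb; exact hb.1

end RealRAM.Cmd

namespace KSat

open RealRAM

variable {k N M : ℕ}

/-- Induction over the edges, in the order of their addresses, for a property of a bank of real
numbers. -/
lemma run_edgeLoop_real (r : ℕ) {ca cj : ℕ} {p : Cmd} {s : State}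
    (hs : s.nat 0 1 = M) (hcj : cj ≠ ca) (hp : p.writesNat ca = false)
    (P : ℕ → (ℕ → ℝ) → Prop) (h0 : P 0 (s.real r))
    (hstep : ∀ (a : Fin M) (j : Fin k) (s' : State), (edgeLoop k ca cj p).Frame s s' →
      s'.nat ca 0 = a → s'.nat cj 0 = j → P (k * a + j) (s'.real r) →
      P (k * a + j + 1) ((p.run s').real r)) :
    P (k * M) (((edgeLoop k ca cj p).run s).real r) := by
  have hb : numClauses.eval s = M := hs
  have := Cmd.run_loop_real r (c := ca) (e := numClauses) (p := .loop cj (.lit k) p) (s := s)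
    (fun i f => P (k * i) f) h0 fun a ha s' hf hca hP => by
      rw [hb] at ha
      have h2 := Cmd.run_loop_real r (c := cj) (e := .lit k) (p := p) (s := s')
        (fun i f => P (k * a + i) f) hP fun j hj s'' hf' hcj' hP' => by
          refine hstep ⟨a, ha⟩ ⟨j, hj⟩ s'' (hf.loop hf') ?_ hcj' hP'
          rw [hf'.nat ca (by simp [Cmd.writesNat, hp, hcj.symm]), hca]
      exact h2
  rwa [hb] at this

/-- Induction over the edges, in the order of their addresses, for a property of a bank of natural
numbers. -/
lemma run_edgeLoop_nat (r : ℕ) {ca cj : ℕ} {p : Cmd} {s : State}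
    (hs : s.nat 0 1 = M) (hcj : cj ≠ ca) (hp : p.writesNat ca = false) (hra : r ≠ ca)
    (hrj : r ≠ cj) (P : ℕ → (ℕ → ℕ) → Prop) (h0 : P 0 (s.nat r))
    (hstep : ∀ (a : Fin M) (j : Fin k) (s' : State), (edgeLoop k ca cj p).Frame s s' →
      s'.nat ca 0 = a → s'.nat cj 0 = j → P (k * a + j) (s'.nat r) →
      P (k * a + j + 1) ((p.run s').nat r)) :
    P (k * M) (((edgeLoop k ca cj p).run s).nat r) := by
  have hb : numClauses.eval s = M := hs
  have := Cmd.run_loop_nat r (c := ca) (e := numClauses) (p := .loop cj (.lit k) p) (s := s) hra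
    (fun i f => P (k * i) f) h0 fun a ha s' hf hca hP => by
      rw [hb] at ha
      have h2 := Cmd.run_loop_nat r (c := cj) (e := .lit k) (p := p) (s := s') hrj
        (fun i f => P (k * a + i) f) hP fun j hj s'' hf' hcj' hP' => by
          refine hstep ⟨a, ha⟩ ⟨j, hj⟩ s'' (hf.loop hf') ?_ hcj' hP'
          rw [hf'.nat ca (by simp [Cmd.writesNat, hp, hcj.symm]), hca]
      exact h2
  rwa [hb] at this

/-- The address of a node of the factor graph. -/
def nodeAddr : Fin N ⊕ Fin M → ℕ
  | .inl i => i
  | .inr a => N + a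

lemma nodeAddr_injective : Function.Injective (nodeAddr : Fin N ⊕ Fin M → ℕ) := by
  rintro (i | a) (j | b) h <;> simp only [nodeAddr] at h
  · rw [Fin.ext h]
  · have := i.2; omega
  · have := j.2; omega
  · rw [Fin.ext (by omega : (a : ℕ) = b)]

lemma exists_nodeAddr {i : ℕ} (hi : i < N + M) : ∃ v : Fin N ⊕ Fin M, nodeAddr v = i := by
  by_cases h : i < N
  · exact ⟨.inl ⟨i, h⟩, rfl⟩
  · exact ⟨.inr ⟨i - N, by omega⟩, by simp only [nodeAddr]; omega⟩

lemma nodeAddr_lt (v : Fin N ⊕ Fin M) : nodeAddr v < N + M := by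
  rcases v with i | a <;> simp only [nodeAddr]
  · have := i.2; omega
  · have := a.2; omega

open Classical in
/-- The number of nodes minus the distance from `u`; this is positive on the connected component of
`u`, and `0` on the other nodes. -/
noncomputable def proximity (F : Formula k N M) (u v : Fin N ⊕ Fin M) : ℕ :=
  if (factorGraph F).Reachable u v then N + M - (factorGraph F).dist u v else 0

lemma dist_lt_nodes {F : Formula k N M} {u v : Fin N ⊕ Fin M} (h : (factorGraph F).Reachable u v) :
    (factorGraph F).dist u v < N + M := by
  obtain ⟨p, hp, hd⟩ := h.exists_path_of_dist
  have := hp.length_lt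
  rw [hd] at this
  simpa using this

lemma proximity_self (F : Formula k N M) (u : Fin N ⊕ Fin M) : proximity F u u = N + M := by
  rw [proximity, if_pos (SimpleGraph.Reachable.refl u), SimpleGraph.dist_self, Nat.sub_zero]

lemma proximity_adj {F : Formula k N M} {u v w : Fin N ⊕ Fin M} (h : (factorGraph F).Adj v w) :
    proximity F u v - 1 ≤ proximity F u w := by
  by_cases hv : (factorGraph F).Reachable u v
  · have hw : (factorGraph F).Reachable u w := hv.trans h.reachable
    rw [proximity, proximity, if_pos hv, if_pos hw]
    have h1 : (factorGraph F).dist u w ≤ (factorGraph F).dist u v + 1 := by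
      obtain ⟨p, hp⟩ := hv.exists_walk_length_eq_dist
      rw [← hp]
      have := SimpleGraph.dist_le (p.concat h)
      rwa [SimpleGraph.Walk.length_concat] at this
    omega
  · rw [proximity, if_neg hv]
    exact Nat.zero_le _

lemma exists_adj_of_dist_eq_succ {F : Formula k N M} {u v : Fin N ⊕ Fin M} {t : ℕ}
    (h : (factorGraph F).Reachable u v) (hd : (factorGraph F).dist u v = t + 1) :
    ∃ w, (factorGraph F).Adj w v ∧ (factorGraph F).Reachable u w ∧
      (factorGraph F).dist u w ≤ t := by
  obtain ⟨p, hp⟩ := h.exists_walk_length_eq_dist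
  rw [hd] at hp
  have hnil : ¬ p.Nil := by
    intro hn
    rw [SimpleGraph.Walk.length_eq_zero_iff.2 hn] at hp
    omega
  refine ⟨p.penultimate, p.adj_penultimate hnil, p.dropLast.reachable, ?_⟩
  refine (SimpleGraph.dist_le p.dropLast).trans ?_
  rw [SimpleGraph.Walk.length_dropLast, hp, Nat.add_sub_cancel]

/-- The relaxation of an edge: the values at both ends are raised to at least the value at the other
end minus one. -/
def relaxCmd (k : ℕ) : Cmd :=
  .seq
    (.setNat 10 (.get 1 (edgeAddr k 6 7)) (.max (.get 10 (.get 1 (edgeAddr k 6 7)))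
      (.sub (.get 10 (.add numVars (.var 6))) (.lit 1))))
    (.setNat 10 (.add numVars (.var 6)) (.max (.get 10 (.add numVars (.var 6)))
      (.sub (.get 10 (.get 1 (edgeAddr k 6 7))) (.lit 1))))

/-- The relaxation of all edges. -/
def roundCmd (k : ℕ) : Cmd := edgeLoop k 6 7 (relaxCmd k)

/-- If the values are below the proximities everywhere, and equal to them up to distance `t`, then
after one round they are equal to them up to distance `t + 1`. The order of the relaxations is
irrelevant, as each of them only raises values and keeps them below the proximities. -/
lemma run_roundCmd {F : Formula k N M} {u : Fin N ⊕ Fin M} {t : ℕ} {s : State} (hs : Stores F s)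
    (hsound : ∀ v, s.nat 10 (nodeAddr v) ≤ proximity F u v)
    (hlow : ∀ v, (factorGraph F).dist u v ≤ t → proximity F u v ≤ s.nat 10 (nodeAddr v)) :
    (∀ v, ((roundCmd k).run s).nat 10 (nodeAddr v) ≤ proximity F u v) ∧
      ∀ v, (factorGraph F).dist u v ≤ t + 1 →
        proximity F u v ≤ ((roundCmd k).run s).nat 10 (nodeAddr v) := by
  set ω₀ := s.nat 10 with hω₀
  obtain ⟨h1, h2, h3⟩ := run_edgeLoop_nat 10 (ca := 6) (cj := 7) (k := k) (p := relaxCmd k)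
    (s := s) hs.clauses (by norm_num) rfl (by norm_num) (by norm_num)
    (fun n ω => (∀ v : Fin N ⊕ Fin M, ω (nodeAddr v) ≤ proximity F u v) ∧
      (∀ v : Fin N ⊕ Fin M, ω₀ (nodeAddr v) ≤ ω (nodeAddr v)) ∧
      ∀ (a : Fin M) (j : Fin k), k * a + j < n →
        ω₀ (N + a) - 1 ≤ ω (F.var a j) ∧ ω₀ (F.var a j) - 1 ≤ ω (N + a))
    ⟨hsound, fun _ => le_rfl, fun a j h => absurd h (Nat.not_lt_zero _)⟩ (by
      intro a j s' hf ha hj ⟨hP1, hP2, hP3⟩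
      have hs' : Stores F s' := hs.of_frame hf rfl rfl rfl
      set ω := s'.nat 10 with hω
      have hxy : (F.var a j : ℕ) ≠ N + a := by have := (F.var a j).2; omega
      have hadj : (factorGraph F).Adj (.inl (F.var a j)) (.inr a) := factorGraph_adj.2 ⟨j, rfl⟩
      simp only [relaxCmd, Cmd.run, NExpr.eval, NExpr.eval_max, NExpr.eval_smul, edgeAddr, numVars,
        State.writeNat_nat_self, State.writeNat_nat_of_ne _ (show (0 : ℕ) ≠ 10 by norm_num),
        State.writeNat_nat_of_ne _ (show (1 : ℕ) ≠ 10 by norm_num),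
        State.writeNat_nat_of_ne _ (show (6 : ℕ) ≠ 10 by norm_num),
        State.writeNat_nat_of_ne _ (show (7 : ℕ) ≠ 10 by norm_num), hs'.vars, hs'.var, ha, hj, ← hω]
      set ω₁ := Function.update ω (F.var a j) (max (ω (F.var a j)) (ω (N + a) - 1)) with hω₁
      have e1 : ω₁ (F.var a j) = max (ω (F.var a j)) (ω (N + a) - 1) := Function.update_self _ _ _
      have e2 : ω₁ (N + a) = ω (N + a) := Function.update_of_ne hxy.symm _ _
      set ω₂ := Function.update ω₁ (N + a) (max (ω₁ (N + a)) (ω₁ (F.var a j) - 1)) with hω₂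
      have e3 : ω₂ (N + a) = max (ω₁ (N + a)) (ω₁ (F.var a j) - 1) := Function.update_self _ _ _
      have e4 : ω₂ (F.var a j) = ω₁ (F.var a j) := Function.update_of_ne hxy _ _
      have e5 : ∀ n, n ≠ (F.var a j : ℕ) → n ≠ N + a → ω₂ n = ω n := fun n h h' => by
        rw [hω₂, Function.update_of_ne h', hω₁, Function.update_of_ne h]
      have hmono : ∀ n, ω n ≤ ω₂ n := by
        intro n
        by_cases h : n = F.var a j
        · rw [h, e4, e1]; exact le_max_left _ _
        by_cases h' : n = N + a
        · rw [h', e3, e2]; exact le_max_left _ _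
        rw [e5 n h h']
      have p1 := hP1 (.inl (F.var a j))
      have p2 := hP1 (.inr a)
      have p3 := proximity_adj (u := u) hadj
      have p4 := proximity_adj (u := u) hadj.symm
      have q1 := hP2 (.inl (F.var a j))
      have q2 := hP2 (.inr a)
      simp only [nodeAddr] at p1 p2 q1 q2
      refine ⟨?_, fun v => (hP2 v).trans (hmono _), ?_⟩
      · intro v
        by_cases h : v = .inl (F.var a j)
        · rw [h]; simp only [nodeAddr]; rw [e4, e1]; omega
        by_cases h' : v = .inr a
        · rw [h']; simp only [nodeAddr]; rw [e3, e2, e1]; omega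
        rw [e5 _ (fun hv => h (nodeAddr_injective (hv.trans rfl)))
          (fun hv => h' (nodeAddr_injective (hv.trans rfl)))]
        exact hP1 v
      · intro a' j' hlt
        rcases Nat.lt_succ_iff_lt_or_eq.1 hlt with h | h
        · obtain ⟨r1, r2⟩ := hP3 a' j' h
          exact ⟨r1.trans (hmono _), r2.trans (hmono _)⟩
        · obtain ⟨ha', hj'⟩ := edge_addr_inj j'.2 j.2 h
          rw [Fin.ext ha', Fin.ext hj', e4, e3, e2, e1]
          omega)
  refine ⟨h1, fun v hv => ?_⟩
  rcases Nat.lt_or_ge t ((factorGraph F).dist u v) with h | h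
  swap
  · exact (hlow v h).trans (h2 v)
  by_cases hr : (factorGraph F).Reachable u v
  swap
  · rw [proximity, if_neg hr]; exact Nat.zero_le _
  have hd : (factorGraph F).dist u v = t + 1 := le_antisymm hv h
  obtain ⟨w, hadj, hrw, hdw⟩ := exists_adj_of_dist_eq_succ hr hd
  have hw : N + M - t ≤ ω₀ (nodeAddr w) := by
    refine le_trans ?_ (hlow w hdw)
    rw [proximity, if_pos hrw]
    omega
  rw [proximity, if_pos hr, hd]
  have hall : ∀ (a : Fin M) (j : Fin k), k * a + j < k * M := fun a j => by
    rw [mul_comm k M]; exact edge_lt a j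
  change _ ≤ ((edgeLoop k 6 7 (relaxCmd k)).run s).nat 10 (nodeAddr v)
  rcases v with i | a <;> rcases w with i' | a'
  · exact absurd hadj factorGraph_not_adj_inl
  · obtain ⟨j, hj⟩ := factorGraph_adj.1 hadj.symm
    have := (h3 a' j (hall a' j)).1
    rw [hj] at this
    simp only [nodeAddr] at hw ⊢
    omega
  · obtain ⟨j, hj⟩ := factorGraph_adj.1 hadj
    have := (h3 a j (hall a j)).2
    rw [hj] at this
    simp only [nodeAddr] at hw ⊢
    omega
  · exact absurd hadj factorGraph_not_adj_inr

/-- The proximities to the node in bank `12`, in bank `10`. -/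
def distancesCmd (k : ℕ) : Cmd :=
  .seq (.loop 14 numNodes (.setNat 10 (.var 14) (.lit 0)))
    (.seq (.setNat 10 (.var 12) numNodes) (.loop 13 numNodes (roundCmd k)))

lemma Stores.eval_numNodes {F : Formula k N M} {s : State} (hs : Stores F s) :
    numNodes.eval s = N + M := by
  simp only [numNodes, numVars, numClauses, NExpr.eval, hs.vars, hs.clauses]

lemma run_distancesCmd {F : Formula k N M} {u : Fin N ⊕ Fin M} {s : State} (hs : Stores F s)
    (hu : s.nat 12 0 = nodeAddr u) (v : Fin N ⊕ Fin M) :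
    ((distancesCmd k).run s).nat 10 (nodeAddr v) = proximity F u v := by
  set p₁ : Cmd := .loop 14 numNodes (.setNat 10 (.var 14) (.lit 0)) with hp₁
  set s₁ := p₁.run s with hs₁
  have hf₁ : p₁.Frame s s₁ := p₁.frame_run s
  have h1 : ∀ n < N + M, s₁.nat 10 n = 0 := by
    have := Cmd.run_loop_nat 10 (c := 14) (e := numNodes)
      (p := .setNat 10 (.var 14) (.lit 0)) (s := s) (by norm_num) (fun i ω => ∀ n < i, ω n = 0)
      (fun n hn => absurd hn (Nat.not_lt_zero n)) (by
        intro i _ s' _ hc hP n hn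
        simp only [Cmd.run, NExpr.eval, hc, State.writeNat_nat_self]
        by_cases h : n = i
        · rw [h, Function.update_self]
        · rw [Function.update_of_ne h]
          exact hP n (by omega))
    rwa [hs.eval_numNodes] at this
  have hst₁ : Stores F s₁ := hs.of_frame hf₁ rfl rfl rfl
  set p₂ : Cmd := .setNat 10 (.var 12) numNodes with hp₂
  set s₂ := p₂.run s₁ with hs₂
  have hst₂ : Stores F s₂ := hst₁.of_frame (p₂.frame_run s₁) rfl rfl rfl
  have h2 : s₂.nat 10 = Function.update (s₁.nat 10) (nodeAddr u) (N + M) := by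
    rw [hs₂, hp₂]
    simp only [Cmd.run, State.writeNat_nat_self, NExpr.eval]
    rw [hst₁.eval_numNodes, hf₁.nat 12 rfl, hu]
  have h3 := Cmd.run_loop_nat 10 (c := 13) (e := numNodes) (p := roundCmd k) (s := s₂)
    (by norm_num) (fun t ω => (∀ v : Fin N ⊕ Fin M, ω (nodeAddr v) ≤ proximity F u v) ∧
      ∀ v : Fin N ⊕ Fin M, (factorGraph F).dist u v ≤ t → proximity F u v ≤ ω (nodeAddr v))
    (by
      rw [h2]
      refine ⟨fun v => ?_, fun v hv => ?_⟩
      · by_cases h : v = u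
        · rw [h, Function.update_self, proximity_self]
        · rw [Function.update_of_ne fun h' => h (nodeAddr_injective h'), h1 _ (nodeAddr_lt v)]
          exact Nat.zero_le _
      · by_cases hr : (factorGraph F).Reachable u v
        · have h : u = v := (hr.dist_eq_zero_iff).1 (by omega)
          rw [← h, Function.update_self, proximity_self]
        · rw [proximity, if_neg hr]
          exact Nat.zero_le _)
    (by
      intro t _ s' hf _ ⟨hP1, hP2⟩
      exact run_roundCmd (hst₂.of_frame hf rfl rfl rfl) hP1 hP2)
  rw [hst₂.eval_numNodes] at h3
  have h4 : (distancesCmd k).run s = (Cmd.loop 13 numNodes (roundCmd k)).run s₂ := rfl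
  rw [h4]
  refine le_antisymm (h3.1 v) ?_
  by_cases hr : (factorGraph F).Reachable u v
  · exact h3.2 v (dist_lt_nodes hr).le
  · rw [proximity, if_neg hr]
    exact Nat.zero_le _

/-- The computation of the diameter of the factor graph, in bank `11`: for every node in bank `12`,
the maximum over the nodes of positive proximity to it. -/
def diameterCmd (k : ℕ) : Cmd :=
  .seq (.setNat 11 (.lit 0) (.lit 0))
    (.loop 12 numNodes (.seq (distancesCmd k)
      (.loop 14 numNodes (.when (.lit 0) (.get 10 (.var 14))
        (.setNat 11 (.lit 0) (.max (.get 11 (.lit 0)) (.sub numNodes (.get 10 (.var 14)))))))))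

lemma run_diameterCmd {F : Formula k N M} {s : State} (hs : Stores F s) :
    ((diameterCmd k).run s).nat 11 0 = diameter F := by
  set p₀ : Cmd := .setNat 11 (.lit 0) (.lit 0) with hp₀
  have hs₀ : Stores F (p₀.run s) := hs.of_frame (p₀.frame_run s) rfl rfl rfl
  have h := Cmd.run_loop_nat 11 (c := 12) (e := numNodes) (p := .seq (distancesCmd k)
      (.loop 14 numNodes (.when (.lit 0) (.get 10 (.var 14))
        (.setNat 11 (.lit 0) (.max (.get 11 (.lit 0)) (.sub numNodes (.get 10 (.var 14))))))))
    (s := p₀.run s) (by norm_num)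
    (fun i f => (∀ u v : Fin N ⊕ Fin M, nodeAddr u < i → (factorGraph F).dist u v ≤ f 0) ∧
      f 0 ≤ diameter F)
    (by
      refine ⟨fun u v h => absurd h (Nat.not_lt_zero _), ?_⟩
      simp [hp₀, Cmd.run, NExpr.eval, State.writeNat_nat_self])
    (by
      intro i hi s' hf hc ⟨hP1, hP2⟩
      have hs' : Stores F s' := hs₀.of_frame hf rfl rfl rfl
      rw [hs₀.eval_numNodes] at hi
      obtain ⟨u, rfl⟩ := exists_nodeAddr hi
      have hprox := run_distancesCmd hs' hc
      set s₁ := (distancesCmd k).run s' with hs₁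
      have hf₁ : (distancesCmd k).Frame s' s₁ := Cmd.frame_run _ _
      have hst₁ : Stores F s₁ := hs'.of_frame hf₁ rfl rfl rfl
      have h11 : s₁.nat 11 = s'.nat 11 := hf₁.nat 11 rfl
      have h := Cmd.run_loop_nat 11 (c := 14) (e := numNodes) (p := .when (.lit 0)
          (.get 10 (.var 14)) (.setNat 11 (.lit 0) (.max (.get 11 (.lit 0))
            (.sub numNodes (.get 10 (.var 14)))))) (s := s₁) (by norm_num)
        (fun i f => (∀ v : Fin N ⊕ Fin M, nodeAddr v < i → (factorGraph F).dist u v ≤ f 0) ∧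
          s'.nat 11 0 ≤ f 0 ∧ f 0 ≤ diameter F)
        ⟨fun v h => absurd h (Nat.not_lt_zero _), by rw [h11], by rw [h11]; exact hP2⟩
        (by
          intro i hi s₂ hf₂ hc₂ ⟨hQ1, hQ2, hQ3⟩
          have hst₂ : Stores F s₂ := hst₁.of_frame hf₂ rfl rfl rfl
          rw [hst₁.eval_numNodes] at hi
          obtain ⟨v, rfl⟩ := exists_nodeAddr hi
          have hv : s₂.nat 10 (nodeAddr v) = proximity F u v := by
            rw [hf₂.nat 10 rfl, hprox]
          have hw : ∀ w : Fin N ⊕ Fin M, nodeAddr w < nodeAddr v + 1 →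
              nodeAddr w < nodeAddr v ∨ w = v := fun w hw =>
            (Nat.lt_succ_iff_lt_or_eq.1 hw).imp_right fun h => nodeAddr_injective h
          simp only [Cmd.run, NExpr.eval, NExpr.eval_max, hst₂.eval_numNodes, hc₂, hv]
          split_ifs with hpos
          · have hr : (factorGraph F).Reachable u v := by
              by_contra hr
              rw [proximity, if_neg hr] at hpos
              exact lt_irrefl _ hpos
            have hd : N + M - proximity F u v = (factorGraph F).dist u v := by
              rw [proximity, if_pos hr]
              have := dist_lt_nodes hr
              omega
            rw [hd, State.writeNat_nat_self, Function.update_self]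
            refine ⟨fun w hlt => ?_, hQ2.trans (le_max_left _ _),
              max_le hQ3 (dist_le_diameter F u v)⟩
            rcases hw w hlt with h | rfl
            · exact (hQ1 w h).trans (le_max_left _ _)
            · exact le_max_right _ _
          · refine ⟨fun w hlt => ?_, hQ2, hQ3⟩
            rcases hw w hlt with h | rfl
            · exact hQ1 w h
            · have hr : ¬ (factorGraph F).Reachable u w := by
                intro hr
                refine hpos ?_
                rw [proximity, if_pos hr]
                have := dist_lt_nodes hr
                omega
              rw [SimpleGraph.dist_eq_zero_of_not_reachable hr]
              exact Nat.zero_le _)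
      rw [hst₁.eval_numNodes] at h
      refine ⟨fun w v hw => ?_, h.2.2⟩
      rcases Nat.lt_succ_iff_lt_or_eq.1 hw with h' | h'
      · exact (hP1 w v h').trans h.2.1
      · rw [nodeAddr_injective h']
        exact h.1 v (nodeAddr_lt v))
  rw [hs₀.eval_numNodes] at h
  refine le_antisymm h.2 ?_
  exact Finset.sup_le fun p _ => h.1 p.1 p.2 (nodeAddr_lt p.1)

lemma diameter_le (F : Formula k N M) : diameter F ≤ N + M := by
  refine Finset.sup_le fun p _ => ?_
  by_cases hr : (factorGraph F).Reachable p.1 p.2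
  · exact (dist_lt_nodes hr).le
  · rw [SimpleGraph.dist_eq_zero_of_not_reachable hr]
    exact Nat.zero_le _

end KSat

/-! ### Sums, products and arrays -/

namespace RealRAM

/-- The indicator of equality, by means of truncated subtraction. -/
def NExpr.eqInd (e f : NExpr) : NExpr := .sub (.lit 1) (.add (.sub e f) (.sub f e))

lemma NExpr.eval_eqInd (e f : NExpr) (s : State) :
    (e.eqInd f).eval s = if e.eval s = f.eval s then 1 else 0 := by
  simp only [eqInd, eval]
  split_ifs <;> omega

/-- A numeral. -/
abbrev RExpr.lit (n : ℕ) : RExpr := .ofNat (.lit n)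

/-- The number at address `0` of a bank. -/
abbrev RExpr.var (r : ℕ) : RExpr := .get r (.lit 0)

end RealRAM

namespace KSat

open RealRAM

variable {k N M : ℕ}

/-- The product of the values of `e`, for the counter `c` below `n`, at address `0` of bank `r`. -/
def prodCmd (r c n : ℕ) (e : RExpr) : Cmd :=
  .seq (.setReal r (.lit 0) (.lit 1)) (.loop c (.lit n) (.setReal r (.lit 0) (.mul (.var r) e)))

lemma run_prodCmd {r c n : ℕ} {e : RExpr} {s : State} {φ : ℕ → ℝ}
    (h : ∀ i < n, ∀ s', (prodCmd r c n e).Frame s s' → s'.nat c 0 = i → e.eval s' = φ i) :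
    ((prodCmd r c n e).run s).real r 0 = ∏ i ∈ range n, φ i := by
  set p₀ : Cmd := .setReal r (.lit 0) (.lit 1) with hp₀
  refine Cmd.run_loop_real r (c := c) (e := .lit n) (p := .setReal r (.lit 0) (.mul (.var r) e))
    (s := p₀.run s) (fun i f => f 0 = ∏ i ∈ range i, φ i) ?_ ?_
  · simp [hp₀, Cmd.run, State.writeReal_real_self, RExpr.eval, NExpr.eval]
  · intro i hi s' hf hc hP
    have hf' : (prodCmd r c n e).Frame s s' :=
      (p₀.frame_run s).seq_left.trans (hf.mono (fun b hb => by
        simp only [Cmd.writesNat, Bool.or_eq_false_iff] at hb ⊢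
        exact hb.2) fun b hb => by
        simp only [Cmd.writesReal, Bool.or_eq_false_iff] at hb ⊢
        exact hb.2)
    simp only [Cmd.run, NExpr.eval, RExpr.eval, State.writeReal_real_self, Function.update_self]
    rw [hP, h i hi s' hf' hc, prod_range_succ]

/-- The sum of the values of `e` over all edges, at address `0` of bank `r`. -/
def sumCmd (k r ca cj : ℕ) (e : RExpr) : Cmd :=
  .seq (.setReal r (.lit 0) (.lit 0))
    (edgeLoop k ca cj (.setReal r (.lit 0) (.add (.var r) e)))

lemma run_sumCmd {r ca cj : ℕ} {e : RExpr} {s : State} {φ : Fin M × Fin k → ℝ}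
    (hs : s.nat 0 1 = M) (hcj : cj ≠ ca)
    (h : ∀ (a : Fin M) (j : Fin k) (s' : State), (sumCmd k r ca cj e).Frame s s' →
      s'.nat ca 0 = a → s'.nat cj 0 = j → e.eval s' = φ (a, j)) :
    ((sumCmd k r ca cj e).run s).real r 0 = ∑ e, φ e := by
  set p₀ : Cmd := .setReal r (.lit 0) (.lit 0) with hp₀
  have h1 := run_edgeLoop_real (k := k) (M := M) r (ca := ca) (cj := cj)
    (p := .setReal r (.lit 0) (.add (.var r) e)) (s := p₀.run s) hs hcj rfl
    (fun n f => f 0 = ∑ e ∈ univ.filter fun e : Fin M × Fin k => k * (e.1 : ℕ) + e.2 < n, φ e)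
    (by simp [hp₀, Cmd.run, State.writeReal_real_self, RExpr.eval, NExpr.eval])
    (by
      intro a j s' hf ha hj hP
      have hf' : (sumCmd k r ca cj e).Frame s s' :=
        (p₀.frame_run s).seq_left.trans (hf.mono (fun b hb => by
          simp only [Cmd.writesNat, Bool.or_eq_false_iff] at hb ⊢
          exact hb.2) fun b hb => by
          simp only [Cmd.writesReal, Bool.or_eq_false_iff] at hb ⊢
          exact hb.2)
      have hfil : (univ.filter fun e : Fin M × Fin k => k * (e.1 : ℕ) + e.2 < k * a + j + 1) =
          insert (a, j) (univ.filter fun e : Fin M × Fin k => k * (e.1 : ℕ) + e.2 < k * a + j) := by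
        ext ⟨a', j'⟩
        simp only [mem_filter, mem_univ, true_and, mem_insert, Prod.mk.injEq]
        constructor
        · intro h'
          rcases Nat.lt_succ_iff_lt_or_eq.1 h' with h' | h'
          · exact Or.inr h'
          · obtain ⟨e1, e2⟩ := edge_addr_inj j'.2 j.2 h'
            exact Or.inl ⟨Fin.ext e1, Fin.ext e2⟩
        · rintro (⟨rfl, rfl⟩ | h')
          · exact Nat.lt_succ_self _
          · omega
      simp only [Cmd.run, NExpr.eval, RExpr.eval, State.writeReal_real_self, Function.update_self]
      rw [hfil, sum_insert (by simp), hP, h a j s' hf' ha hj, add_comm])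
  have huniv : (univ.filter fun e : Fin M × Fin k => k * (e.1 : ℕ) + e.2 < k * M) = univ := by
    refine filter_true_of_mem fun e _ => ?_
    rw [mul_comm k M]
    exact edge_lt e.1 e.2
  rwa [huniv] at h1

/-- For every edge, the value of `e` after the execution of `p` is stored in the array `r`. -/
def fillCmd (k r ca cj : ℕ) (p : Cmd) (e : RExpr) : Cmd :=
  edgeLoop k ca cj (.seq p (.setReal r (edgeAddr k ca cj) e))

lemma run_fillCmd {r ca cj : ℕ} {p : Cmd} {e : RExpr} {s : State} {φ : Messages k M}
    (hs : s.nat 0 1 = M) (hcj : cj ≠ ca) (hpa : p.writesNat ca = false)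
    (hpj : p.writesNat cj = false) (hpr : p.writesReal r = false)
    (h : ∀ (a : Fin M) (j : Fin k) (s' : State), (fillCmd k r ca cj p e).Frame s s' →
      s'.nat ca 0 = a → s'.nat cj 0 = j → e.eval (p.run s') = φ a j) (a : Fin M) (j : Fin k) :
    ((fillCmd k r ca cj p e).run s).real r (k * a + j) = φ a j := by
  refine run_edgeLoop_real (k := k) (M := M) r (ca := ca) (cj := cj)
    (p := .seq p (.setReal r (edgeAddr k ca cj) e)) (s := s) hs hcj (by
      simp [Cmd.writesNat, hpa])
    (fun n f => ∀ (a : Fin M) (j : Fin k), k * a + j < n → f (k * a + j) = φ a j)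
    (fun a j h => absurd h (Nat.not_lt_zero _)) ?_ a j (by rw [mul_comm k M]; exact edge_lt a j)
  intro a j s' hf ha hj hP a' j' hlt
  have haddr : (edgeAddr k ca cj).eval (p.run s') = k * a + j := by
    simp only [edgeAddr, NExpr.eval, NExpr.eval_smul]
    rw [Cmd.run_nat hpa, Cmd.run_nat hpj, ha, hj]
  simp only [Cmd.run, haddr, State.writeReal_real_self]
  rcases Nat.lt_succ_iff_lt_or_eq.1 hlt with h' | h'
  · rw [Function.update_of_ne h'.ne, Cmd.run_real hpr]
    exact hP a' j' h'
  · rw [h', Function.update_self, h a j s' hf ha hj]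
    obtain ⟨e1, e2⟩ := edge_addr_inj j'.2 j.2 h'
    rw [Fin.ext e1, Fin.ext e2]

/-! ### Computing the messages of belief propagation

Real banks: `0` holds the input `β` and finally the output, `1` the sum of the energies, `2` the
current inverse temperature, `3` and `4` the messages to and from the clauses, and `5` and `6` a sum
and a product in progress. Natural banks: `0`, `1` and `2` hold the formula, `3` to `9` are loop
counters, and `11` holds the diameter. -/

/-- The array contains the messages `h`. -/
def Encodes (f : ℕ → ℝ) (h : Messages k M) : Prop :=
  ∀ (a : Fin M) (j : Fin k), f (k * a + j) = h a j

/-- The value `unsat` of an expression. -/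
def unsatExpr (e : RExpr) : RExpr := .div (.lit 1) (.add (.lit 1) (.exp (.mul (.lit 2) e)))

lemma eval_unsatExpr (e : RExpr) (s : State) : (unsatExpr e).eval s = unsat (e.eval s) := by
  simp [unsatExpr, RExpr.eval, NExpr.eval, unsat]

/-- The factor of position `p` in the message from clause `a` to its variable at position `j`, with
`a`, `j` and `p` in the banks `6`, `7` and `9`. -/
def messageFactor (k : ℕ) : RExpr :=
  .add (.ofNat (.eqInd (.var 9) (.var 7)))
    (.mul (.sub (.lit 1) (.ofNat (.eqInd (.var 9) (.var 7)))) (unsatExpr (.get 3 (edgeAddr k 6 9))))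

/-- The messages from the clauses to the variables, in bank `4`, from those in the other direction,
in bank `3`. -/
def clauseMessageCmd (k : ℕ) : Cmd :=
  fillCmd k 4 6 7 (prodCmd 6 9 k (messageFactor k))
    (.mul (.sub (.lit 0) (.div (.lit 1) (.lit 2))) (.log (.sub (.lit 1)
      (.mul (.sub (.lit 1) (.exp (.sub (.lit 0) (.var 2)))) (.var 6)))))

lemma prod_range_eq_prod_fin {φ : ℕ → ℝ} {ψ : Fin k → ℝ} (h : ∀ i : Fin k, φ i = ψ i) :
    ∏ i ∈ range k, φ i = ∏ i, ψ i := by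
  rw [prod_range]
  exact prod_congr rfl fun i _ => h i

lemma run_clauseMessageCmd {F : Formula k N M} {s : State} (hs : Stores F s) {h : Messages k M}
    (hh : Encodes (s.real 3) h) :
    Encodes (((clauseMessageCmd k).run s).real 4) (clauseMessage (s.real 2 0) h) := by
  refine run_fillCmd hs.clauses (by norm_num) rfl rfl rfl fun a j s' hf ha hj => ?_
  have hprod : ((prodCmd 6 9 k (messageFactor k)).run s').real 6 0 =
      ∏ p ∈ univ.erase j, unsat (h a p) := by
    have hlt : ∀ i, i < k → s'.real 3 (k * a + i) = s.real 3 (k * a + i) := fun i _ => by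
      rw [hf.real 3 rfl]
    rw [run_prodCmd (φ := fun i => if i = j then 1 else unsat (s.real 3 (k * a + i)))]
    · rw [prod_range_eq_prod_fin (ψ := fun p => if p = j then 1 else unsat (h a p))]
      · rw [← mul_prod_erase univ _ (mem_univ j), if_pos rfl, one_mul]
        exact prod_congr rfl fun p hp => if_neg (ne_of_mem_erase hp)
      · intro i
        rw [hh a i]
        simp only [Fin.ext_iff]
    · intro i hi s'' hf' hc
      have h6 : s''.nat 6 0 = a := by rw [hf'.nat 6 rfl, ha]
      have h7 : s''.nat 7 0 = j := by rw [hf'.nat 7 rfl, hj]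
      have h3 : s''.real 3 = s.real 3 := by rw [hf'.real 3 rfl, hf.real 3 rfl]
      simp only [messageFactor, RExpr.eval, NExpr.eval, NExpr.eval_eqInd, eval_unsatExpr, edgeAddr,
        NExpr.eval_smul, h6, h7, hc, h3]
      split_ifs <;> simp
  have h2 : ((prodCmd 6 9 k (messageFactor k)).run s').real 2 = s.real 2 := by
    rw [Cmd.run_real rfl, hf.real 2 rfl]
  simp only [RExpr.eval, NExpr.eval, hprod, h2]
  rw [clauseMessage, messageFun_eq]
  norm_num

/-- The term of the edge `(b, p)`, in the banks `8` and `9`, in the message to clause `a` from its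
variable at position `j`, in the banks `6` and `7`. -/
def fieldTerm (k : ℕ) : RExpr :=
  .mul (.mul (.mul (.sub (.lit 1) (.ofNat (.eqInd (.var 8) (.var 6))))
    (.ofNat (.eqInd (.get 1 (edgeAddr k 8 9)) (.get 1 (edgeAddr k 6 7)))))
    (.sub (.mul (.lit 2) (.ofNat (.eqInd (.get 2 (edgeAddr k 8 9)) (.get 2 (edgeAddr k 6 7)))))
      (.lit 1))) (.get 4 (edgeAddr k 8 9))

/-- The messages from the variables to the clauses, from those in the other direction. -/
def fieldCmd (k : ℕ) : Cmd := fillCmd k 3 6 7 (sumCmd k 5 8 9 (fieldTerm k)) (.var 5)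

lemma run_fieldCmd {F : Formula k N M} {s : State} (hs : Stores F s) {u : Messages k M}
    (hu : Encodes (s.real 4) u) :
    Encodes (((fieldCmd k).run s).real 3) fun a j =>
      ∑ e ∈ agreeing F a j, u e.1 e.2 - ∑ e ∈ disagreeing F a j, u e.1 e.2 := by
  refine run_fillCmd hs.clauses (by norm_num) rfl rfl rfl fun a j s' hf ha hj => ?_
  have hs' : Stores F s' := hs.of_frame hf rfl rfl rfl
  change ((sumCmd k 5 8 9 (fieldTerm k)).run s').real 5 0 = _
  rw [agreeing, disagreeing, sum_filter, sum_filter, ← sum_sub_distrib]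
  refine run_sumCmd hs'.clauses (by norm_num) fun b p s'' hf' hb hp => ?_
  have hs'' : Stores F s'' := hs'.of_frame hf' rfl rfl rfl
  have h6 : s''.nat 6 0 = a := by rw [hf'.nat 6 rfl, ha]
  have h7 : s''.nat 7 0 = j := by rw [hf'.nat 7 rfl, hj]
  have h4 : s''.real 4 (k * b + p) = u b p := by rw [hf'.real 4 rfl, hf.real 4 rfl, hu]
  have hsign : (F.sign b p).toNat = (F.sign a j).toNat ↔ F.sign b p = F.sign a j := by
    cases F.sign b p <;> cases F.sign a j <;> simp
  simp only [fieldTerm, RExpr.eval, NExpr.eval, NExpr.eval_eqInd, edgeAddr, NExpr.eval_smul, h6, h7,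
    hb, hp, hs''.var, hs''.sign, h4, hsign, Fin.val_inj]
  by_cases e1 : b = a <;> by_cases e2 : F.var b p = F.var a j <;>
    by_cases e3 : F.sign b p = F.sign a j <;> (simp [e1, e2, e3]; try norm_num)

/-- The iterations of belief propagation; their number is in bank `11`. -/
def messagesCmd (k : ℕ) : Cmd :=
  .seq (fillCmd k 3 6 7 (.setReal 5 (.lit 0) (.lit 0)) (.lit 0))
    (.loop 5 (.var 11) (.seq (clauseMessageCmd k) (fieldCmd k)))

lemma run_messagesCmd {F : Formula k N M} {s : State} (hs : Stores F s)
    (hd : s.nat 11 0 = diameter F) :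
    Encodes (((messagesCmd k).run s).real 3) (bpMessages (s.real 2 0) F) := by
  set p₀ : Cmd := fillCmd k 3 6 7 (.setReal 5 (.lit 0) (.lit 0)) (.lit 0) with hp₀
  have hf₀ : p₀.Frame s (p₀.run s) := p₀.frame_run s
  have hs₀ : Stores F (p₀.run s) := hs.of_frame hf₀ rfl rfl rfl
  have h0 : Encodes ((p₀.run s).real 3) (0 : Messages k M) := by
    refine run_fillCmd hs.clauses (by norm_num) rfl rfl rfl fun a j s' _ _ _ => ?_
    simp [RExpr.eval, NExpr.eval]
  have h := Cmd.run_loop_real 3 (c := 5) (e := .var 11)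
    (p := .seq (clauseMessageCmd k) (fieldCmd k)) (s := p₀.run s)
    (fun t f => Encodes f ((bpStep (s.real 2 0) F)^[t] 0)) h0 (by
      intro t _ s' hf _ hP
      have hs' : Stores F s' := hs₀.of_frame hf rfl rfl rfl
      have h2 : s'.real 2 = s.real 2 := by rw [hf.real 2 rfl, hf₀.real 2 rfl]
      have h3 := run_clauseMessageCmd hs' hP
      rw [h2] at h3
      have h4 := run_fieldCmd (hs'.of_frame ((clauseMessageCmd k).frame_run s') rfl rfl rfl) h3
      rw [Function.iterate_succ_apply']
      exact h4)
  have he : (NExpr.var 11).eval (p₀.run s) = diameter F := by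
    rw [← hd]
    exact congrFun (hf₀.nat 11 rfl) 0
  rw [he] at h
  exact h

/-- The sum of the energies of the clauses is added to the number in bank `1`. -/
def energyCmd (k : ℕ) : Cmd :=
  .loop 6 numClauses (.seq (prodCmd 6 9 k (unsatExpr (.get 3 (edgeAddr k 6 9))))
    (.setReal 1 (.lit 0) (.add (.var 1) (.div (.mul (.exp (.sub (.lit 0) (.var 2))) (.var 6))
      (.sub (.lit 1) (.mul (.sub (.lit 1) (.exp (.sub (.lit 0) (.var 2)))) (.var 6)))))))

lemma run_energyCmd {F : Formula k N M} {s : State} (hs : Stores F s) {b : ℝ}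
    (hb : s.real 2 0 = b) (hh : Encodes (s.real 3) (bpMessages b F)) :
    ((energyCmd k).run s).real 1 0 = s.real 1 0 + bpEnergy b F := by
  set φ : ℕ → ℝ := fun i => if h : i < M then bpClauseEnergy b F ⟨i, h⟩ else 0 with hφ
  have h := Cmd.run_loop_real 1 (c := 6) (e := numClauses)
    (p := .seq (prodCmd 6 9 k (unsatExpr (.get 3 (edgeAddr k 6 9))))
    (.setReal 1 (.lit 0) (.add (.var 1) (.div (.mul (.exp (.sub (.lit 0) (.var 2))) (.var 6))
      (.sub (.lit 1) (.mul (.sub (.lit 1) (.exp (.sub (.lit 0) (.var 2)))) (.var 6)))))))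
    (s := s) (fun i f => f 0 = s.real 1 0 + ∑ a ∈ range i, φ a) (by simp) (by
      intro i hi s' hf hc hP
      have hiM : i < M := by
        have : numClauses.eval s = M := hs.clauses
        rwa [this] at hi
      have hprod : ((prodCmd 6 9 k (unsatExpr (.get 3 (edgeAddr k 6 9)))).run s').real 6 0 =
          ∏ p, unsat (bpMessages b F ⟨i, hiM⟩ p) := by
        rw [run_prodCmd (φ := fun p => unsat (s.real 3 (k * i + p)))]
        · refine prod_range_eq_prod_fin fun p => ?_
          rw [hh ⟨i, hiM⟩ p]
        · intro p _ s'' hf' hp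
          simp only [eval_unsatExpr, RExpr.eval, NExpr.eval, edgeAddr, NExpr.eval_smul, hp]
          rw [hf'.nat 6 rfl, hc, hf'.real 3 rfl, hf.real 3 rfl]
      have h2 : ((prodCmd 6 9 k (unsatExpr (.get 3 (edgeAddr k 6 9)))).run s').real 2 0 = b := by
        rw [Cmd.run_real rfl, hf.real 2 rfl, hb]
      have h1 : ((prodCmd 6 9 k (unsatExpr (.get 3 (edgeAddr k 6 9)))).run s').real 1 0 =
          s'.real 1 0 := by rw [Cmd.run_real rfl]
      rw [Cmd.run, Cmd.run, State.writeReal_real_self]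
      simp only [RExpr.eval, NExpr.eval, Function.update_self, hprod, h2, h1]
      rw [hP, sum_range_succ, hφ]
      simp only [dif_pos hiM, bpClauseEnergy_eq, violProb]
      simp [add_assoc])
  have hM : numClauses.eval s = M := hs.clauses
  rw [hM, sum_range] at h
  refine Eq.trans h ?_
  rw [bpEnergy]
  simp [hφ]

/-- The energy at the inverse temperature with index `i * N + j`, for `i` and `j` in the banks `3`
and `4`, is added to the number in bank `1`. Two counters are used as natural numbers cannot be
multiplied in one step. -/
def temperatureCmd (k : ℕ) : Cmd :=
  .seq (.setReal 2 (.lit 0) (.div (.mul (.add (.mul (.ofNat (.var 3)) (.ofNat numVars))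
    (.ofNat (.var 4))) (.var 0)) (.mul (.ofNat numVars) (.ofNat numVars))))
    (.seq (messagesCmd k) (energyCmd k))

lemma run_temperatureCmd {F : Formula k N M} {s : State} (hs : Stores F s)
    (hd : s.nat 11 0 = diameter F) {i j : ℕ} (hi : s.nat 3 0 = i) (hj : s.nat 4 0 = j) :
    ((temperatureCmd k).run s).real 1 0 = s.real 1 0 +
      bpEnergy ((i * N + j : ℕ) * s.real 0 0 / (N : ℝ) ^ 2) F := by
  set p₀ : Cmd := .setReal 2 (.lit 0) (.div (.mul (.add (.mul (.ofNat (.var 3)) (.ofNat numVars))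
    (.ofNat (.var 4))) (.var 0)) (.mul (.ofNat numVars) (.ofNat numVars))) with hp₀
  have hf₀ : p₀.Frame s (p₀.run s) := p₀.frame_run s
  have hs₀ : Stores F (p₀.run s) := hs.of_frame hf₀ rfl rfl rfl
  have hf₁ : (messagesCmd k).Frame (p₀.run s) ((messagesCmd k).run (p₀.run s)) := Cmd.frame_run _ _
  have hb : (p₀.run s).real 2 0 = (i * N + j : ℕ) * s.real 0 0 / (N : ℝ) ^ 2 := by
    simp only [hp₀, Cmd.run, NExpr.eval, RExpr.eval, State.writeReal_real_self,
      Function.update_self, numVars, hs.vars, hi, hj]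
    push_cast
    ring
  have hmsg := run_messagesCmd hs₀ (by rw [hf₀.nat 11 rfl, hd])
  rw [hb] at hmsg
  have h := run_energyCmd (hs₀.of_frame hf₁ rfl rfl rfl) (by rw [hf₁.real 2 rfl, hb]) hmsg
  rw [hf₁.real 1 rfl, hf₀.real 1 rfl] at h
  exact h

/-- The computation of `Φ`, if the diameter of the factor graph is in bank `11`. -/
def logPartitionCmd (k : ℕ) : Cmd :=
  .seq (.setReal 1 (.lit 0) (.lit 0)) (.seq (.loop 3 numVars (.loop 4 numVars (temperatureCmd k)))
    (.setReal 0 (.lit 0) (.sub (.mul (.ofNat numVars) (.log (.lit 2)))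
      (.mul (.div (.var 0) (.mul (.ofNat numVars) (.ofNat numVars))) (.var 1)))))

lemma sum_range_sq (n : ℕ) (f : ℕ → ℝ) :
    ∑ i ∈ range n, ∑ j ∈ range n, f (i * n + j) = ∑ i ∈ range (n ^ 2), f i := by
  have h : ∀ m, ∑ i ∈ range m, ∑ j ∈ range n, f (i * n + j) = ∑ i ∈ range (m * n), f i := by
    intro m
    induction m with
    | zero => simp
    | succ m ih => rw [sum_range_succ, ih, Nat.succ_mul, sum_range_add]
  rw [h, sq]

lemma run_logPartitionCmd {F : Formula k N M} {s : State} (hs : Stores F s)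
    (hd : s.nat 11 0 = diameter F) :
    ((logPartitionCmd k).run s).real 0 0 = bpLogPartition (s.real 0 0) F := by
  set β := s.real 0 0 with hβ
  set p₀ : Cmd := .setReal 1 (.lit 0) (.lit 0) with hp₀
  have hf₀ : p₀.Frame s (p₀.run s) := p₀.frame_run s
  have hs₀ : Stores F (p₀.run s) := hs.of_frame hf₀ rfl rfl rfl
  have hN₀ : numVars.eval (p₀.run s) = N := hs₀.vars
  set E : ℕ → ℝ := fun i => bpEnergy (i * β / (N : ℝ) ^ 2) F with hE
  set p₁ : Cmd := .loop 3 numVars (.loop 4 numVars (temperatureCmd k)) with hp₁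
  have hf₁ : p₁.Frame (p₀.run s) (p₁.run (p₀.run s)) := p₁.frame_run _
  have h := Cmd.run_loop_real 1 (c := 3) (e := numVars) (p := .loop 4 numVars (temperatureCmd k))
    (s := p₀.run s) (fun i f => f 0 = ∑ i ∈ range i, ∑ j ∈ range N, E (i * N + j))
    (by simp [hp₀, Cmd.run, State.writeReal_real_self, RExpr.eval, NExpr.eval]) (by
      intro i _ s' hf hi hP
      have hs' : Stores F s' := hs₀.of_frame hf rfl rfl rfl
      have hN' : numVars.eval s' = N := hs'.vars
      have h2 := Cmd.run_loop_real 1 (c := 4) (e := numVars) (p := temperatureCmd k)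
        (s := s') (fun j f => f 0 = s'.real 1 0 + ∑ j ∈ range j, E (i * N + j)) (by simp) (by
          intro j _ s'' hf' hj hQ
          have hs'' : Stores F s'' := hs'.of_frame hf' rfl rfl rfl
          have h3 := run_temperatureCmd hs'' (by
            rw [hf'.nat 11 rfl, hf.nat 11 rfl, hf₀.nat 11 rfl, hd])
            (i := i) (j := j) (by rw [hf'.nat 3 rfl, hi]) hj
          rw [h3, hQ, sum_range_succ, hf'.real 0 rfl, hf.real 0 rfl, hf₀.real 0 rfl, ← add_assoc])
      rw [hN'] at h2
      refine Eq.trans h2 ?_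
      rw [hP, sum_range_succ])
  rw [hN₀, sum_range_sq] at h
  have hN₁ : numVars.eval (p₁.run (p₀.run s)) = N := by
    rw [← hN₀]
    exact congrFun (hf₁.nat 0 rfl) 0
  have hβ₁ : (p₁.run (p₀.run s)).real 0 0 = β := by rw [hf₁.real 0 rfl, hf₀.real 0 rfl]
  have hrun : (logPartitionCmd k).run s = Cmd.run (.setReal 0 (.lit 0)
      (.sub (.mul (.ofNat numVars) (.log (.lit 2)))
        (.mul (.div (.var 0) (.mul (.ofNat numVars) (.ofNat numVars))) (.var 1))))
      (p₁.run (p₀.run s)) := rfl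
  rw [bpLogPartition, ← mul_sum, ← h, hrun, Cmd.run, State.writeReal_real_self]
  simp only [RExpr.eval, NExpr.eval, Function.update_self]
  rw [hN₁, hβ₁, sq, ← hp₁]
  norm_num

/-! ### The algorithm -/

/-- Belief propagation with interpolation is a polynomial-time algorithm. -/
theorem exists_program (k : ℕ) : ∃ (A : Program) (P : Polynomial ℕ),
    ∀ (N M : ℕ) (β : ℝ) (F : Formula k N M),
      A.OutputsWithin (inputState β F) (P.eval (N + M)) (bpLogPartition β F) := by
  refine ⟨.seq (diameterCmd k).compile (logPartitionCmd k).compile,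
    ((diameterCmd k).time + (logPartitionCmd k).time).comp (.X + .C k), fun N M β F => ?_⟩
  have hs := stores_inputState β F
  set s := inputState β F with hsdef
  set s₁ := (diameterCmd k).run s with hs₁
  have hf : (diameterCmd k).Frame s s₁ := Cmd.frame_run _ _
  have hst₁ : Stores F s₁ := hs.of_frame hf rfl rfl rfl
  have hd : s₁.nat 11 0 = diameter F := run_diameterCmd hs
  have hadm : (diameterCmd k).Admissible [0, 1, 2] = true := rfl
  have hadm' : (logPartitionCmd k).Admissible [0, 1, 2, 11] = true := rfl
  have hnodes := hs.eval_numNodes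
  have hclauses : numClauses.eval s = M := hs.clauses
  have hclauses₁ : numClauses.eval s₁ = M := hst₁.clauses
  have hvars₁ : numVars.eval s₁ = N := hst₁.vars
  have hd₁ : (NExpr.var 11).eval s₁ = diameter F := hd
  have hdle := diameter_le F
  obtain ⟨t, ht, htK⟩ := Cmd.exec_compile hadm (N + M + k) s (by
    intro e he
    have : e = numNodes ∨ e = numClauses ∨ e = .lit k := by
      revert he
      simp only [diameterCmd, distancesCmd, roundCmd, relaxCmd, edgeLoop, Cmd.bounds,
        List.mem_append, List.mem_cons, List.not_mem_nil]
      tauto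
    rcases this with rfl | rfl | rfl
    · omega
    · omega
    · simp only [NExpr.eval]; omega)
  obtain ⟨t', ht', htK'⟩ := Cmd.exec_compile hadm' (N + M + k) s₁ (by
    intro e he
    have : e = numVars ∨ e = numClauses ∨ e = .lit k ∨ e = .var 11 := by
      revert he
      simp only [logPartitionCmd, temperatureCmd, messagesCmd, energyCmd, clauseMessageCmd,
        fieldCmd, fillCmd, prodCmd, sumCmd, edgeLoop, Cmd.bounds, List.mem_append, List.mem_cons,
        List.not_mem_nil]
      tauto
    rcases this with rfl | rfl | rfl | rfl
    · omega
    · omega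
    · simp only [NExpr.eval]; omega
    · omega)
  refine ⟨t + t', (logPartitionCmd k).run s₁, Exec.seq ht ht', ?_, ?_⟩
  · rw [Polynomial.eval_comp, Polynomial.eval_add, Polynomial.eval_add, Polynomial.eval_X,
      Polynomial.eval_C]
    exact add_le_add htK htK'
  · rw [run_logPartitionCmd hst₁ hd, hf.real 0 rfl]
    congr 1

end KSat

theorem theorem1 (k : ℕ) (hk : 2 ≤ k) :
    ∃ (A : RealRAM.Program) (P : Polynomial ℕ),
      (∀ (N M : ℕ) (β : ℝ) (F : KSat.Formula k N M),
        A.OutputsWithin (KSat.inputState β F) (P.eval (N + M)) (KSat.bpLogPartition β F)) ∧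
      ∀ ε α : ℝ, 0 < ε → 0 ≤ α → α < KSat.alphaStar k →
        ∃ δ : ℝ, 0 < δ ∧
          ∀ β : ℕ → ℝ, (∀ N : ℕ, β N ∈ Set.Icc (0 : ℝ) ((N : ℝ) ^ δ)) →
            Tendsto
              (fun N : ℕ => KSat.prob k N ⌊α * N⌋₊ fun F =>
                KSat.bpLogPartition (β N) F * (1 - ε) ≤
                    Real.log (KSat.partitionFunction (β N) F) ∧
                  Real.log (KSat.partitionFunction (β N) F) ≤
                    KSat.bpLogPartition (β N) F * (1 + ε))
              atTop (𝓝 1) := by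
  obtain ⟨A, P, h⟩ := KSat.exists_program k
  exact ⟨A, P, h, fun _ _ hε hα hα1 => KSat.tendsto_prob_bpLogPartition hk hε hα hα1⟩
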